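/- We work in homotopy type theory (HoTT): dependent type theory with a hierarchy of univalent universes, function extensionality and propositional truncation, without excluded middle, choice or propositional resizing. Let $\mathsf{Prop}$ be the type of propositions (types with at most one element) in a fixed but arbitrary universe, write $\exists x.\,A(x)$ for the propositional truncation of $\Sigma x.\,A(x)$, and let $\mathbf 2=\{0,1\}$. Let $\mathsf{Brw}$, together with a relation ${\le}$ on it, be the quotient inductive-inductive type of Brouwer trees. It is generated by $\mathsf{zero}:\mathsf{Brw}$; $\mathsf{suc}:\mathsf{Brw}\to\mathsf{Brw}$; a limit $\mathsf{lim}\,f:\mathsf{Brw}$ for each $f:\mathbb N\to\mathsf{Brw}$ that is strictly increasing, i.e. $\mathsf{suc}(f_n)\le f_{n+1}$ for all $n$; an equality $\mathsf{lim}\,f=\mathsf{lim}\,g$ whenever $\forall k.\exists n.\,f_k\le g_n$ and $\forall k.\exists n.\,g_k\le f_n$; and the requirement that $\mathsf{Brw}$ is a set. The relation $\le$ is generated by: $\mathsf{zero}\le x$; transitivity; $x\le y\to\mathsf{suc}\,x\le\mathsf{suc}\,y$; $x\le f_k\to x\le\mathsf{lim}\,f$; $(\forall k.\,f_k\le x)\to\mathsf{lim}\,f\le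 x$; and the requirement that each $x\le y$ is a proposition. For $x:\mathsf{Brw}$ let $x+\omega$ be the limit of the sequence $k\mapsto\mathsf{suc}^k x$; let $\omega\cdot 0=\mathsf{zero}$ and $\omega\cdot(n+1)=\omega\cdot n+\omega$; and let $\omega^2$ be the limit of the sequence $n\mapsto\omega\cdot n$. A proposition $P$ is *semidecidable* if $\exists s:\mathbb N\to\mathbf 2.\,(P\leftrightarrow\exists i.\,s_i=1)$. For $\alpha:\mathsf{Brw}$, it is *$\alpha$-decidable* if $\exists y:\mathsf{Brw}.\,(P\leftrightarrow\alpha\le y)$. **Theorem.** The following is provable in HoTT. 1. If $P:\mathbb N\times\mathbb N\to\mathsf{Prop}$ is a family of semidecidable propositions such that $P(n,m)\to P(n,m+1)$ for all $m$ and $n$, then the proposition $\exists m.\,\forall n.\,P(n,m)$ is $(\omega^2+\omega)$-decidable. 2. In particular, the existence of a counterexample to the twin prime conjecture, i.e. the proposition that there exists $m:\mathbb N$ such that for every $n\ge m$ the numbers $n$ and $n+2$ are not both prime, is $(\omega^2+\omega)$-decidable. -/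

import Mathlib

/-!
The result is a theorem of homotopy type theory, without excluded middle and without choice. In Lean
every proposition is decidable, so a reading of it on Lean's own propositions would be void. We
therefore define the formal system and state that the types which express the result are inhabited
in it. The system is the type theory of the HoTT book: a cumulative hierarchy of Russell universes,
function types with `β` and `η`, the usual inductive types, function extensionality, univalence and
propositional truncation; to these we add the quotient inductive-inductive type `Brw` of Brouwer
trees with its order. Type formers and eliminators are constants with closed types; they are
polymorphic in explicit universe levels.
-/

namespace HoTT

/-! ### Raw terms -/

/-- The constants of the theory. The numbers are universe levels. -/
inductive Const : Type
  -- dependent pairs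
  | sig (i : ℕ) | pair (i : ℕ) | sigInd (i j : ℕ)
  -- disjoint sums
  | sum (i : ℕ) | inl (i : ℕ) | inr (i : ℕ) | sumInd (i j : ℕ)
  -- the empty type, the unit type, the booleans, the natural numbers
  | empty | emptyInd (j : ℕ)
  | unit | star | unitInd (j : ℕ)
  | bool | ff | tt | boolInd (j : ℕ)
  | nat | zero | succ | natInd (j : ℕ)
  -- identity types
  | id (i : ℕ) | refl (i : ℕ) | idInd (i j : ℕ)
  -- function extensionality and univalence
  | funext (i : ℕ) | univalence (i : ℕ)
  -- propositional truncation
  | trunc (i : ℕ) | truncIn (i : ℕ) | truncProp (i : ℕ) | truncRec (i j : ℕ)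
  -- Brouwer trees and their order
  | brw | le
  | bzero | bsuc | blim | bisim | brwSet
  | leZero | leTrans | leSuc | leCocone | leLimiting | leProp
  | brwInd (i j : ℕ) | leInd (i j : ℕ)

/-- Raw terms, with de Bruijn indices. In `pi A B` and `lam A b` the last argument is under a
binder of type `A`. -/
inductive Tm : Type
  | var (n : ℕ)
  | univ (i : ℕ)
  | pi (A B : Tm)
  | lam (A b : Tm)
  | app (f a : Tm)
  | con (c : Const)

instance : CoeFun Tm (fun _ => Tm → Tm) := ⟨Tm.app⟩

/-- A renaming, moved under a binder. -/
def upRen (r : ℕ → ℕ) : ℕ → ℕ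
  | 0 => 0
  | n + 1 => r n + 1

/-- Renaming of variables. -/
def Tm.rename : (ℕ → ℕ) → Tm → Tm
  | r, .var n => .var (r n)
  | _, .univ i => .univ i
  | r, .pi A B => .pi (A.rename r) (B.rename (upRen r))
  | r, .lam A b => .lam (A.rename r) (b.rename (upRen r))
  | r, .app f a => .app (f.rename r) (a.rename r)
  | _, .con c => .con c

/-- Weakening by one variable. -/
def Tm.wk (t : Tm) : Tm := t.rename (fun n => n + 1)

/-- A substitution, moved under a binder. -/
def upSub (s : ℕ → Tm) : ℕ → Tm
  | 0 => .var 0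
  | n + 1 => (s n).wk

/-- Simultaneous (capture-avoiding) substitution. -/
def Tm.subst : (ℕ → Tm) → Tm → Tm
  | s, .var n => s n
  | _, .univ i => .univ i
  | s, .pi A B => .pi (A.subst s) (B.subst (upSub s))
  | s, .lam A b => .lam (A.subst s) (b.subst (upSub s))
  | s, .app f a => .app (f.subst s) (a.subst s)
  | _, .con c => .con c

/-- The substitution that replaces variable `0` by `a` and lowers the others. -/
def instSub (a : Tm) : ℕ → Tm
  | 0 => a
  | n + 1 => .var n

/-- `b.inst a` is `b` with variable `0` replaced by `a`. -/
def Tm.inst (b a : Tm) : Tm := b.subst (instSub a)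

/-! ### Writing closed terms with named variables

An `Exp` yields, for each number `d` of enclosing binders, a raw term. The binders below are used
with Lean's `fun x => …`, so that closed terms can be written with names; `Exp.close` turns them into
de Bruijn terms. Application is written as juxtaposition. -/

structure Exp : Type where
  atDepth : ℕ → Tm

namespace Exp

def close (e : Exp) : Tm := e.atDepth 0

def univ (i : ℕ) : Exp := ⟨fun _ => .univ i⟩

def con (c : Const) : Exp := ⟨fun _ => .con c⟩

def app (f a : Exp) : Exp := ⟨fun d => .app (f.atDepth d) (a.atDepth d)⟩

/-- The variable bound by the binder that stands below `d` other binders. -/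
def bound (d : ℕ) : Exp := ⟨fun e => .var (e - (d + 1))⟩

def pi (A : Exp) (B : Exp → Exp) : Exp :=
  ⟨fun d => .pi (A.atDepth d) ((B (bound d)).atDepth (d + 1))⟩

def lam (A : Exp) (b : Exp → Exp) : Exp :=
  ⟨fun d => .lam (A.atDepth d) ((b (bound d)).atDepth (d + 1))⟩

end Exp

instance : CoeFun Exp (fun _ => Exp → Exp) := ⟨Exp.app⟩

open Exp (univ con pi lam)

/-! ### Derived notions of the type theory -/

/-- `A → B` -/
def arr (A B : Exp) : Exp := pi A fun _ => B

/-- `Σ x : A, B x` -/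
def sig (i : ℕ) (A : Exp) (B : Exp → Exp) : Exp := con (.sig i) A (lam A B)

/-- `A × B` -/
def prod (i : ℕ) (A B : Exp) : Exp := sig i A fun _ => B

/-- The pair `(a, b) : Σ x : A, B x` -/
def pair (i : ℕ) (A : Exp) (B : Exp → Exp) (a b : Exp) : Exp := con (.pair i) A (lam A B) a b

def fst (i : ℕ) (A : Exp) (B : Exp → Exp) (p : Exp) : Exp :=
  con (.sigInd i i) A (lam A B) (lam (sig i A B) fun _ => A)
    (lam A fun a => lam (B a) fun _ => a) p

def snd (i : ℕ) (A : Exp) (B : Exp → Exp) (p : Exp) : Exp :=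
  con (.sigInd i i) A (lam A B) (lam (sig i A B) fun q => B (fst i A B q))
    (lam A fun a => lam (B a) fun b => b) p

/-- The identity type `a = b` of the type `A : U i` -/
def eq (i : ℕ) (A a b : Exp) : Exp := con (.id i) A a b

/-- Transport along `p : x = y` in a family `C : A → U j`, applied to `u : C x` -/
def transport (i j : ℕ) (A C x y p u : Exp) : Exp :=
  con (.idInd i j) A
    (lam A fun x => lam A fun y => lam (eq i A x y) fun _ => arr (C x) (C y))
    (lam A fun x => lam (C x) fun u => u) x y p u

def isProp (i : ℕ) (A : Exp) : Exp := pi A fun x => pi A fun y => eq i A x y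

def isSet (i : ℕ) (A : Exp) : Exp := pi A fun x => pi A fun y => isProp i (eq i A x y)

/-- `f : A → B` has a right inverse and a left inverse (a bi-invertible map). -/
def isEquiv (i : ℕ) (A B f : Exp) : Exp :=
  prod i
    (sig i (arr B A) fun g => pi B fun b => eq i B (f (g b)) b)
    (sig i (arr B A) fun h => pi A fun a => eq i A (h (f a)) a)

/-- `A ≃ B` -/
def equiv (i : ℕ) (A B : Exp) : Exp := sig i (arr A B) fun f => isEquiv i A B f

/-- The identity equivalence of `A` -/
def idEquiv (i : ℕ) (A : Exp) : Exp :=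
  let inv : Exp → Exp := fun k => pi A fun a => eq i A (k a) a
  let one : Exp := lam A fun a => a
  let half : Exp := pair i (arr A A) inv one (lam A fun a => con (.refl i) A a)
  pair i (arr A A) (fun f => isEquiv i A A f) one
    (pair i (sig i (arr A A) inv) (fun _ => sig i (arr A A) inv) half half)

/-- The canonical map `(A = B) → (A ≃ B)` for `A B : U i` -/
def idToEquiv (i : ℕ) (A B : Exp) : Exp :=
  lam (eq (i + 1) (univ i) A B) fun p =>
    con (.idInd (i + 1) i) (univ i)
      (lam (univ i) fun A => lam (univ i) fun B => lam (eq (i + 1) (univ i) A B) fun _ =>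
        equiv i A B)
      (lam (univ i) fun A => idEquiv i A) A B p

/-- The canonical map `(f = g) → Π x, f x = g x` for `f g : Π x : A, B x` -/
def happly (i : ℕ) (A B f g : Exp) : Exp :=
  let F : Exp := pi A fun x => B x
  lam (eq i F f g) fun p =>
    con (.idInd i i) F
      (lam F fun f => lam F fun g => lam (eq i F f g) fun _ =>
        pi A fun x => eq i (B x) (f x) (g x))
      (lam F fun f => lam A fun x => con (.refl i) (B x) (f x)) f g p

/-- `∃ x : A, B x`, the truncation of the type of pairs -/
def exist (i : ℕ) (A : Exp) (B : Exp → Exp) : Exp := con (.trunc i) (sig i A B)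

/-- `P ↔ Q` -/
def iff (i : ℕ) (P Q : Exp) : Exp := prod i (arr P Q) (arr Q P)

def empty : Exp := con .empty
def bool : Exp := con .bool
def nat : Exp := con .nat
def succ (n : Exp) : Exp := con .succ n
def brw : Exp := con .brw
def bzero : Exp := con .bzero
def bsuc (x : Exp) : Exp := con .bsuc x

/-- The order `x ≤ y` of Brouwer trees -/
def le (x y : Exp) : Exp := con .le x y

/-- `x < y`, by definition `suc x ≤ y` -/
def lt (x y : Exp) : Exp := le (bsuc x) y

/-- The sequence `f : ℕ → Brw` is strictly increasing. -/
def increasing (f : Exp) : Exp := pi nat fun n => lt (f n) (f (succ n))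

/-- The limit of the sequence `f`, where `p : increasing f` -/
def blim (f p : Exp) : Exp := con .blim f p

/-- `f` is simulated by `g`: every `f k` is below some `g n`. -/
def simulated (f g : Exp) : Exp := pi nat fun k => exist 0 nat fun n => le (f k) (g n)

/-! ### The types of the constants -/

/-- The data for an induction on Brouwer trees and their order, as a telescope in front of a type
`K`: a family `C` over `Brw`, a family `D` over `≤` (which may mention the values in `C`), and one
method for each constructor. The first five constructors are those of `Brw`, the other six those
of `≤`. The method for a constructor that says that a type is a set or a proposition says that
about `C` or `D`. -/
def brwTelescope (i j : ℕ)
    (K : (C D mz ms ml mb mset nz nt ns nc nl nprop : Exp) → Exp) : Exp :=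
  pi (arr brw (univ i)) fun C =>
  pi (pi brw fun x => pi brw fun y => arr (C x) (arr (C y) (arr (le x y) (univ j)))) fun D =>
  -- zero
  pi (C bzero) fun mz =>
  -- successor
  pi (pi brw fun x => arr (C x) (C (bsuc x))) fun ms =>
  -- `incrOver f p cf` says that the values `cf n : C (f n)` are increasing in the sense of `D`
  let incrOver : Exp → Exp → Exp → Exp := fun f p cf =>
    pi nat fun n => D (bsuc (f n)) (f (succ n)) (ms (f n) (cf n)) (cf (succ n)) (p n)
  -- limit of a strictly increasing sequence
  pi (pi (arr nat brw) fun f => pi (increasing f) fun p =>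
      pi (pi nat fun n => C (f n)) fun cf => arr (incrOver f p cf) (C (blim f p))) fun ml =>
  -- `simOver f cf g cg` says that `f` is simulated by `g` in such a way that `D` holds
  let simOver : Exp → Exp → Exp → Exp → Exp := fun f cf g cg =>
    pi nat fun k => exist j nat fun n =>
      sig j (le (f k) (g n)) fun e => D (f k) (g n) (cf k) (cg n) e
  -- bisimilar sequences have equal limits
  pi (pi (arr nat brw) fun f => pi (increasing f) fun p =>
      pi (pi nat fun n => C (f n)) fun cf => pi (incrOver f p cf) fun cp =>
      pi (arr nat brw) fun g => pi (increasing g) fun q =>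
      pi (pi nat fun n => C (g n)) fun cg => pi (incrOver g q cg) fun cq =>
      pi (simulated f g) fun u => pi (simulated g f) fun v =>
      arr (simOver f cf g cg) (arr (simOver g cg f cf)
        (eq i (C (blim g q))
          (transport 0 i brw C (blim f p) (blim g q) (con .bisim f p g q u v) (ml f p cf cp))
          (ml g q cg cq)))) fun mb =>
  -- `Brw` is a set
  pi (pi brw fun x => isSet i (C x)) fun mset =>
  -- zero is least
  pi (pi brw fun x => pi (C x) fun cx => D bzero x mz cx (con .leZero x)) fun nz =>
  -- transitivity
  pi (pi brw fun x => pi brw fun y => pi brw fun z =>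
      pi (C x) fun cx => pi (C y) fun cy => pi (C z) fun cz =>
      pi (le x y) fun e => pi (le y z) fun e' =>
      arr (D x y cx cy e) (arr (D y z cy cz e')
        (D x z cx cz (con .leTrans x y z e e')))) fun nt =>
  -- the successor is monotone
  pi (pi brw fun x => pi brw fun y => pi (C x) fun cx => pi (C y) fun cy =>
      pi (le x y) fun e => arr (D x y cx cy e)
        (D (bsuc x) (bsuc y) (ms x cx) (ms y cy) (con .leSuc x y e))) fun ns =>
  -- limits are upper bounds
  pi (pi brw fun x => pi (C x) fun cx =>
      pi (arr nat brw) fun f => pi (increasing f) fun p =>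
      pi (pi nat fun n => C (f n)) fun cf => pi (incrOver f p cf) fun cp =>
      pi nat fun k => pi (le x (f k)) fun e => arr (D x (f k) cx (cf k) e)
        (D x (blim f p) cx (ml f p cf cp) (con .leCocone x f p k e))) fun nc =>
  -- limits are least upper bounds
  pi (pi (arr nat brw) fun f => pi (increasing f) fun p =>
      pi (pi nat fun n => C (f n)) fun cf => pi (incrOver f p cf) fun cp =>
      pi brw fun x => pi (C x) fun cx =>
      pi (pi nat fun k => le (f k) x) fun e =>
      arr (pi nat fun k => D (f k) x (cf k) cx (e k))
        (D (blim f p) x (ml f p cf cp) cx (con .leLimiting f p x e))) fun nl =>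
  -- `≤` is valued in propositions
  pi (pi brw fun x => pi brw fun y => pi (C x) fun cx => pi (C y) fun cy =>
      pi (le x y) fun e => isProp j (D x y cx cy e)) fun nprop =>
  K C D mz ms ml mb mset nz nt ns nc nl nprop

/-- The (closed) type of each constant, in named form. -/
def constExp : Const → Exp
  | .sig i => pi (univ i) fun A => arr (arr A (univ i)) (univ i)
  | .pair i => pi (univ i) fun A => pi (arr A (univ i)) fun B =>
      pi A fun a => arr (B a) (con (.sig i) A B)
  | .sigInd i j => pi (univ i) fun A => pi (arr A (univ i)) fun B =>
      pi (arr (con (.sig i) A B) (univ j)) fun C =>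
      arr (pi A fun a => pi (B a) fun b => C (con (.pair i) A B a b))
        (pi (con (.sig i) A B) fun p => C p)
  | .sum i => arr (univ i) (arr (univ i) (univ i))
  | .inl i => pi (univ i) fun A => pi (univ i) fun B => arr A (con (.sum i) A B)
  | .inr i => pi (univ i) fun A => pi (univ i) fun B => arr B (con (.sum i) A B)
  | .sumInd i j => pi (univ i) fun A => pi (univ i) fun B =>
      pi (arr (con (.sum i) A B) (univ j)) fun C =>
      arr (pi A fun a => C (con (.inl i) A B a)) <|
      arr (pi B fun b => C (con (.inr i) A B b)) <|
        pi (con (.sum i) A B) fun s => C s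
  | .empty => univ 0
  | .emptyInd j => pi (arr empty (univ j)) fun C => pi empty fun e => C e
  | .unit => univ 0
  | .star => con .unit
  | .unitInd j => pi (arr (con .unit) (univ j)) fun C =>
      arr (C (con .star)) (pi (con .unit) fun x => C x)
  | .bool => univ 0
  | .ff => bool
  | .tt => bool
  | .boolInd j => pi (arr bool (univ j)) fun C =>
      arr (C (con .ff)) (arr (C (con .tt)) (pi bool fun x => C x))
  | .nat => univ 0
  | .zero => nat
  | .succ => arr nat nat
  | .natInd j => pi (arr nat (univ j)) fun C =>
      arr (C (con .zero)) (arr (pi nat fun n => arr (C n) (C (succ n))) (pi nat fun n => C n))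
  | .id i => pi (univ i) fun A => arr A (arr A (univ i))
  | .refl i => pi (univ i) fun A => pi A fun a => eq i A a a
  | .idInd i j => pi (univ i) fun A =>
      pi (pi A fun x => pi A fun y => arr (eq i A x y) (univ j)) fun C =>
      arr (pi A fun x => C x x (con (.refl i) A x))
        (pi A fun x => pi A fun y => pi (eq i A x y) fun p => C x y p)
  | .funext i => pi (univ i) fun A => pi (arr A (univ i)) fun B =>
      pi (pi A fun x => B x) fun f => pi (pi A fun x => B x) fun g =>
      isEquiv i (eq i (pi A fun x => B x) f g) (pi A fun x => eq i (B x) (f x) (g x))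
        (happly i A B f g)
  | .univalence i => pi (univ i) fun A => pi (univ i) fun B =>
      isEquiv (i + 1) (eq (i + 1) (univ i) A B) (equiv i A B) (idToEquiv i A B)
  | .trunc i => arr (univ i) (univ i)
  | .truncIn i => pi (univ i) fun A => arr A (con (.trunc i) A)
  | .truncProp i => pi (univ i) fun A => isProp i (con (.trunc i) A)
  | .truncRec i j => pi (univ i) fun A => pi (univ j) fun B =>
      arr (isProp j B) (arr (arr A B) (arr (con (.trunc i) A) B))
  | .brw => univ 0
  | .le => arr brw (arr brw (univ 0))
  | .bzero => brw
  | .bsuc => arr brw brw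
  | .blim => pi (arr nat brw) fun f => arr (increasing f) brw
  | .bisim => pi (arr nat brw) fun f => pi (increasing f) fun p =>
      pi (arr nat brw) fun g => pi (increasing g) fun q =>
      arr (simulated f g) (arr (simulated g f) (eq 0 brw (blim f p) (blim g q)))
  | .brwSet => isSet 0 brw
  | .leZero => pi brw fun x => le bzero x
  | .leTrans => pi brw fun x => pi brw fun y => pi brw fun z =>
      arr (le x y) (arr (le y z) (le x z))
  | .leSuc => pi brw fun x => pi brw fun y => arr (le x y) (le (bsuc x) (bsuc y))
  | .leCocone => pi brw fun x => pi (arr nat brw) fun f => pi (increasing f) fun p =>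
      pi nat fun k => arr (le x (f k)) (le x (blim f p))
  | .leLimiting => pi (arr nat brw) fun f => pi (increasing f) fun p => pi brw fun x =>
      arr (pi nat fun k => le (f k) x) (le (blim f p) x)
  | .leProp => pi brw fun x => pi brw fun y => isProp 0 (le x y)
  | .brwInd i j => brwTelescope i j fun C _ _ _ _ _ _ _ _ _ _ _ _ => pi brw fun x => C x
  | .leInd i j => brwTelescope i j fun C D mz ms ml mb mset nz nt ns nc nl nprop =>
      let val : Exp → Exp := fun x =>
        con (.brwInd i j) C D mz ms ml mb mset nz nt ns nc nl nprop x
      pi brw fun x => pi brw fun y => pi (le x y) fun e => D x y (val x) (val y) e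

/-- The (closed) type of each constant. -/
def constType (c : Const) : Tm := (constExp c).close

/-! ### Judgmental equality and typing -/

/-- The constant `c` (one of the two eliminators for Brouwer trees) with all its methods -/
def brwSpine (c : Const) (C D mz ms ml mb mset nz nt ns nc nl nprop : Tm) : Tm :=
  Tm.con c C D mz ms ml mb mset nz nt ns nc nl nprop

/-- Judgmental equality: the congruence generated by `β` and `η` for functions and by the
computation rules of the inductive types on their point constructors. -/
inductive Conv : Tm → Tm → Prop
  | refl (t : Tm) : Conv t t
  | symm {t u : Tm} : Conv t u → Conv u t
  | trans {t u v : Tm} : Conv t u → Conv u v → Conv t v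
  | pi {A A' B B' : Tm} : Conv A A' → Conv B B' → Conv (.pi A B) (.pi A' B')
  | lam {A A' b b' : Tm} : Conv A A' → Conv b b' → Conv (.lam A b) (.lam A' b')
  | app {f f' a a' : Tm} : Conv f f' → Conv a a' → Conv (f a) (f' a')
  | beta (A b a : Tm) : Conv ((Tm.lam A b) a) (b.inst a)
  | eta (A f : Tm) : Conv (.lam A (f.wk (.var 0))) f
  | sigPair (i j : ℕ) (A B C d A' B' a b : Tm) :
      Conv (Tm.con (.sigInd i j) A B C d (Tm.con (.pair i) A' B' a b)) (d a b)
  | sumInl (i j : ℕ) (A B C d e A' B' a : Tm) :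
      Conv (Tm.con (.sumInd i j) A B C d e (Tm.con (.inl i) A' B' a)) (d a)
  | sumInr (i j : ℕ) (A B C d e A' B' b : Tm) :
      Conv (Tm.con (.sumInd i j) A B C d e (Tm.con (.inr i) A' B' b)) (e b)
  | unitStar (j : ℕ) (C d : Tm) : Conv (Tm.con (.unitInd j) C d (Tm.con .star)) d
  | boolFf (j : ℕ) (C d e : Tm) : Conv (Tm.con (.boolInd j) C d e (Tm.con .ff)) d
  | boolTt (j : ℕ) (C d e : Tm) : Conv (Tm.con (.boolInd j) C d e (Tm.con .tt)) e
  | natZero (j : ℕ) (C d e : Tm) : Conv (Tm.con (.natInd j) C d e (Tm.con .zero)) d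
  | natSucc (j : ℕ) (C d e n : Tm) :
      Conv (Tm.con (.natInd j) C d e (Tm.con .succ n)) (e n (Tm.con (.natInd j) C d e n))
  | idRefl (i j : ℕ) (A C d x y A' a : Tm) :
      Conv (Tm.con (.idInd i j) A C d x y (Tm.con (.refl i) A' a)) (d a)
  | truncIn (i j : ℕ) (A B h f A' a : Tm) :
      Conv (Tm.con (.truncRec i j) A B h f (Tm.con (.truncIn i) A' a)) (f a)
  | brwZero (i j : ℕ) (C D mz ms ml mb mset nz nt ns nc nl nprop : Tm) :
      Conv (brwSpine (.brwInd i j) C D mz ms ml mb mset nz nt ns nc nl nprop (Tm.con .bzero)) mz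
  | brwSuc (i j : ℕ) (C D mz ms ml mb mset nz nt ns nc nl nprop x : Tm) :
      Conv (brwSpine (.brwInd i j) C D mz ms ml mb mset nz nt ns nc nl nprop (Tm.con .bsuc x))
        (ms x (brwSpine (.brwInd i j) C D mz ms ml mb mset nz nt ns nc nl nprop x))
  | brwLim (i j : ℕ) (C D mz ms ml mb mset nz nt ns nc nl nprop f p : Tm) :
      Conv (brwSpine (.brwInd i j) C D mz ms ml mb mset nz nt ns nc nl nprop (Tm.con .blim f p))
        (ml f p
          (.lam (.con .nat)
            ((brwSpine (.brwInd i j) C D mz ms ml mb mset nz nt ns nc nl nprop).wk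
              (f.wk (.var 0))))
          (.lam (.con .nat)
            ((brwSpine (.leInd i j) C D mz ms ml mb mset nz nt ns nc nl nprop).wk
              (Tm.con .bsuc (f.wk (.var 0))) (f.wk (Tm.con .succ (.var 0))) (p.wk (.var 0)))))

/-- Typing. A context is the list of the types of its variables, the latest variable first. The
universes are cumulative, and `A` is a type when `A : U i` for some `i`. Only contexts that consist
of types can be reached from the empty context. -/
inductive HasType : List Tm → Tm → Tm → Prop
  | var {Γ : List Tm} {n : ℕ} {A : Tm} : Γ[n]? = some A →
      HasType Γ (.var n) (A.rename fun k => k + (n + 1))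
  | con {Γ : List Tm} (c : Const) : HasType Γ (.con c) (constType c)
  | univ {Γ : List Tm} (i : ℕ) : HasType Γ (.univ i) (.univ (i + 1))
  | cumul {Γ : List Tm} {A : Tm} {i : ℕ} :
      HasType Γ A (.univ i) → HasType Γ A (.univ (i + 1))
  | pi {Γ : List Tm} {A B : Tm} {i : ℕ} :
      HasType Γ A (.univ i) → HasType (A :: Γ) B (.univ i) → HasType Γ (.pi A B) (.univ i)
  | lam {Γ : List Tm} {A B b : Tm} {i : ℕ} :
      HasType Γ A (.univ i) → HasType (A :: Γ) b B → HasType Γ (.lam A b) (.pi A B)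
  | app {Γ : List Tm} {A B f a : Tm} :
      HasType Γ f (.pi A B) → HasType Γ a A → HasType Γ (f a) (B.inst a)
  | conv {Γ : List Tm} {A B t : Tm} {i : ℕ} :
      HasType Γ t A → Conv A B → HasType Γ B (.univ i) → HasType Γ t B

/-- The closed type `T` is inhabited: homotopy type theory proves `T`. -/
def Provable (T : Exp) : Prop := ∃ t : Tm, HasType [] t T.close

/-! ### The ordinal `ω² + ω`

A sequence is accepted by the limit constructor only with a proof that it is strictly increasing.
To have these proofs at hand, ordinals are here paired with a proof of `x ≤ x`. -/

/-- The type of pairs of an ordinal `x` and a proof of `x ≤ x` -/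
def ord : Exp := sig 0 brw fun x => le x x

def ordVal (u : Exp) : Exp := fst 0 brw (fun x => le x x) u

def ordRefl (u : Exp) : Exp := snd 0 brw (fun x => le x x) u

def ordMk (x r : Exp) : Exp := pair 0 brw (fun x => le x x) x r

/-- `x + k`, the `k`-fold successor of `x` -/
def addNat (x k : Exp) : Exp :=
  con (.natInd 0) (lam nat fun _ => brw) x (lam nat fun _ => lam brw fun y => bsuc y) k

/-- `x + k ≤ x + k`, for the ordinal `x` of `u` -/
def addNatRefl (u k : Exp) : Exp :=
  con (.natInd 0) (lam nat fun k => le (addNat (ordVal u) k) (addNat (ordVal u) k)) (ordRefl u)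
    (lam nat fun k => lam (le (addNat (ordVal u) k) (addNat (ordVal u) k)) fun e =>
      con .leSuc (addNat (ordVal u) k) (addNat (ordVal u) k) e) k

/-- The function that maps a strictly increasing sequence `f` with proofs of `f k ≤ f k` to its
limit, with a proof of `lim f ≤ lim f` -/
def ordLim : Exp :=
  lam (arr nat brw) fun f => lam (increasing f) fun p => lam (pi nat fun k => le (f k) (f k)) fun r =>
    ordMk (blim f p)
      (con .leLimiting f p (blim f p) (lam nat fun k => con .leCocone (f k) f p k (r k)))

/-- The function that maps `x` to `x + ω`, the limit of the sequence `x + k` -/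
def addOmega : Exp :=
  lam ord fun u =>
    ordLim (lam nat fun k => addNat (ordVal u) k) (lam nat fun k => addNatRefl u (succ k))
      (lam nat fun k => addNatRefl u k)

/-- A proof of `x < x + ω`, since `suc x` is the member `x + 1` of the sequence with limit
`x + ω` -/
def ltAddOmega : Exp :=
  lam ord fun u =>
    con .leCocone (bsuc (ordVal u)) (lam nat fun k => addNat (ordVal u) k)
      (lam nat fun k => addNatRefl u (succ k)) (succ (con .zero))
      (addNatRefl u (succ (con .zero)))

/-- The sequence `n ↦ ω · n`, that is `ω · 0 = 0` and `ω · (n + 1) = ω · n + ω` -/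
def omegaMul : Exp :=
  con (.natInd 0) (lam nat fun _ => ord) (ordMk bzero (con .leZero bzero))
    (lam nat fun _ => addOmega)

/-- `ω² = ω · ω`, the limit of the sequence `ω · n` -/
def omegaSq : Exp :=
  ordLim (lam nat fun n => ordVal (omegaMul n)) (lam nat fun n => ltAddOmega (omegaMul n))
    (lam nat fun n => ordRefl (omegaMul n))

/-- `ω² + ω : Brw` -/
def omegaSqAddOmega : Exp := ordVal (addOmega omegaSq)

/-! ### Decidability -/

/-- `Prop`, the type of propositions in the universe `U i` -/
def hProp (i : ℕ) : Exp := sig (i + 1) (univ i) fun X => isProp i X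

/-- The type that underlies `P : Prop` -/
def holds (i : ℕ) (P : Exp) : Exp := fst (i + 1) (univ i) (fun X => isProp i X) P

/-- `P` is semidecidable: `∃ s : ℕ → 2, (P ↔ ∃ k, s k = 1)`. -/
def isSemiDec (i : ℕ) (P : Exp) : Exp :=
  exist i (arr nat bool) fun s => iff i P (exist 0 nat fun k => eq 0 bool (s k) (con .tt))

/-- `P` is `α`-decidable: `∃ y : Brw, (P ↔ α ≤ y)`. -/
def isOrdDec (i : ℕ) (α P : Exp) : Exp := exist i brw fun y => iff i P (le α y)

/-- For all `P : ℕ × ℕ → Prop`, if every `P (n, m)` is semidecidable and `P (n, m)` always implies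
`P (n, m + 1)`, then `∃ m, ∀ n, P (n, m)` is `(ω² + ω)`-decidable. Here `Prop` is the type of
propositions in `U i`. -/
def existsForallOrdDec (i : ℕ) : Exp :=
  pi (arr (prod 0 nat nat) (hProp i)) fun P =>
    let Q : Exp → Exp → Exp := fun n m => holds i (P (pair 0 nat (fun _ => nat) n m))
    arr (pi nat fun n => pi nat fun m => isSemiDec i (Q n m)) <|
    arr (pi nat fun n => pi nat fun m => arr (Q n m) (Q n (succ m))) <|
      isOrdDec i omegaSqAddOmega (exist i nat fun m => pi nat fun n => Q n m)

/-! ### Twin primes -/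

def natAdd (a b : Exp) : Exp :=
  con (.natInd 0) (lam nat fun _ => nat) a (lam nat fun _ => lam nat fun r => succ r) b

def natMul (a b : Exp) : Exp :=
  con (.natInd 0) (lam nat fun _ => nat) (con .zero)
    (lam nat fun _ => lam nat fun r => natAdd r a) b

/-- `a ≤ b` for natural numbers -/
def natLe (a b : Exp) : Exp := sig 0 nat fun k => eq 0 nat (natAdd a k) b

def neg (A : Exp) : Exp := arr A empty

def two : Exp := succ (succ (con .zero))

/-- `p` is prime: `p ≥ 2`, and `p` is not a product of two numbers `≥ 2`. -/
def isPrime (p : Exp) : Exp :=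
  prod 0 (natLe two p)
    (pi nat fun a => pi nat fun b =>
      arr (natLe two a) (arr (natLe two b) (neg (eq 0 nat (natMul a b) p))))

/-- There is a counterexample to the twin prime conjecture: a number `m` such that for no `n ≥ m`
both `n` and `n + 2` are prime. -/
def twinPrimeCounterexample : Exp :=
  exist 0 nat fun m => pi nat fun n =>
    arr (natLe m n) (neg (prod 0 (isPrime n) (isPrime (natAdd n two))))

end HoTT

namespace HoTT

open Exp (univ con pi lam)

/-! ### Metatheory of renaming and substitution -/

/-! Fix `m`, let `P n` stand for `P (n, m)`, and let `O k = ω · k`. For every `k` there is a limit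
`Z k` whose predecessors are those of the largest `ω · (j + 1)` with `j ≤ k` such that `P 0, …, P (j
- 1)` hold. No case distinction on the `P n` is needed. Let `z = lim f` be below `x`, and let a
weakly increasing Boolean sequence `c` semidecide `A`. The sequence that takes the value `f k` while
`c k = 0` and the value `x + k` once `c k = 1` is strictly increasing, and its limit has the
predecessors of `z`, joined by those of `x + ω` if `A` holds (`stepPf`). Iterate this with `x = ω ·
(k + 1)` and `A = P 0 ∧ ⋯ ∧ P k`.

Semidecidability provides `c` only under a truncation, and countable choice is absent. But limits
below each other are bisimilar, hence equal by the path constructor, so a limit is determined by its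
predecessors. The limits with prescribed predecessors thus form a proposition, mere existence
suffices (`uniqueCut`), and `Z` is an actual sequence (`rankPf`).

Let `W` be the limit of `Z k + k`; the summand makes the sequence strictly increasing. If all `P n`
hold, then `ω · k ≤ Z k`, so `ω² ≤ W` (`rankLimFullTy`). Conversely, `ω² ≤ W` yields `ω · (n + 3) <
Z k + k` for some `k`. A limit below `y + k` is already below `y` (`T.strip`), so `ω · (n + 2) < Z
k`, which can only come from `P 0, …, P n` (`rankLimOutTy`).

The limits `W m` for the different `m` increase weakly. With `y` the limit of `W m + m`, one has `ω²
+ ω ≤ y` precisely if `ω² ≤ W m` for some `m` (`diagBoundTy`): the last `ω` of the bound matches the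
summands `m`.

All this rests on the inversion of `<`: `x < suc y` gives `x ≤ y`, and `x < lim f` gives some `k`
with `x < f k`. It is proved by simultaneous induction on trees and their order into the type of
propositions (`ltFamilyPf`), which is a set by univalence (`hPropSetPf`). For twin primes, the
relevant family is decidable by bounded search.

Provability in the formal system is shown by reflection. A type checker for raw terms is proved
sound (`infer_sound`) and evaluated by the kernel on explicit proof terms. Proved theorems enter a
context as variables, which are cut out at the end, and symbolic universe levels make one check
serve all levels `i`. -/

def upRenBy (r : ℕ → ℕ) : ℕ → ℕ → ℕ
  | 0 => r
  | c + 1 => upRen (upRenBy r c)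

def upSubBy (s : ℕ → Tm) : ℕ → ℕ → Tm
  | 0 => s
  | c + 1 => upSub (upSubBy s c)

/-- Raising the variables from `c` on by `k`, with arithmetic on numerals only. -/
def Tm.shift (k : ℕ) : ℕ → Tm → Tm
  | c, .var n => .var (bif Nat.ble c n then n + k else n)
  | _, .univ i => .univ i
  | c, .pi A B => .pi (A.shift k c) (B.shift k (c + 1))
  | c, .lam A b => .lam (A.shift k c) (b.shift k (c + 1))
  | c, .app f a => .app (f.shift k c) (a.shift k c)
  | _, .con c => .con c

/-- Instantiation of the variables from `d` on by the terms of a list, with arithmetic on numerals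
only -/
def instVar : List Tm → ℕ → ℕ → Tm
  | [], n, d => .var (n + d)
  | a :: _, 0, d => bif Nat.beq d 0 then a else a.shift d 0
  | _ :: σ, n + 1, d => instVar σ n d

def Tm.insts (t : Tm) (σ : List Tm) (d : ℕ) : Tm :=
  match t with
  | .var n => bif Nat.ble d n then instVar σ (n - d) d else .var n
  | .univ i => .univ i
  | .pi A B => .pi (A.insts σ d) (B.insts σ (d + 1))
  | .lam A b => .lam (A.insts σ d) (b.insts σ (d + 1))
  | .app f b => .app (f.insts σ d) (b.insts σ d)
  | .con c => .con c

/-- The substitution of the terms of a list for the first variables -/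
def listSub : List Tm → ℕ → Tm
  | [], n => .var n
  | a :: _, 0 => a
  | _ :: σ, n + 1 => listSub σ n

theorem upRenBy_add (k c n : ℕ) :
    upRenBy (fun n => n + k) c n = bif Nat.ble c n then n + k else n := by
  simp only [Bool.cond_eq_ite, Nat.ble_eq]
  induction c generalizing n with
  | zero => simp [upRenBy]
  | succ c ih =>
    cases n with
    | zero => simp [upRenBy, upRen]
    | succ n =>
      simp only [upRenBy, upRen, ih]
      split_ifs <;> omega

theorem Tm.shift_eq (k c : ℕ) (t : Tm) :
    t.shift k c = t.rename (upRenBy (fun n => n + k) c) := by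
  induction t generalizing c with
  | var n => simp [shift, rename, upRenBy_add]
  | pi A B hA hB => simp [shift, rename, hA, hB, upRenBy]
  | lam A B hA hB => simp [shift, rename, hA, hB, upRenBy]
  | app f a hf ha => simp [shift, rename, hf, ha]
  | _ => rfl

theorem upRen_comp (r s : ℕ → ℕ) : upRen (fun n => r (s n)) = fun n => upRen r (upRen s n) := by
  funext n; cases n <;> rfl

theorem Tm.rename_rename (r s : ℕ → ℕ) (t : Tm) :
    (t.rename s).rename r = t.rename fun n => r (s n) := by
  induction t generalizing r s with
  | pi A B hA hB => simp [rename, hA, hB, upRen_comp]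
  | lam A B hA hB => simp [rename, hA, hB, upRen_comp]
  | app f a hf ha => simp [rename, hf, ha]
  | _ => rfl

theorem Tm.rename_id (t : Tm) : t.rename (fun m => m) = t := by
  have hu : upRen (fun m => m) = fun m => m := by funext m; cases m <;> rfl
  induction t <;> simp_all [Tm.rename]

theorem upSubBy_apply (s : ℕ → Tm) (d n : ℕ) :
    upSubBy s d n = bif Nat.ble d n then (s (n - d)).rename (fun m => m + d) else .var n := by
  simp only [Bool.cond_eq_ite, Nat.ble_eq]
  induction d generalizing n with
  | zero => simp [upSubBy, Tm.rename_id]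
  | succ d ih =>
    cases n with
    | zero => simp [upSubBy, upSub]
    | succ n =>
      simp only [upSubBy, upSub, ih]
      by_cases h : d ≤ n
      · simp only [h, if_true, Tm.wk, Tm.rename_rename, Nat.add_le_add_iff_right,
          Nat.add_sub_add_right]
        rfl
      · simp [h, Tm.wk, Tm.rename]

theorem instVar_eq (σ : List Tm) (n d : ℕ) :
    instVar σ n d = (listSub σ n).rename fun m => m + d := by
  induction σ generalizing n with
  | nil => rfl
  | cons a σ ih =>
    cases n with
    | zero =>
      simp only [instVar, Bool.cond_eq_ite, Nat.beq_eq]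
      split_ifs with h
      · subst h; exact a.rename_id.symm
      · exact a.shift_eq d 0
    | succ n => exact ih n

/-- Justifies running the checker with list instantiation while the typing rules speak of functional
substitutions. -/
theorem Tm.insts_eq (σ : List Tm) (d : ℕ) (t : Tm) :
    t.insts σ d = t.subst (upSubBy (listSub σ) d) := by
  induction t generalizing d with
  | var n => simp [insts, subst, upSubBy_apply, instVar_eq]
  | pi A B hA hB => simp [insts, subst, hA, hB, upSubBy]
  | lam A B hA hB => simp [insts, subst, hA, hB, upSubBy]
  | app f a hf ha => simp [insts, subst, hf, ha]
  | _ => rfl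

theorem Tm.insts_zero (σ : List Tm) (t : Tm) : t.insts σ 0 = t.subst (listSub σ) :=
  Tm.insts_eq σ 0 t

theorem Tm.insts_singleton (a t : Tm) : t.insts [a] 0 = t.inst a := by
  rw [insts_zero, inst]
  congr 1; funext n; cases n <;> rfl

/-- All variables of the term are below `d`. -/
def Tm.closedAt : ℕ → Tm → Bool
  | d, .var n => Nat.blt n d
  | _, .univ _ => true
  | d, .pi A B => A.closedAt d && B.closedAt (d + 1)
  | d, .lam A b => A.closedAt d && b.closedAt (d + 1)
  | d, .app f a => f.closedAt d && a.closedAt d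
  | _, .con _ => true

theorem Tm.subst_closed (t : Tm) (d : ℕ) (s : ℕ → Tm) (hs : ∀ n < d, s n = .var n)
    (h : t.closedAt d = true) : t.subst s = t := by
  have up : ∀ (d : ℕ) (s : ℕ → Tm), (∀ n < d, s n = .var n) →
      ∀ n < d + 1, upSub s n = .var n := by
    intro d s hs n hn
    cases n with
    | zero => rfl
    | succ n => simp [upSub, hs n (by omega), wk, rename]
  induction t generalizing d s with
  | var n => exact hs n (by simpa [closedAt] using h)
  | pi A B hA hB =>
    simp only [closedAt, Bool.and_eq_true] at h
    simp [subst, hA d s hs h.1, hB (d + 1) _ (up d s hs) h.2]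
  | lam A B hA hB =>
    simp only [closedAt, Bool.and_eq_true] at h
    simp [subst, hA d s hs h.1, hB (d + 1) _ (up d s hs) h.2]
  | app f a hf ha =>
    simp only [closedAt, Bool.and_eq_true] at h
    simp [subst, hf d s hs h.1, ha d s hs h.2]
  | _ => rfl

/-! ### Boolean equality -/

/-- Missing levels are padded with `0`. Together with the constructor index the levels determine the
constant, so equality of constants amounts to three comparisons of numerals. -/
def Const.lvls : Const → ℕ × ℕ
  | .sig i | .pair i | .sum i | .inl i | .inr i | .id i | .refl i | .funext i | .univalence i
  | .trunc i | .truncIn i | .truncProp i => (i, 0)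
  | .sigInd i j | .sumInd i j | .idInd i j | .truncRec i j | .brwInd i j | .leInd i j => (i, j)
  | .emptyInd j | .unitInd j | .boolInd j | .natInd j => (j, 0)
  | _ => (0, 0)

/-- The constant with the given constructor number and levels. -/
def Const.ofIdx (i j : ℕ) (n : ℕ) : Const :=
  ([.sig i, .pair i, .sigInd i j, .sum i, .inl i, .inr i, .sumInd i j, .empty, .emptyInd i,
    .unit, .star, .unitInd i, .bool, .ff, .tt, .boolInd i, .nat, .zero, .succ, .natInd i,
    .id i, .refl i, .idInd i j, .funext i, .univalence i, .trunc i, .truncIn i, .truncProp i,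
    .truncRec i j, .brw, .le, .bzero, .bsuc, .blim, .bisim, .brwSet, .leZero, .leTrans, .leSuc,
    .leCocone, .leLimiting, .leProp, .brwInd i j, .leInd i j] : List Const).getD n .empty

theorem Const.ofIdx_ctorIdx (c : Const) : ofIdx c.lvls.1 c.lvls.2 c.ctorIdx = c := by
  cases c <;> rfl

def Const.beq (c d : Const) : Bool :=
  Nat.beq c.ctorIdx d.ctorIdx && (Nat.beq c.lvls.1 d.lvls.1 && Nat.beq c.lvls.2 d.lvls.2)

theorem Const.eq_of_beq {c d : Const} (h : c.beq d = true) : c = d := by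
  simp only [beq, Bool.and_eq_true, Nat.beq_eq] at h
  rw [← ofIdx_ctorIdx c, ← ofIdx_ctorIdx d, h.1, h.2.1, h.2.2]

def Tm.beqVar (n : ℕ) : Tm → Bool
  | .var m => Nat.beq n m
  | _ => false

def Tm.beqUniv (n : ℕ) : Tm → Bool
  | .univ m => Nat.beq n m
  | _ => false

def Tm.beqPi (f g : Tm → Bool) : Tm → Bool
  | .pi A B => f A && g B
  | _ => false

def Tm.beqLam (f g : Tm → Bool) : Tm → Bool
  | .lam A B => f A && g B
  | _ => false

def Tm.beqApp (f g : Tm → Bool) : Tm → Bool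
  | .app A B => f A && g B
  | _ => false

def Tm.beqCon (c : Const) : Tm → Bool
  | .con d => c.beq d
  | _ => false

def Tm.beq : Tm → Tm → Bool
  | .var n => beqVar n
  | .univ n => beqUniv n
  | .pi A B => beqPi A.beq B.beq
  | .lam A B => beqLam A.beq B.beq
  | .app A B => beqApp A.beq B.beq
  | .con c => beqCon c

theorem Tm.eq_of_beq {t u : Tm} (h : t.beq u = true) : t = u := by
  induction t generalizing u <;> cases u <;>
    simp_all [beq, beqVar, beqUniv, beqPi, beqLam, beqApp, beqCon] <;> grind [Const.eq_of_beq]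

/-! ### Weak head reduction -/

def Tm.apps : Tm → List Tm → Tm
  | t, [] => t
  | t, a :: s => (t.app a).apps s

def Tm.spine : Tm → List Tm → Tm × List Tm
  | .app f a, s => f.spine (a :: s)
  | t, s => (t, s)

theorem Tm.spine_apps (t : Tm) (s : List Tm) : (t.spine s).1.apps (t.spine s).2 = t.apps s := by
  induction t generalizing s <;> simp_all [spine, apps]

theorem Tm.apps_append (t : Tm) (s s' : List Tm) : t.apps (s ++ s') = (t.apps s).apps s' := by
  induction s generalizing t <;> simp_all [apps]

theorem Conv.apps {t u : Tm} (h : Conv t u) (s : List Tm) : Conv (t.apps s) (u.apps s) := by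
  induction s generalizing t u with
  | nil => exact h
  | cons a s ih => exact ih (.app h (.refl a))

theorem Conv.apps_app {t a b : Tm} (h : Conv a b) (s s' : List Tm) :
    Conv (t.apps (s ++ a :: s')) (t.apps (s ++ b :: s')) := by
  rw [Tm.apps_append, Tm.apps_append]
  exact Conv.apps (.app (.refl _) h) s'

/-- The number of arguments of an eliminator that stand before the eliminated one -/
def Const.arity : Const → Option ℕ
  | .sigInd _ _ => some 4
  | .sumInd _ _ => some 5
  | .unitInd _ => some 2
  | .boolInd _ => some 3
  | .natInd _ => some 3
  | .idInd _ _ => some 5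
  | .truncRec _ _ => some 4
  | .brwInd _ _ => some 13
  | _ => none

/-! The computation rules of the eliminators, given the arguments before the eliminated one and the
constructor with its arguments -/

def sigRule (i : ℕ) (s : List Tm) (c : Const) (s' : List Tm) : Option Tm :=
  match s, c, s' with
  | [_, _, _, d], .pair i', [_, _, a, b] => bif Nat.beq i i' then some (d a b) else none
  | _, _, _ => none

def sumRule (i : ℕ) (s : List Tm) (c : Const) (s' : List Tm) : Option Tm :=
  match s, c, s' with
  | [_, _, _, d, _], .inl i', [_, _, a] => bif Nat.beq i i' then some (d a) else none
  | [_, _, _, _, e], .inr i', [_, _, b] => bif Nat.beq i i' then some (e b) else none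
  | _, _, _ => none

def unitRule (s : List Tm) (c : Const) (s' : List Tm) : Option Tm :=
  match s, c, s' with
  | [_, d], .star, [] => some d
  | _, _, _ => none

def boolRule (s : List Tm) (c : Const) (s' : List Tm) : Option Tm :=
  match s, c, s' with
  | [_, d, _], .ff, [] => some d
  | [_, _, e], .tt, [] => some e
  | _, _, _ => none

def natRule (j : ℕ) (s : List Tm) (c : Const) (s' : List Tm) : Option Tm :=
  match s, c, s' with
  | [_, d, _], .zero, [] => some d
  | [C, d, e], .succ, [n] => some (e n (Tm.con (.natInd j) C d e n))
  | _, _, _ => none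

def idRule (i : ℕ) (s : List Tm) (c : Const) (s' : List Tm) : Option Tm :=
  match s, c, s' with
  | [_, _, d, _, _], .refl i', [_, a] => bif Nat.beq i i' then some (d a) else none
  | _, _, _ => none

def truncRule (i : ℕ) (s : List Tm) (c : Const) (s' : List Tm) : Option Tm :=
  match s, c, s' with
  | [_, _, _, f], .truncIn i', [_, a] => bif Nat.beq i i' then some (f a) else none
  | _, _, _ => none

def brwRule (i j : ℕ) (s : List Tm) (c : Const) (s' : List Tm) : Option Tm :=
  match s with
  | [C, D, mz, ms, ml, mb, mset, nz, nt, ns, nc, nl, nprop] => match c, s' with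
    | .bzero, [] => some mz
    | .bsuc, [x] =>
      some (ms x (brwSpine (.brwInd i j) C D mz ms ml mb mset nz nt ns nc nl nprop x))
    | .blim, [f, p] =>
      some (ml f p
        (.lam (.con .nat)
          (((brwSpine (.brwInd i j) C D mz ms ml mb mset nz nt ns nc nl nprop).shift 1 0)
            ((f.shift 1 0) (.var 0))))
        (.lam (.con .nat)
          (((brwSpine (.leInd i j) C D mz ms ml mb mset nz nt ns nc nl nprop).shift 1 0)
            (Tm.con .bsuc ((f.shift 1 0) (.var 0))) ((f.shift 1 0) (Tm.con .succ (.var 0)))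
            ((p.shift 1 0) (.var 0)))))
    | _, _ => none
  | _ => none

/-- There is no rule for `leInd`: its values lie in propositions, and `Conv` has no computation rule
for it. -/
def iota : Const → List Tm → Const → List Tm → Option Tm
  | .sigInd i _ => sigRule i
  | .sumInd i _ => sumRule i
  | .unitInd _ => unitRule
  | .boolInd _ => boolRule
  | .natInd j => natRule j
  | .idInd i _ => idRule i
  | .truncRec i _ => truncRule i
  | .brwInd i j => brwRule i j
  | _ => fun _ _ _ => none

theorem Tm.shift_one (t : Tm) : t.shift 1 0 = t.wk := t.shift_eq 1 0

theorem iota_sound {c c' : Const} {s s' : List Tm} {t : Tm} (h : iota c s c' s' = some t) :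
    Conv ((Tm.con c).apps (s ++ [(Tm.con c').apps s'])) t := by
  unfold iota at h
  split at h
  all_goals
    try unfold sigRule at h
    try unfold sumRule at h
    try unfold unitRule at h
    try unfold boolRule at h
    try unfold natRule at h
    try unfold idRule at h
    try unfold truncRule at h
    try unfold brwRule at h
  all_goals repeat' (split at h)
  all_goals first
    | contradiction
    | (simp only [Bool.cond_eq_ite] at h
       split_ifs at h with hi
       obtain rfl := Nat.eq_of_beq_eq_true hi
       obtain rfl := Option.some.inj h
       first
       | exact .sigPair ..
       | exact .sumInl ..
       | exact .sumInr ..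
       | exact .idRefl ..
       | exact .truncIn ..)
    | (obtain rfl := Option.some.inj h
       try simp only [Tm.shift_one]
       first
       | exact .unitStar ..
       | exact .boolFf ..
       | exact .boolTt ..
       | exact .natZero ..
       | exact .natSucc ..
       | exact .brwZero ..
       | exact .brwSuc ..
       | exact .brwLim ..)

/-- One computation step of the eliminator `c` with arguments `s`, of which those from the eliminated
one on are given separately. The function `red` computes weak head normal forms. -/
def whnfElim (red : Tm → List Tm → Tm) (c : Const) (s : List Tm) (n : ℕ) : List Tm → Tm
  | [] => (Tm.con c).apps s
  | a :: s' => match (red a []).spine [] with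
    | (.con c', l) => match iota c (s.take n) c' l with
      | some t => red t s'
      | none => (Tm.con c).apps s
    | _ => (Tm.con c).apps s

def whnfCon (red : Tm → List Tm → Tm) (c : Const) (s : List Tm) : Tm :=
  match c.arity with
  | none => (Tm.con c).apps s
  | some n => whnfElim red c s n (s.drop n)

def whnfLam (red : Tm → List Tm → Tm) (A b : Tm) : List Tm → Tm
  | [] => .lam A b
  | a :: s => red (b.insts [a] 0) s

def whnfStep (red : Tm → List Tm → Tm) : Tm → List Tm → Tm
  | .app f a, s => red f (a :: s)
  | .lam A b, s => whnfLam red A b s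
  | .con c, s => whnfCon red c s
  | t, s => t.apps s

/-- The weak head normal form of `t` applied to the arguments `s`; the first argument bounds the
number of steps. -/
def whnf : ℕ → Tm → List Tm → Tm
  | 0 => Tm.apps
  | k + 1 => whnfStep (whnf k)

theorem whnf_sound (k : ℕ) (t : Tm) (s : List Tm) : Conv (t.apps s) (whnf k t s) := by
  induction k generalizing t s with
  | zero => exact .refl _
  | succ k ih =>
    cases t with
    | app f a => exact ih f (a :: s)
    | lam A b =>
      cases s with
      | nil => exact .refl _
      | cons a s =>
        refine .trans (.apps (.beta A b a) s) ?_
        simp only [whnf, whnfStep, whnfLam, Tm.insts_singleton]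
        exact ih _ s
    | con c =>
      simp only [whnf, whnfStep, whnfCon]
      split
      · exact .refl _
      · rename_i n hn
        unfold whnfElim
        split
        · exact .refl _
        · rename_i a s' hs
          split
          · rename_i c' l hl
            split
            · rename_i t ht
              refine .trans ?_ (ih t s')
              have hsp := Tm.spine_apps (whnf k a []) []
              rw [hl] at hsp
              have h1 : Conv a ((Tm.con c').apps l) := by
                have := ih a []
                rwa [← show _ = whnf k a [] from hsp] at this
              have h2 := (Conv.apps_app (t := .con c) h1 (s.take n) []).trans (iota_sound ht)
              -- The arguments split into those before the eliminated one, the eliminated one, and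
              -- the surplus to which the result is applied.
              have h3 : s = s.take n ++ [a] ++ s' := by
                rw [List.append_assoc, List.singleton_append, ← hs, List.take_append_drop]
              conv => enter [1]; rw [h3, Tm.apps_append]
              exact .apps h2 s'
            · exact .refl _
          · exact .refl _
    | var n => exact .refl _
    | univ i => exact .refl _
    | pi A B => exact .refl _

/-! A test for judgmental equality of terms in weak head normal form, given a test `cv` for
judgmental equality. Only `true` is meaningful. -/

def convPi (cv : Tm → Tm → Bool) (A B : Tm) : Tm → Bool
  | .pi A' B' => cv A A' && cv B B'
  | .lam _ b => cv (((Tm.pi A B).shift 1 0) (.var 0)) b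
  | _ => false

def convLam (cv : Tm → Tm → Bool) (A b : Tm) : Tm → Bool
  | .lam A' b' => cv A A' && cv b b'
  | u => cv b ((u.shift 1 0) (.var 0))

def convApp (cv : Tm → Tm → Bool) (f a : Tm) : Tm → Bool
  | .app f' a' => cv f f' && cv a a'
  | .lam _ b => cv (((Tm.app f a).shift 1 0) (.var 0)) b
  | _ => false

def convAtom (cv : Tm → Tm → Bool) (t : Tm) : Tm → Bool
  | .lam _ b => cv ((t.shift 1 0) (.var 0)) b
  | u => t.beq u

def convWhnf (cv : Tm → Tm → Bool) : Tm → Tm → Bool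
  | .pi A B => convPi cv A B
  | .lam A b => convLam cv A b
  | .app f a => convApp cv f a
  | t => convAtom cv t

/-- A test for judgmental equality -/
def convTest : ℕ → Tm → Tm → Bool
  | 0, t, u => t.beq u
  | k + 1, t, u => t.beq u || convWhnf (convTest k) (whnf k t []) (whnf k u [])

theorem convTest_sound {k : ℕ} {t u : Tm} (h : convTest k t u = true) : Conv t u := by
  induction k generalizing t u with
  | zero => rw [Tm.eq_of_beq h]; exact .refl _
  | succ k ih =>
    simp only [convTest, Bool.or_eq_true] at h
    obtain h | h := h
    · rw [Tm.eq_of_beq h]; exact .refl _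
    refine .trans (whnf_sound k t []) (.trans ?_ (.symm (whnf_sound k u [])))
    generalize whnf k t [] = t', whnf k u [] = u' at h
    -- The rule `Conv.eta` is untyped, so any term may be compared with a λ-abstraction, by applying
    -- its weakening to the variable `0`.
    have eta : ∀ {t A b}, convTest k ((t.shift 1 0) (.var 0)) b = true → Conv t (.lam A b) := by
      intro t A b h
      rw [Tm.shift_one] at h
      exact .trans (.symm (.eta A _)) (.lam (.refl _) (ih h))
    have eta' : ∀ {t A b}, convTest k b ((t.shift 1 0) (.var 0)) = true → Conv (.lam A b) t := by
      intro t A b h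
      rw [Tm.shift_one] at h
      exact .trans (.lam (.refl _) (ih h)) (.eta A _)
    have atom : ∀ {t : Tm}, convAtom (convTest k) t u' = true → Conv t u' := by
      intro t h
      unfold convAtom at h
      split at h
      · exact eta h
      · rw [Tm.eq_of_beq h]; exact .refl _
    cases t' with
    | pi A B =>
      simp only [convWhnf, convPi] at h
      split at h
      · rw [Bool.and_eq_true] at h
        exact .pi (ih h.1) (ih h.2)
      · exact eta h
      · contradiction
    | lam A b =>
      simp only [convWhnf, convLam] at h
      split at h
      · rw [Bool.and_eq_true] at h
        exact .lam (ih h.1) (ih h.2)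
      · exact eta' h
    | app f a =>
      simp only [convWhnf, convApp] at h
      split at h
      · rw [Bool.and_eq_true] at h
        exact .app (ih h.1) (ih h.2)
      · exact eta h
      · contradiction
    | var n => exact atom h
    | univ i => exact atom h
    | con c => exact atom h

/-! ### Universe levels

A level `n` below `1000` stands for itself; level `1000 + n` stands for `i + n`, where `i` is an
arbitrary level. -/

/-- The interpretation of levels, given `i` -/
def lvl (i n : ℕ) : ℕ := bif Nat.ble 1000 n then i + (n - 1000) else n

def Const.mapLvl (r : ℕ → ℕ) : Const → Const
  | .sig i => .sig (r i) | .pair i => .pair (r i) | .sigInd i j => .sigInd (r i) (r j)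
  | .sum i => .sum (r i) | .inl i => .inl (r i) | .inr i => .inr (r i)
  | .sumInd i j => .sumInd (r i) (r j)
  | .emptyInd j => .emptyInd (r j) | .unitInd j => .unitInd (r j)
  | .boolInd j => .boolInd (r j) | .natInd j => .natInd (r j)
  | .id i => .id (r i) | .refl i => .refl (r i) | .idInd i j => .idInd (r i) (r j)
  | .funext i => .funext (r i) | .univalence i => .univalence (r i)
  | .trunc i => .trunc (r i) | .truncIn i => .truncIn (r i) | .truncProp i => .truncProp (r i)
  | .truncRec i j => .truncRec (r i) (r j)
  | .brwInd i j => .brwInd (r i) (r j) | .leInd i j => .leInd (r i) (r j)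
  | c => c

def Tm.mapLvl (r : ℕ → ℕ) : Tm → Tm
  | .var n => .var n
  | .univ i => .univ (r i)
  | .pi A B => .pi (A.mapLvl r) (B.mapLvl r)
  | .lam A b => .lam (A.mapLvl r) (b.mapLvl r)
  | .app f a => .app (f.mapLvl r) (a.mapLvl r)
  | .con c => .con (c.mapLvl r)

theorem Tm.mapLvl_rename (r s : ℕ → ℕ) (t : Tm) :
    (t.rename s).mapLvl r = (t.mapLvl r).rename s := by
  induction t generalizing s <;> simp_all [rename, mapLvl]

theorem Tm.mapLvl_subst (r : ℕ → ℕ) (s : ℕ → Tm) (t : Tm) :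
    (t.subst s).mapLvl r = (t.mapLvl r).subst fun n => (s n).mapLvl r := by
  have up : ∀ s : ℕ → Tm, (fun n => (upSub s n).mapLvl r) = upSub fun n => (s n).mapLvl r := by
    intro s; funext n
    cases n <;> simp [upSub, Tm.wk, mapLvl_rename, mapLvl]
  induction t generalizing s <;> simp_all [subst, mapLvl]

theorem Tm.mapLvl_inst (r : ℕ → ℕ) (a t : Tm) :
    (t.inst a).mapLvl r = (t.mapLvl r).inst (a.mapLvl r) := by
  rw [inst, inst, mapLvl_subst]
  congr 1; funext n; cases n <;> rfl

theorem Tm.mapLvl_wk (r : ℕ → ℕ) (t : Tm) : t.wk.mapLvl r = (t.mapLvl r).wk :=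
  mapLvl_rename r _ t

theorem Tm.closedAt_mapLvl (r : ℕ → ℕ) (d : ℕ) (t : Tm) :
    (t.mapLvl r).closedAt d = t.closedAt d := by
  induction t generalizing d <;> simp_all [closedAt, mapLvl]

theorem Conv.mapLvl (r : ℕ → ℕ) {t u : Tm} (h : Conv t u) : Conv (t.mapLvl r) (u.mapLvl r) := by
  induction h with
  | refl t => exact .refl _
  | symm _ h => exact .symm h
  | trans _ _ h h' => exact .trans h h'
  | pi _ _ h h' => exact .pi h h'
  | lam _ _ h h' => exact .lam h h'
  | app _ _ h h' => exact .app h h'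
  | beta A b a => rw [Tm.mapLvl_inst]; exact .beta ..
  | eta A f =>
    simp only [Tm.mapLvl, Tm.mapLvl_wk]
    exact .eta ..
  | sigPair => exact .sigPair ..
  | sumInl => exact .sumInl ..
  | sumInr => exact .sumInr ..
  | unitStar => exact .unitStar ..
  | boolFf => exact .boolFf ..
  | boolTt => exact .boolTt ..
  | natZero => exact .natZero ..
  | natSucc => exact .natSucc ..
  | idRefl => exact .idRefl ..
  | truncIn => exact .truncIn ..
  | brwZero => exact .brwZero ..
  | brwSuc => exact .brwSuc ..
  | brwLim =>
    simp only [Tm.mapLvl, Tm.mapLvl_wk, brwSpine]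
    exact .brwLim ..

/-- Level `a` is at most level `b` under every interpretation. -/
def lvlLe (a b : ℕ) : Bool :=
  Nat.ble a b && (Nat.ble 1000 a || (Nat.ble b 999 || Nat.ble (a + 1000) b))

/-- A numeral `a < 1000` is below `i + (b - 1000)` for every `i`, in particular for `i = 0`, only if
`a + 1000 ≤ b`; this is the last alternative in `lvlLe`. -/
theorem lvl_le {a b : ℕ} (h : lvlLe a b = true) (i : ℕ) : lvl i a ≤ lvl i b := by
  simp only [lvlLe, Bool.and_eq_true, Bool.or_eq_true, Nat.ble_eq] at h
  simp only [lvl, Bool.cond_eq_ite, Nat.ble_eq]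
  split_ifs <;> omega

/-- The level `999` is excluded because its successor `1000` is read as `i`. -/
theorem lvl_succ {a : ℕ} (h : Nat.beq a 999 = false) (i : ℕ) : lvl i (a + 1) = lvl i a + 1 := by
  have h : a ≠ 999 := by
    rintro rfl; simp at h
  simp only [lvl, Bool.cond_eq_ite, Nat.ble_eq]
  split_ifs <;> omega

/-- The levels `0` and `n + 1` that occur in the type of a constant of level `n` are interpreted
as such. -/
def Const.lvlOk : Const → Bool
  | .univalence i => !(Nat.beq i 999)
  | _ => true

/-- Only the type of `univalence` mentions the successor of a level; for all other constants both
sides agree by computation. -/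
theorem constType_mapLvl {c : Const} (h : c.lvlOk = true) (i : ℕ) :
    (constType c).mapLvl (lvl i) = constType (c.mapLvl (lvl i)) := by
  cases c with
  | univalence n =>
    have h' := lvl_succ (a := n) (by simpa [Const.lvlOk] using h) i
    simp only [constType, constExp, Exp.close, isEquiv, eq, equiv, idToEquiv, prod, sig, arr,
      idEquiv, pair, Exp.app, con, univ, pi, lam, Tm.mapLvl, Const.mapLvl, h', Exp.bound]
  | _ => rfl

/-! ### Metatheory of typing -/

theorem upSub_comp_upRen (r : ℕ → ℕ) (s : ℕ → Tm) :
    (fun n => upSub s (upRen r n)) = upSub fun n => s (r n) := by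
  funext n; cases n <;> rfl

theorem Tm.subst_rename (r : ℕ → ℕ) (s : ℕ → Tm) (t : Tm) :
    (t.rename r).subst s = t.subst fun n => s (r n) := by
  induction t generalizing r s <;> simp_all [rename, subst, upSub_comp_upRen]

theorem Tm.rename_subst (r : ℕ → ℕ) (s : ℕ → Tm) (t : Tm) :
    (t.subst s).rename r = t.subst fun n => (s n).rename r := by
  have up : ∀ (r : ℕ → ℕ) (s : ℕ → Tm),
      (fun n => (upSub s n).rename (upRen r)) = upSub fun n => (s n).rename r := by
    intro r s; funext n
    cases n <;> simp [upSub, wk, rename_rename, rename, upRen]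
  induction t generalizing r s <;> simp_all [rename, subst]

theorem Tm.subst_subst (s s' : ℕ → Tm) (t : Tm) :
    (t.subst s).subst s' = t.subst fun n => (s n).subst s' := by
  have up : ∀ s s' : ℕ → Tm,
      (fun n => (upSub s n).subst (upSub s')) = upSub fun n => (s n).subst s' := by
    intro s s'; funext n
    cases n with
    | zero => rfl
    | succ n => simp [upSub, wk, subst_rename, rename_subst]
  induction t generalizing s s' <;> simp_all [subst]

theorem Tm.subst_var (t : Tm) : t.subst .var = t := by
  have up : upSub .var = .var := by funext n; cases n <;> rfl
  induction t <;> simp_all [subst]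

theorem Tm.subst_var_comp (r : ℕ → ℕ) (t : Tm) : t.subst (fun n => .var (r n)) = t.rename r := by
  have := Tm.subst_rename r .var t
  rw [Tm.subst_var] at this
  exact this.symm

theorem Tm.wk_subst (s : ℕ → Tm) (t : Tm) : t.wk.subst (upSub s) = (t.subst s).wk := by
  simp only [wk, subst_rename, rename_subst]
  rfl

theorem Tm.inst_subst (s : ℕ → Tm) (a t : Tm) :
    (t.inst a).subst s = (t.subst (upSub s)).inst (a.subst s) := by
  simp only [inst, subst_subst]
  congr 1; funext n
  cases n with
  | zero => rfl
  | succ n =>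
    simp only [instSub, subst, upSub, wk, subst_rename]
    exact (subst_var _).symm

theorem Conv.subst (s : ℕ → Tm) {t u : Tm} (h : Conv t u) : Conv (t.subst s) (u.subst s) := by
  induction h generalizing s with
  | refl t => exact .refl _
  | symm _ h => exact .symm (h s)
  | trans _ _ h h' => exact .trans (h s) (h' s)
  | pi _ _ h h' => exact .pi (h s) (h' _)
  | lam _ _ h h' => exact .lam (h s) (h' _)
  | app _ _ h h' => exact .app (h s) (h' s)
  | beta A b a => rw [Tm.inst_subst]; exact .beta ..
  | eta A f =>
    simp only [Tm.subst, Tm.wk_subst]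
    exact .eta ..
  | sigPair => exact .sigPair ..
  | sumInl => exact .sumInl ..
  | sumInr => exact .sumInr ..
  | unitStar => exact .unitStar ..
  | boolFf => exact .boolFf ..
  | boolTt => exact .boolTt ..
  | natZero => exact .natZero ..
  | natSucc => exact .natSucc ..
  | idRefl => exact .idRefl ..
  | truncIn => exact .truncIn ..
  | brwZero => exact .brwZero ..
  | brwSuc => exact .brwSuc ..
  | brwLim =>
    simp only [Tm.subst, Tm.wk_subst, brwSpine]
    exact .brwLim ..

theorem Conv.rename (r : ℕ → ℕ) {t u : Tm} (h : Conv t u) : Conv (t.rename r) (u.rename r) := by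
  rw [← Tm.subst_var_comp, ← Tm.subst_var_comp]
  exact h.subst _

theorem constType_closed (c : Const) : (constType c).closedAt 0 = true := by
  cases c <;> rfl

theorem constType_subst (c : Const) (s : ℕ → Tm) : (constType c).subst s = constType c :=
  Tm.subst_closed _ 0 s (by simp) (constType_closed c)

theorem constType_rename (c : Const) (r : ℕ → ℕ) : (constType c).rename r = constType c := by
  rw [← Tm.subst_var_comp, constType_subst]

/-! ### Stability of typing under renaming and substitution -/

theorem HasType.rename {Γ : List Tm} {t T : Tm} (h : HasType Γ t T) {Δ : List Tm} {r : ℕ → ℕ}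
    (hr : ∀ n A, Γ[n]? = some A → ∃ A', Δ[r n]? = some A' ∧
      A'.rename (fun k => k + (r n + 1)) = (A.rename fun k => k + (n + 1)).rename r) :
    HasType Δ (t.rename r) (T.rename r) := by
  have up : ∀ {Γ Δ : List Tm} {r : ℕ → ℕ} (A : Tm),
      (∀ n A, Γ[n]? = some A → ∃ A', Δ[r n]? = some A' ∧
        A'.rename (fun k => k + (r n + 1)) = (A.rename fun k => k + (n + 1)).rename r) →
      ∀ n B, (A :: Γ)[n]? = some B → ∃ A', (A.rename r :: Δ)[upRen r n]? = some A' ∧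
        A'.rename (fun k => k + (upRen r n + 1)) =
          (B.rename fun k => k + (n + 1)).rename (upRen r) := by
    intro Γ Δ r A hr n B hB
    cases n with
    | zero =>
      obtain rfl : A = B := by simpa using hB
      exact ⟨_, rfl, by simp only [Tm.rename_rename]; rfl⟩
    | succ n =>
      obtain ⟨A', h1, h2⟩ := hr n B (by simpa using hB)
      refine ⟨A', by simpa [upRen] using h1, ?_⟩
      have := congrArg (Tm.rename fun k => k + 1) h2
      simp only [Tm.rename_rename] at this ⊢
      exact this
  induction h generalizing Δ r with
  | var h =>
    obtain ⟨A', h1, h2⟩ := hr _ _ h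
    rw [← h2]
    exact .var h1
  | con c => rw [constType_rename]; exact .con c
  | univ i => exact .univ i
  | cumul _ ih => exact .cumul (ih hr)
  | pi _ _ ihA ihB => exact .pi (ihA hr) (ihB (up _ hr))
  | lam _ _ ihA ihb => exact .lam (ihA hr) (ihb (up _ hr))
  | app _ _ ihf iha =>
    rename_i B _ a _ _
    have : (B.inst a).rename r = (B.rename (upRen r)).inst (a.rename r) := by
      rw [← Tm.subst_var_comp, Tm.inst_subst, Tm.subst_var_comp, ← Tm.subst_var_comp (upRen r)]
      congr 2; funext n; cases n <;> rfl
    rw [this]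
    exact .app (ihf hr) (iha hr)
  | conv _ hc _ iht ihB => exact .conv (iht hr) (hc.rename r) (ihB hr)

theorem HasType.wk {Γ : List Tm} {t T : Tm} (h : HasType Γ t T) (A : Tm) :
    HasType (A :: Γ) t.wk T.wk :=
  h.rename fun n B hB => ⟨B, by simpa using hB, by simp only [Tm.rename_rename]; rfl⟩

theorem HasType.subst {Γ : List Tm} {t T : Tm} (h : HasType Γ t T) {Δ : List Tm} {s : ℕ → Tm}
    (hs : ∀ n A, Γ[n]? = some A → HasType Δ (s n) ((A.rename fun k => k + (n + 1)).subst s)) :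
    HasType Δ (t.subst s) (T.subst s) := by
  have up : ∀ {Γ Δ : List Tm} {s : ℕ → Tm} {A : Tm},
      (∀ n A, Γ[n]? = some A → HasType Δ (s n) ((A.rename fun k => k + (n + 1)).subst s)) →
      ∀ n B, (A :: Γ)[n]? = some B →
        HasType (A.subst s :: Δ) (upSub s n) ((B.rename fun k => k + (n + 1)).subst (upSub s)) := by
    intro Γ Δ s A hs n B hB
    cases n with
    | zero =>
      obtain rfl : A = B := by simpa using hB
      have e : (A.rename fun k => k + (0 + 1)).subst (upSub s) =
        (A.subst s).rename fun k => k + (0 + 1) := Tm.wk_subst s A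
      rw [e]
      exact .var rfl
    | succ n =>
      have := (hs n B (by simpa using hB)).wk (A.subst s)
      rw [← Tm.wk_subst] at this
      simp only [Tm.wk, Tm.rename_rename] at this
      exact this
  induction h generalizing Δ s with
  | var h => exact hs _ _ h
  | con c => rw [constType_subst]; exact .con c
  | univ i => exact .univ i
  | cumul _ ih => exact .cumul (ih hs)
  | pi _ _ ihA ihB => exact .pi (ihA hs) (ihB (up hs))
  | lam _ _ ihA ihb => exact .lam (ihA hs) (ihb (up hs))
  | app _ _ ihf iha =>
    rw [Tm.inst_subst]
    exact .app (ihf hs) (iha hs)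
  | conv _ hc _ iht ihB => exact .conv (iht hs) (hc.subst s) (ihB hs)

theorem HasType.inst {Γ : List Tm} {A t T a : Tm} (h : HasType (A :: Γ) t T)
    (ha : HasType Γ a A) : HasType Γ (t.inst a) (T.inst a) := by
  refine h.subst fun n B hB => ?_
  have e : ∀ B : Tm, ((B.rename fun k => k + (n + 1)).subst (instSub a)) =
      B.rename fun k => k + n := by
    intro B
    rw [Tm.subst_rename]
    exact Tm.subst_var_comp _ B
  rw [e]
  cases n with
  | zero =>
    obtain rfl : A = B := by simpa using hB
    simpa [Tm.rename_id, instSub] using ha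
  | succ n => exact .var (by simpa using hB)

/-- The rules `cumul` and `conv` do not change the term, so induction reaches the formation rule.
This inverts the typing of a Π-type without injectivity of Π up to conversion. -/
theorem HasType.pi_inv {Γ : List Tm} {A B T : Tm} (h : HasType Γ (.pi A B) T) :
    ∃ i, HasType Γ A (.univ i) ∧ HasType (A :: Γ) B (.univ i) := by
  generalize e : Tm.pi A B = t at h
  induction h with
  | pi hA hB => cases e; exact ⟨_, hA, hB⟩
  | cumul _ ih => exact ih e
  | conv _ _ _ ih _ => exact ih e
  | _ => cases e

/-- The type `A` is well formed in the context `Γ`. -/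
def IsType (Γ : List Tm) (A : Tm) : Prop := ∃ i, HasType Γ A (.univ i)

inductive WfCtx : List Tm → Prop
  | nil : WfCtx []
  | cons {Γ : List Tm} {A : Tm} : WfCtx Γ → IsType Γ A → WfCtx (A :: Γ)

theorem IsType.wk {Γ : List Tm} {A : Tm} (h : IsType Γ A) (B : Tm) : IsType (B :: Γ) A.wk :=
  h.imp fun _ h => h.wk B

theorem WfCtx.isType {Γ : List Tm} (h : WfCtx Γ) {n : ℕ} {A : Tm} (hA : Γ[n]? = some A) :
    IsType Γ (A.rename fun k => k + (n + 1)) := by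
  induction h generalizing n with
  | nil => simp at hA
  | cons hΓ hB ih =>
    rename_i Γ B
    cases n with
    | zero =>
      obtain rfl : B = A := by simpa using hA
      exact hB.wk B
    | succ n =>
      have := (ih (n := n) (by simpa using hA)).wk B
      rw [Tm.wk, Tm.rename_rename] at this
      exact this

theorem IsType.of_nil {A : Tm} (h : IsType [] A) (Γ : List Tm) : IsType Γ (A.subst .var) := by
  obtain ⟨i, h⟩ := h
  exact ⟨i, h.subst (Δ := Γ) (s := .var) (by simp)⟩

/-! ### Type inference -/

def univLvl : Tm → Option ℕ
  | .univ a => some a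
  | _ => none

/-- The universe level of a type of which the type is given -/
def lvlOfTy (k : ℕ) : Option Tm → Option ℕ
  | some (.univ a) => some a
  | some T => univLvl (whnf k T [])
  | none => none

/-- The universe level of a type, if it is a type -/
def tyLvl (inf : List Tm → Tm → Option Tm) (k : ℕ) (Γ : List Tm) (A : Tm) : Option ℕ :=
  lvlOfTy k (inf Γ A)

def subUniv (b : ℕ) : Tm → Bool
  | .univ a => lvlLe a b
  | _ => false

def subWhnf (k : ℕ) (T' T : Tm) : Tm → Bool
  | .univ b => subUniv b (whnf k T' [])
  | _ => convTest k T' T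

/-- Is a term of type `T'` also of type `T`? -/
def subTest (k : ℕ) (T' T : Tm) : Bool := T'.beq T || subWhnf k T' T (whnf k T [])

def checkSub (k : ℕ) (T : Tm) : Option Tm → Bool
  | some T' => subTest k T' T
  | none => false

def checkLam (inf : List Tm → Tm → Option Tm) (k : ℕ) (Γ : List Tm) (A b : Tm)
    (chk : List Tm → Tm → Bool) : Tm → Bool
  | .pi A' B => bif A.beq A' then chk (A :: Γ) B
    else checkSub k (.pi A' B) (inf Γ (.lam A b))
  | T => checkSub k T (inf Γ (.lam A b))

/-- `subTest` uses cumulativity only at the head of a type, not in the codomain of a Π-type.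
Descending into a λ-abstraction whose domain is known makes it available for the body. -/
def check (inf : List Tm → Tm → Option Tm) (k : ℕ) : Tm → List Tm → Tm → Bool
  | .lam A b, Γ, T => checkLam inf k Γ A b (check inf k b) T
  | t, Γ, T => checkSub k T (inf Γ t)

/-- An upper bound of two levels -/
def lvlMax (a b : ℕ) : Option ℕ :=
  bif lvlLe a b then some b else bif lvlLe b a then some a else
  -- If one level is a numeral `a` and the other is `1000 + n`, their sum stands for `i + (n + a)`,
  -- which bounds both for every `i`.
  bif lvlLe a (a + b) && lvlLe b (a + b) then some (a + b) else none

/-- The Π-type found by reduction is tested anew for being a type, since subject reduction is not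
proved. -/
def inferFun (inf : List Tm → Tm → Option Tm) (k : ℕ) (Γ : List Tm) (a : Tm)
    (args : Tm → List Tm → Option Tm) : Tm → Option Tm
  | .pi A B =>
    bif (tyLvl inf k Γ (.pi A B)).isSome && check inf k a Γ A then args B [a] else none
  | _ => none

/-- While the remaining type is literally a Π-type, arguments accumulate in `σ` and the codomain is
not instantiated. Otherwise the pending substitution is carried out, the result is reduced, and the
accumulation starts afresh. -/
def inferArg (inf : List Tm → Tm → Option Tm) (k : ℕ) (Γ : List Tm) (σ : List Tm) (a : Tm)
    (args : Tm → List Tm → Option Tm) : Tm → Option Tm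
  | .pi A B => bif check inf k a Γ (A.insts σ 0) then args B (a :: σ) else none
  | F => inferFun inf k Γ a args (whnf k (F.insts σ 0) [])

/-- The type of a function of type `F`, with the terms of `σ` in place of the first variables, applied
to a list of arguments -/
def inferArgs (inf : List Tm → Tm → Option Tm) (k : ℕ) (Γ : List Tm) :
    List Tm → Tm → List Tm → Option Tm
  | [], F, σ => some (F.insts σ 0)
  | a :: s, F, σ => inferArg inf k Γ σ a (inferArgs inf k Γ s) F

def lookup : List Tm → ℕ → Option Tm
  | [], _ => none
  | A :: _, 0 => some A
  | _ :: Γ, n + 1 => lookup Γ n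

def inferVar (n : ℕ) : Option Tm → Option Tm
  | some A => some (A.shift (n + 1) 0)
  | none => none

def inferPi (inf : List Tm → Tm → Option Tm) (k : ℕ) (Γ : List Tm) (A B : Tm) : Option Tm :=
  ((tyLvl inf k Γ A).bind fun a => (tyLvl inf k (A :: Γ) B).bind (lvlMax a)).map .univ

def inferLam (inf : List Tm → Tm → Option Tm) (k : ℕ) (Γ : List Tm) (A b : Tm) : Option Tm :=
  bif (tyLvl inf k Γ A).isSome then (inf (A :: Γ) b).map (.pi A) else none

def inferApp (inf : List Tm → Tm → Option Tm) (k : ℕ) (Γ : List Tm) (p : Tm × List Tm) :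
    Option Tm :=
  (inf Γ p.1).bind fun F => inferArgs inf k Γ p.2 F []

def inferStep (cs : List Const) (inf : List Tm → Tm → Option Tm) (k : ℕ) (Γ : List Tm) :
    Tm → Option Tm
  | .var n => inferVar n (lookup Γ n)
  | .con c => bif cs.any c.beq then some (constType c) else none
  | .univ a => bif Nat.beq a 999 then none else some (.univ (a + 1))
  | .pi A B => inferPi inf k Γ A B
  | .lam A b => inferLam inf k Γ A b
  | .app f a => inferApp inf k Γ (f.spine [a])

/-- The type of a term in a well-formed context. The term may contain constants from the list `cs`.
The second argument bounds the number of steps. -/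
def infer (cs : List Const) : ℕ → List Tm → Tm → Option Tm
  | 0 => fun _ _ => none
  | k + 1 => inferStep cs (infer cs k) k

/-! ### Soundness of type inference -/

theorem HasType.cumul_le {Γ : List Tm} {A : Tm} {a b : ℕ} (h : HasType Γ A (.univ a))
    (hab : a ≤ b) : HasType Γ A (.univ b) := by
  induction hab with
  | refl => exact h
  | step _ ih => exact .cumul ih

/-- Inference by `inf` is correct under the interpretation of levels by `r`. -/
def InferSound (r : ℕ → ℕ) (inf : List Tm → Tm → Option Tm) : Prop :=
  ∀ Γ t T, WfCtx (Γ.map (Tm.mapLvl r)) → inf Γ t = some T →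
    HasType (Γ.map (Tm.mapLvl r)) (t.mapLvl r) (T.mapLvl r) ∧
      IsType (Γ.map (Tm.mapLvl r)) (T.mapLvl r)

section
variable {i k : ℕ} {inf : List Tm → Tm → Option Tm} (hinf : InferSound (lvl i) inf)
include hinf

theorem tyLvl_sound {Γ : List Tm} (hΓ : WfCtx (Γ.map (Tm.mapLvl (lvl i)))) {A : Tm} {a : ℕ}
    (h : tyLvl inf k Γ A = some a) :
    HasType (Γ.map (Tm.mapLvl (lvl i))) (A.mapLvl (lvl i)) (.univ (lvl i a)) := by
  unfold tyLvl lvlOfTy at h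
  split at h
  · rename_i a' e
    obtain rfl := Option.some.inj h
    exact (hinf _ _ _ hΓ e).1
  · rename_i T _ e
    unfold univLvl at h
    split at h
    · rename_i a' e'
      obtain rfl := Option.some.inj h
      have := (whnf_sound k T []).mapLvl (lvl i)
      rw [e'] at this
      exact .conv (hinf _ _ _ hΓ e).1 this (.univ _)
    · contradiction
  · contradiction

theorem tyLvl_isSome {Γ : List Tm} (hΓ : WfCtx (Γ.map (Tm.mapLvl (lvl i)))) {A : Tm}
    (h : (tyLvl inf k Γ A).isSome = true) :
    IsType (Γ.map (Tm.mapLvl (lvl i))) (A.mapLvl (lvl i)) := by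
  obtain ⟨a, ha⟩ := Option.isSome_iff_exists.1 h
  exact ⟨_, tyLvl_sound hinf hΓ ha⟩

omit hinf in
theorem subTest_sound {Γ : List Tm} {t T T' : Tm} (h : subTest k T' T = true)
    (hT : IsType (Γ.map (Tm.mapLvl (lvl i))) (T.mapLvl (lvl i)))
    (ht : HasType (Γ.map (Tm.mapLvl (lvl i))) (t.mapLvl (lvl i)) (T'.mapLvl (lvl i))) :
    HasType (Γ.map (Tm.mapLvl (lvl i))) (t.mapLvl (lvl i)) (T.mapLvl (lvl i)) := by
  simp only [subTest, Bool.or_eq_true] at h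
  obtain h | h := h
  · rwa [← Tm.eq_of_beq h]
  obtain ⟨a, ha⟩ := hT
  unfold subWhnf at h
  split at h
  · rename_i b e'
    unfold subUniv at h
    split at h
    · rename_i a e
      have := (whnf_sound k T' []).mapLvl (lvl i)
      rw [e] at this
      have hT := (whnf_sound k T []).mapLvl (lvl i)
      rw [e'] at hT
      exact .conv (.cumul_le (.conv ht this (.univ _)) (lvl_le h i)) hT.symm ha
    · contradiction
  · exact .conv ht ((convTest_sound h).mapLvl _) ha

theorem check_sound {Γ : List Tm} (hΓ : WfCtx (Γ.map (Tm.mapLvl (lvl i)))) {t T : Tm}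
    (hT : IsType (Γ.map (Tm.mapLvl (lvl i))) (T.mapLvl (lvl i)))
    (h : check inf k t Γ T = true) :
    HasType (Γ.map (Tm.mapLvl (lvl i))) (t.mapLvl (lvl i)) (T.mapLvl (lvl i)) := by
  have fallback : ∀ {Γ t T}, WfCtx (Γ.map (Tm.mapLvl (lvl i))) →
      IsType (Γ.map (Tm.mapLvl (lvl i))) (T.mapLvl (lvl i)) → checkSub k T (inf Γ t) = true →
      HasType (Γ.map (Tm.mapLvl (lvl i))) (t.mapLvl (lvl i)) (T.mapLvl (lvl i)) := by
    intro Γ t T hΓ hT h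
    unfold checkSub at h
    split at h
    · rename_i T' e
      exact subTest_sound h hT (hinf _ _ _ hΓ e).1
    · contradiction
  induction t generalizing Γ T with
  | lam A b _ ih =>
    cases T with
    | pi A' B =>
      simp only [check, checkLam, Bool.cond_eq_ite] at h
      split_ifs at h with hA
      · obtain rfl := Tm.eq_of_beq hA
        obtain ⟨u, hT⟩ := hT
        obtain ⟨v, hA, hB⟩ := hT.pi_inv
        exact .lam hA (ih (Γ := A :: Γ) (.cons hΓ ⟨v, hA⟩) ⟨v, hB⟩ h)
      · exact fallback hΓ hT h
    | _ => exact fallback hΓ hT h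
  | _ => exact fallback hΓ hT h

omit hinf in
theorem Tm.subst_upSub_inst (σ : List Tm) (t a : Tm) :
    (t.subst (upSub (listSub σ))).inst a = t.subst (listSub (a :: σ)) := by
  rw [Tm.inst, Tm.subst_subst]
  congr 1; funext n
  cases n with
  | zero => rfl
  | succ n =>
    simp only [upSub, Tm.wk, Tm.subst_rename]
    exact Tm.subst_var _

theorem inferArgs_sound {Γ : List Tm} (hΓ : WfCtx (Γ.map (Tm.mapLvl (lvl i)))) {F f T : Tm}
    {σ s : List Tm} (h : inferArgs inf k Γ s F σ = some T)
    (hf : HasType (Γ.map (Tm.mapLvl (lvl i))) (f.mapLvl (lvl i))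
      ((F.subst (listSub σ)).mapLvl (lvl i)))
    (hF : IsType (Γ.map (Tm.mapLvl (lvl i))) ((F.subst (listSub σ)).mapLvl (lvl i))) :
    HasType (Γ.map (Tm.mapLvl (lvl i))) ((f.apps s).mapLvl (lvl i)) (T.mapLvl (lvl i)) ∧
      IsType (Γ.map (Tm.mapLvl (lvl i))) (T.mapLvl (lvl i)) := by
  have step : ∀ {A B f a : Tm} {σ : List Tm}, HasType (Γ.map (Tm.mapLvl (lvl i)))
      (f.mapLvl (lvl i)) (((Tm.pi A B).subst (listSub σ)).mapLvl (lvl i)) →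
      IsType (Γ.map (Tm.mapLvl (lvl i))) (((Tm.pi A B).subst (listSub σ)).mapLvl (lvl i)) →
      check inf k a Γ (A.subst (listSub σ)) = true →
      HasType (Γ.map (Tm.mapLvl (lvl i))) ((f.app a).mapLvl (lvl i))
        ((B.subst (listSub (a :: σ))).mapLvl (lvl i)) ∧
      IsType (Γ.map (Tm.mapLvl (lvl i))) ((B.subst (listSub (a :: σ))).mapLvl (lvl i)) := by
    intro A B f a σ hf ⟨u, hF⟩ ha
    obtain ⟨v, hA, hB⟩ := hF.pi_inv
    have ha := check_sound hinf hΓ ⟨v, hA⟩ ha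
    rw [← Tm.subst_upSub_inst, Tm.mapLvl_inst]
    exact ⟨.app hf ha, v, hB.inst ha⟩
  induction s generalizing F f σ with
  | nil =>
    obtain rfl := Option.some.inj h
    rw [Tm.insts_zero]
    exact ⟨hf, hF⟩
  | cons a s ih =>
    simp only [inferArgs, inferArg] at h
    split at h
    · rename_i A B
      simp only [Bool.cond_eq_ite] at h
      split_ifs at h with ha
      rw [Tm.insts_zero] at ha
      obtain ⟨hf, hF⟩ := step hf hF ha
      exact ih h hf hF
    · unfold inferFun at h
      split at h <;> [skip; contradiction]
      rename_i A B e
      simp only [Bool.cond_eq_ite, Bool.and_eq_true] at h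
      split_ifs at h with ha
      rw [Tm.insts_zero] at e
      have hc := (whnf_sound k (F.subst (listSub σ)) []).mapLvl (lvl i)
      rw [e] at hc
      have hAB := tyLvl_isSome hinf hΓ ha.1
      have hf' := HasType.conv hf hc hAB.choose_spec
      -- After reduction no substitution is pending, and `listSub []` is the identity substitution.
      rw [← Tm.subst_var (.pi A B)] at hf' hAB
      rw [← Tm.subst_var A] at ha
      obtain ⟨hf, hF⟩ := step (σ := []) hf' hAB ha.2
      exact ih h hf hF

end

theorem lookup_eq (Γ : List Tm) (n : ℕ) : lookup Γ n = Γ[n]? := by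
  induction Γ generalizing n with
  | nil => rfl
  | cons A Γ ih => cases n <;> simp [lookup, ih]

/-- The types of the constants in the list are well formed. -/
def ConstsOk (i : ℕ) (cs : List Const) : Prop :=
  ∀ c ∈ cs, (constType c).mapLvl (lvl i) = constType (c.mapLvl (lvl i)) ∧
    IsType [] ((constType c).mapLvl (lvl i))

/-- Induction on the step bound: inference with one step more is sound because its recursive calls
are. Well-formedness of the inferred type is carried along since checking an argument presupposes
that the domain is a type. -/
theorem infer_sound {i : ℕ} {cs : List Const} (hcs : ConstsOk i cs) (k : ℕ) :
    InferSound (lvl i) (infer cs k) := by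
  induction k with
  | zero => intro Γ t T _ h; simp [infer] at h
  | succ k ih =>
    intro Γ t T hΓ h
    cases t with
    | var n =>
      simp only [infer, inferStep, inferVar] at h
      split at h
      · rename_i A e
        obtain rfl := Option.some.inj h
        rw [lookup_eq] at e
        rw [Tm.shift_eq, Tm.mapLvl_rename]
        have e' : (Γ.map (Tm.mapLvl (lvl i)))[n]? = some (A.mapLvl (lvl i)) := by simp [e]
        exact ⟨.var e', hΓ.isType e'⟩
      · contradiction
    | con c =>
      simp only [infer, inferStep, Bool.cond_eq_ite] at h
      split_ifs at h with hc
      obtain rfl := Option.some.inj h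
      obtain ⟨c', hc', e⟩ := List.any_eq_true.1 hc
      obtain rfl := Const.eq_of_beq e
      have hT := (hcs c hc').2.of_nil (Γ.map (Tm.mapLvl (lvl i)))
      rw [(hcs c hc').1, constType_subst] at hT
      rw [(hcs c hc').1]
      exact ⟨.con _, hT⟩
    | univ a =>
      simp only [infer, inferStep, Bool.cond_eq_ite] at h
      split_ifs at h with ha
      obtain rfl := Option.some.inj h
      simp only [Tm.mapLvl, lvl_succ (Bool.eq_false_iff.2 ha)]
      exact ⟨.univ _, _, .univ _⟩
    | pi A B =>
      simp only [infer, inferStep, inferPi, Option.map_eq_some_iff, Option.bind_eq_some_iff] at h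
      obtain ⟨c, ⟨a, hA, b, hB, hc⟩, rfl⟩ := h
      have hA := tyLvl_sound ih hΓ hA
      have hB := tyLvl_sound ih (Γ := A :: Γ) (.cons hΓ ⟨_, hA⟩) hB
      refine ⟨?_, _, .univ _⟩
      simp only [lvlMax, Bool.cond_eq_ite] at hc
      split_ifs at hc with h1 h2 h3
      · obtain rfl := Option.some.inj hc
        exact .pi (.cumul_le hA (lvl_le h1 i)) hB
      · obtain rfl := Option.some.inj hc
        exact .pi hA (.cumul_le hB (lvl_le h2 i))
      · obtain rfl := Option.some.inj hc
        rw [Bool.and_eq_true] at h3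
        exact .pi (.cumul_le hA (lvl_le h3.1 i)) (.cumul_le hB (lvl_le h3.2 i))
    | lam A b =>
      simp only [infer, inferStep, inferLam, Bool.cond_eq_ite] at h
      split_ifs at h with hA
      obtain ⟨B, hb, rfl⟩ := Option.map_eq_some_iff.1 h
      obtain ⟨v, hA⟩ := tyLvl_isSome ih hΓ hA
      obtain ⟨hb, u, hB⟩ := ih (A :: Γ) _ _ (.cons hΓ ⟨_, hA⟩) hb
      exact ⟨.lam hA hb, _, .pi (.cumul_le hA (le_max_left _ u)) (.cumul_le hB (le_max_right v u))⟩
    | app f a =>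
      simp only [infer, inferStep, inferApp] at h
      obtain ⟨F, hF, h⟩ := Option.bind_eq_some_iff.1 h
      have hs := Tm.spine_apps f [a]
      generalize f.spine [a] = p at h hF hs
      obtain ⟨ht, hT⟩ := ih _ _ _ hΓ hF
      rw [← Tm.subst_var F] at ht hT
      have := inferArgs_sound ih hΓ h ht hT
      rwa [hs] at this

/-- A test for the well-formedness of the types of constants; the constants that occur in such a
type have to stand later in the list. -/
def constsTest (k : ℕ) : List Const → Bool
  | [] => true
  | c :: cs => constsTest k cs && (c.lvlOk && (tyLvl (infer cs k) k [] (constType c)).isSome)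

theorem constsTest_sound {k : ℕ} {cs : List Const} (h : constsTest k cs = true) (i : ℕ) :
    ConstsOk i cs := by
  induction cs with
  | nil => simp [ConstsOk]
  | cons c cs ih =>
    simp only [constsTest, Bool.and_eq_true] at h
    intro c' hc'
    obtain rfl | hc' := List.mem_cons.1 hc'
    · exact ⟨constType_mapLvl h.2.1 i, tyLvl_isSome (infer_sound (ih h.1) k) (Γ := []) .nil h.2.2⟩
    · exact ih h.1 c' hc'


/-! ### Libraries of theorems

A library is a context of closed types that are inhabited in the theory. Its theorems can be used
as variables in the proofs of further theorems. -/

/-- Closed types that are inhabited in the context `Γ` are inhabited. -/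
def Realizable (i : ℕ) (Γ : List Tm) : Prop :=
  ∀ t T : Tm, T.closedAt 0 = true → HasType (Γ.map (Tm.mapLvl (lvl i))) t T → ∃ t, HasType [] t T

/-- The bound on the number of steps of the type checker -/
def fuel : ℕ := 100000

/-- The constants that may be used in proofs -/
def consts : List Const :=
  [.leInd 1 0, .brwInd 1 0, .brwInd 0 0, .leProp, .leLimiting, .leCocone, .leSuc, .leTrans,
    .leZero, .brwSet, .bisim, .blim, .bsuc, .bzero, .le, .brw,
    .truncRec 0 0, .truncRec 1000 0, .truncRec 0 1000, .truncRec 1000 1000,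
    .truncProp 0, .truncProp 1000, .truncIn 0, .truncIn 1000, .trunc 0, .trunc 1000,
    .univalence 0, .funext 0, .idInd 0 0, .idInd 0 1, .idInd 1 0, .idInd 1 1, .idInd 0 1000, .idInd 1000 1000,
    .refl 0, .refl 1, .refl 1000, .id 0, .id 1, .id 1000,
    .natInd 0, .natInd 1, .natInd 1000, .natInd 1001, .succ, .zero, .nat,
    .boolInd 0, .boolInd 1, .boolInd 1000, .tt, .ff, .bool,
    .unitInd 0, .star, .unit, .emptyInd 0, .emptyInd 1000, .empty,
    .sumInd 0 0, .sumInd 0 1000, .sumInd 1000 0, .sumInd 1000 1000,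
    .inr 0, .inr 1000, .inl 0, .inl 1000, .sum 0, .sum 1000,
    .sigInd 0 0, .sigInd 0 1, .sigInd 0 1000, .sigInd 1000 0, .sigInd 1000 1000, .sigInd 1 0, .sigInd 1 1,
    .sigInd 1001 1001, .pair 0, .pair 1, .pair 1000, .pair 1001, .sig 0, .sig 1, .sig 1000,
    .sig 1001]

theorem constsOk (i : ℕ) : ConstsOk i consts :=
  constsTest_sound (k := fuel) (by decide +kernel) i

/-- In the context `Γ`, the term `a` has the type `A`. -/
def test (Γ : List Tm) (a A : Tm) : Bool :=
  (tyLvl (infer consts fuel) fuel Γ A).isSome && check (infer consts fuel) fuel a Γ A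

theorem test_sound (i : ℕ) {Γ : List Tm} (hΓ : WfCtx (Γ.map (Tm.mapLvl (lvl i)))) {a A : Tm}
    (h : test Γ a A = true) :
    IsType (Γ.map (Tm.mapLvl (lvl i))) (A.mapLvl (lvl i)) ∧
      HasType (Γ.map (Tm.mapLvl (lvl i))) (a.mapLvl (lvl i)) (A.mapLvl (lvl i)) := by
  simp only [test, Bool.and_eq_true] at h
  have hinf := infer_sound (constsOk i) fuel
  have hA := tyLvl_isSome hinf hΓ h.1
  exact ⟨hA, check_sound hinf hΓ hA h.2⟩

/-- A library with its number of theorems -/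
structure Lib where
  ctx : List Tm
  size : ℕ
  wf (i : ℕ) : WfCtx (ctx.map (Tm.mapLvl (lvl i)))
  realizable (i : ℕ) : Realizable i ctx

def Lib.empty : Lib := ⟨[], 0, fun _ => .nil, fun _ t _ _ ht => ⟨t, ht⟩⟩

/-- `T A` is the type of expressions that are meant to have type `A`. Judgmental equality is not
taken into account; type correctness is tested when a theorem is added to a library. -/
structure T (A : Exp) where
  tm : Exp

/-- A library with one more theorem -/
def Lib.add (L : Lib) {A : Exp} (a : T A)
    (h : test L.ctx (a.tm.atDepth L.size) A.close = true) : Lib where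
  ctx := A.close :: L.ctx
  size := L.size + 1
  wf i := .cons (L.wf i) (test_sound i (L.wf i) h).1
  realizable i t B hB ht := by
    obtain ⟨⟨u, hA⟩, ha⟩ := test_sound i (L.wf i) h
    -- The new variable is discharged by a cut, the redex `(λ x : A, t) a`. Its type is unchanged
    -- because `B` is closed.
    have := HasType.app (.lam hA ht) ha
    rw [Tm.inst, Tm.subst_closed B 0 _ (by simp) hB] at this
    exact L.realizable i _ _ hB this

/-- The theorem that is added next to a library -/
def Lib.next (L : Lib) (A : Exp) : T A := ⟨Exp.bound L.size⟩

/-- One evaluation of the checker at symbolic levels covers every `i`; the remaining equation only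
says that `B` is the instance of `A` at `i`. -/
theorem Lib.provable (L : Lib) {A : Exp} (a : T A) (i : ℕ) (B : Exp)
    (h : test L.ctx (a.tm.atDepth L.size) A.close = true) (hA : A.close.closedAt 0 = true)
    (hB : B.close = A.close.mapLvl (lvl i)) : Provable B := by
  have := (test_sound i (L.wf i) h).2
  rw [← hB] at this
  refine L.realizable i _ _ ?_ this
  rw [hB, Tm.closedAt_mapLvl, hA]

/-! ### Writing proofs -/

variable {i j : ℕ} {A A' : Exp} {B : Exp → Exp} {C : Exp}

instance : CoeOut (T A) Exp := ⟨T.tm⟩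

/-- The same expression, at a judgmentally equal type -/
def T.cast (x : T A) : T A' := ⟨x.tm⟩

def fn (b : (x : T A) → T (B x.tm)) : T (pi A B) := ⟨lam A fun x => (b ⟨x⟩).tm⟩

def T.app (f : T (pi A B)) (a : T A) : T (B a.tm) := ⟨f.tm a.tm⟩

infixl:90 " ⬝ " => T.app

/-- The truncation of `A` -/
def trunc (i : ℕ) (A : Exp) : Exp := con (.trunc i) A

/-- The disjoint sum of `A` and `B` -/
def sum (i : ℕ) (A B : Exp) : Exp := con (.sum i) A B

def unit : Exp := con .unit
def zero : Exp := con .zero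
def ff : Exp := con .ff
def tt : Exp := con .tt

def mk (a : T A) (b : T (B a.tm)) : T (sig i A B) := ⟨pair i A B a.tm b.tm⟩

def T.fst (p : T (sig i A B)) : T A := ⟨HoTT.fst i A B p.tm⟩

def T.snd (p : T (sig i A B)) : T (B (HoTT.fst i A B p.tm)) := ⟨HoTT.snd i A B p.tm⟩

/-- Elimination of a pair into `C`, a type of level `j` -/
def T.split (j : ℕ) (p : T (sig i A B)) (f : (a : T A) → (b : T (B a.tm)) → T C) : T C :=
  ⟨con (.sigInd i j) A (lam A B) (lam (sig i A B) fun _ => C)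
    (lam A fun a => lam (B a) fun b => (f ⟨a⟩ ⟨b⟩).tm) p.tm⟩

/-- Dependent elimination of a pair -/
def sigElim (j : ℕ) (D : Exp → Exp)
    (f : (a : T A) → (b : T (B a.tm)) → T (D (pair i A B a.tm b.tm))) (p : T (sig i A B)) :
    T (D p.tm) :=
  ⟨con (.sigInd i j) A (lam A B) (lam (sig i A B) D)
    (lam A fun a => lam (B a) fun b => (f ⟨a⟩ ⟨b⟩).tm) p.tm⟩

def T.inTrunc (a : T A) : T (trunc i A) := ⟨con (.truncIn i) A a.tm⟩

/-- Elimination of a truncation into a proposition `C` of level `j` -/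
def T.untrunc (t : T (trunc i A)) (h : T (isProp j C)) (f : T A → T C) : T C :=
  ⟨con (.truncRec i j) A C h.tm (lam A fun a => (f ⟨a⟩).tm) t.tm⟩

def truncProp : T (isProp i (trunc i A)) := ⟨con (.truncProp i) A⟩

def exMk (a : T A) (b : T (B a.tm)) : T (exist i A B) := ⟨(mk (i := i) a b).inTrunc (i := i).tm⟩

/-- Elimination of `∃` into a proposition `C` of level `j` -/
def T.exElim (t : T (exist i A B)) (h : T (isProp j C))
    (f : (a : T A) → (b : T (B a.tm)) → T C) : T C :=
  ⟨con (.truncRec i j) (sig i A B) C h.tm (lam (sig i A B) fun p => (T.split (i := i) (A := A) (B := B) j ⟨p⟩ f).tm) t.tm⟩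

def inl {A B : Exp} (a : T A) : T (sum i A B) := ⟨con (.inl i) A B a.tm⟩

def inr {A B : Exp} (b : T B) : T (sum i A B) := ⟨con (.inr i) A B b.tm⟩

/-- Case distinction, into a type `C` of level `j` -/
def T.cases {A B : Exp} (j : ℕ) (s : T (sum i A B)) (f : T A → T C) (g : T B → T C) : T C :=
  ⟨con (.sumInd i j) A B (lam (sum i A B) fun _ => C) (lam A fun a => (f ⟨a⟩).tm)
    (lam B fun b => (g ⟨b⟩).tm) s.tm⟩

def T.absurd (j : ℕ) (e : T empty) : T C := ⟨con (.emptyInd j) (lam empty fun _ => C) e.tm⟩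

def star : T unit := ⟨con .star⟩

def boolElim (j : ℕ) (D : Exp → Exp) (d : T (D ff)) (e : T (D tt)) (b : T bool) : T (D b.tm) :=
  ⟨con (.boolInd j) (lam bool D) d.tm e.tm b.tm⟩

def natElim (j : ℕ) (D : Exp → Exp) (d : T (D zero))
    (e : (n : T nat) → T (D n.tm) → T (D (succ n.tm))) (n : T nat) : T (D n.tm) :=
  ⟨con (.natInd j) (lam nat D) d.tm
    (lam nat fun n => lam (D n) fun h => (e ⟨n⟩ ⟨h⟩).tm) n.tm⟩

/-- Reflexivity, for judgmentally equal `a` and `b` -/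
def rfl' {a b : Exp} : T (eq i A a b) := ⟨con (.refl i) A a⟩

/-- Path induction -/
def idElim (j : ℕ) (D : Exp → Exp → Exp → Exp) (d : (x : T A) → T (D x.tm x.tm (con (.refl i) A x.tm)))
    {x y : Exp} (p : T (eq i A x y)) : T (D x y p.tm) :=
  ⟨con (.idInd i j) A (lam A fun x => lam A fun y => lam (eq i A x y) fun p => D x y p)
    (lam A fun x => (d ⟨x⟩).tm) x y p.tm⟩

/-- Transport in a family of types of level `j` -/
def T.subst (j : ℕ) (D : Exp → Exp) {x y : Exp} (p : T (eq i A x y)) (u : T (D x)) : T (D y) :=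
  ⟨transport i j A (lam A D) x y p.tm u.tm⟩

def T.symm {x y : Exp} (p : T (eq i A x y)) : T (eq i A y x) :=
  idElim i (fun x y _ => eq i A y x) (fun _ => rfl') p

def T.trans {x y z : Exp} (p : T (eq i A x y)) (q : T (eq i A y z)) : T (eq i A x z) :=
  q.subst i (fun z => eq i A x z) p

/-- A function `f : A → A'` between types of levels `i` and `j` maps equal arguments to equal
values. -/
def T.ap (j : ℕ) (f : Exp → Exp) {x y : Exp} (p : T (eq i A x y)) : T (eq j A' (f x) (f y)) :=
  idElim j (fun x y _ => eq j A' (f x) (f y)) (fun _ => rfl') p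

/-- Function extensionality -/
def funExt {f g : Exp} (h : T (pi A fun x => eq i (B x) (f x) (g x))) :
    T (eq i (pi A fun x => B x) f g) :=
  let B' := lam A B
  let e : T (isEquiv i (eq i (pi A fun x => B' x) f g) (pi A fun x => eq i (B' x) (f x) (g x))
      (happly i A B' f g)) := ⟨con (.funext i) A B' f g⟩
  ⟨(e.fst.fst).tm h.tm⟩

def leZero {x : Exp} : T (le bzero x) := ⟨con .leZero x⟩

def T.leTrans {x y z : Exp} (e : T (le x y)) (e' : T (le y z)) : T (le x z) :=
  ⟨con .leTrans x y z e.tm e'.tm⟩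

def T.leSuc {x y : Exp} (e : T (le x y)) : T (le (bsuc x) (bsuc y)) := ⟨con .leSuc x y e.tm⟩

def T.leCocone {x f : Exp} (k : T nat) (e : T (le x (f k.tm))) {p : Exp} : T (le x (blim f p)) :=
  ⟨con .leCocone x f p k.tm e.tm⟩

def leLimiting {f p x : Exp} (h : T (pi nat fun k => le (f k) x)) : T (le (blim f p) x) :=
  ⟨con .leLimiting f p x h.tm⟩

def leProp {x y : Exp} : T (isProp 0 (le x y)) := ⟨con .leProp x y⟩

def T.succ (n : T nat) : T nat := ⟨HoTT.succ n.tm⟩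


/-! ### Identity types and propositions -/

def symmTy (i : ℕ) : Exp :=
  pi (univ i) fun A => pi A fun x => pi A fun y => arr (eq i A x y) (eq i A y x)

def transTy (i : ℕ) : Exp :=
  pi (univ i) fun A => pi A fun x => pi A fun y => pi A fun z =>
    arr (eq i A x y) (arr (eq i A y z) (eq i A x z))

/-- A library theorem is a variable and never unfolds. This keeps later proof terms small where the
computation of the path is irrelevant. -/
def libSymm : Lib :=
  Lib.empty.add (A := symmTy 0)
    (fn fun _ => fn fun _ => fn fun _ => fn fun p => p.symm) (by decide +kernel)

def libSymmOne : Lib :=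
  libSymm.add (A := symmTy 1)
    (fn fun _ => fn fun _ => fn fun _ => fn fun p => p.symm) (by decide +kernel)

def libTrans : Lib :=
  libSymmOne.add (A := transTy 0)
    (fn fun _ => fn fun _ => fn fun _ => fn fun _ => fn fun p => fn fun q => p.trans q)
    (by decide +kernel)

def libTransOne : Lib :=
  libTrans.add (A := transTy 1)
    (fn fun _ => fn fun _ => fn fun _ => fn fun _ => fn fun p => fn fun q => p.trans q)
    (by decide +kernel)

section
variable {i : ℕ} {A x y z : Exp}

/-- Symmetry of equality, as a theorem without computation rule -/
def T.symm₀ (p : T (eq 0 A x y)) : T (eq 0 A y x) :=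
  Lib.empty.next (symmTy 0) ⬝ ⟨A⟩ ⬝ ⟨x⟩ ⬝ ⟨y⟩ ⬝ p

def T.symm₁ (p : T (eq 1 A x y)) : T (eq 1 A y x) :=
  libSymm.next (symmTy 1) ⬝ ⟨A⟩ ⬝ ⟨x⟩ ⬝ ⟨y⟩ ⬝ p

def T.trans₀ (p : T (eq 0 A x y)) (q : T (eq 0 A y z)) : T (eq 0 A x z) :=
  libSymmOne.next (transTy 0) ⬝ ⟨A⟩ ⬝ ⟨x⟩ ⬝ ⟨y⟩ ⬝ ⟨z⟩ ⬝ p ⬝ q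

def T.trans₁ (p : T (eq 1 A x y)) (q : T (eq 1 A y z)) : T (eq 1 A x z) :=
  libTrans.next (transTy 1) ⬝ ⟨A⟩ ⬝ ⟨x⟩ ⬝ ⟨y⟩ ⬝ ⟨z⟩ ⬝ p ⬝ q

end

/-- `p⁻¹ p` is trivial. -/
def symmTransTy (i : ℕ) : Exp :=
  pi (univ i) fun A => pi A fun x => pi A fun y => pi (eq i A x y) fun p =>
    eq i (eq i A y y) ((T.mk (A := eq i A x y) p).symm.trans (T.mk (A := eq i A x y) p))
      (con (.refl i) A y)

def symmTransPf (i : ℕ) : T (symmTransTy i) :=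
  fn fun A => fn fun x => fn fun y => fn fun p =>
    idElim i (fun x y r => eq i (eq i A y y)
      ((T.mk (A := eq i A x y) r).symm.trans (T.mk (A := eq i A x y) r)) (con (.refl i) A y))
      (fun _ => rfl') p

def libSymmTrans : Lib := libTransOne.add (symmTransPf 0) (by decide +kernel)

def libSymmTransOne : Lib := libSymmTrans.add (symmTransPf 1) (by decide +kernel)

def propIsSetTy : Exp := pi (univ 0) fun X => arr (isProp 0 X) (isSet 0 X)

/-- By path induction every `r : x = y` equals `(h x x)⁻¹ (h x y)`, which does not mention `r`. So
any two paths are equal. -/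
def propIsSetPf : T propIsSetTy :=
  fn fun X => fn fun h => fn fun x => fn fun y => fn fun p => fn fun q =>
    let key (r : T (eq 0 X x y)) : T (eq 0 (eq 0 X x y) ((h ⬝ x ⬝ x).symm.trans (h ⬝ x ⬝ y)) r) :=
      idElim 0 (fun x y r => eq 0 (eq 0 X x y) ((h ⬝ ⟨x⟩ ⬝ ⟨x⟩).symm.trans (h ⬝ ⟨x⟩ ⬝ ⟨y⟩)) r)
        (fun x => libTransOne.next (symmTransTy 0) ⬝ X ⬝ x ⬝ x ⬝ (h ⬝ x ⬝ x)) r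
    (key p).symm₀.trans₀ (key q)

def libPropIsSet : Lib := libSymmTransOne.add propIsSetPf (by decide +kernel)

def propIsSet {X : Exp} (h : T (isProp 0 X)) : T (isSet 0 X) :=
  libSymmTransOne.next propIsSetTy ⬝ ⟨X⟩ ⬝ h

def isPropIsPropTy : Exp := pi (univ 0) fun X => isProp 0 (isProp 0 X)

def libIsPropIsProp : Lib :=
  libPropIsSet.add (A := isPropIsPropTy)
    (fn fun _ => fn fun f => fn fun g =>
      funExt (fn fun x => funExt (fn fun y => propIsSet f ⬝ x ⬝ y ⬝ (f ⬝ x ⬝ y) ⬝ (g ⬝ x ⬝ y))))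
    (by decide +kernel)

def isPropArrTy : Exp :=
  pi (univ 0) fun X => pi (univ 0) fun Y => arr (isProp 0 Y) (isProp 0 (arr X Y))

def libIsPropArr : Lib :=
  libIsPropIsProp.add (A := isPropArrTy)
    (fn fun _ => fn fun _ => fn fun h => fn fun f => fn fun g =>
      funExt (fn fun x => h ⬝ (f ⬝ x) ⬝ (g ⬝ x)))
    (by decide +kernel)

def isPropArr {X Y : Exp} (h : T (isProp 0 Y)) : T (isProp 0 (arr X Y)) :=
  libIsPropIsProp.next isPropArrTy ⬝ ⟨X⟩ ⬝ ⟨Y⟩ ⬝ h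

/-- Propositional extensionality, from univalence -/
def propExtTy : Exp :=
  pi (univ 0) fun X => pi (univ 0) fun Y => arr (isProp 0 X) (arr (isProp 0 Y)
    (arr (arr X Y) (arr (arr Y X) (eq 1 (univ 0) X Y))))

def propExtPf : T propExtTy :=
  fn fun X => fn fun Y => fn fun hX => fn fun hY => fn fun f => fn fun g =>
    let ua : T (isEquiv 1 (eq 1 (univ 0) X Y) (equiv 0 X Y) (idToEquiv 0 X Y)) :=
      ⟨con (.univalence 0) X Y⟩
    -- The right inverse of the univalence map, applied to the equivalence whose right and left
    -- inverse are both `g`.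
    ua.fst.fst ⬝ mk f (mk (mk g (fn fun y => hY ⬝ (f ⬝ (g ⬝ y)) ⬝ y))
      (mk g (fn fun x => hX ⬝ (g ⬝ (f ⬝ x)) ⬝ x)))

def libPropExt : Lib := libIsPropArr.add propExtPf (by decide +kernel)

/-- The proposition with underlying type `X` -/
def mkProp {X : Exp} (h : T (isProp 0 X)) : T (hProp 0) := mk ⟨X⟩ h

def pairPropTy : Exp :=
  pi (univ 0) fun X => pi (univ 0) fun Y => arr (eq 1 (univ 0) X Y)
    (pi (isProp 0 X) fun h => pi (isProp 0 Y) fun h' =>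
      eq 1 (hProp 0) (mkProp (X := X) ⟨h⟩) (mkProp (X := Y) ⟨h'⟩))

/-- Path induction reduces to two proofs that the same type is a proposition, and these are equal.
-/
def pairPropPf : T pairPropTy :=
  fn fun _ => fn fun _ => fn fun p =>
    idElim 1 (fun X Y _ => pi (isProp 0 X) fun h => pi (isProp 0 Y) fun h' =>
        eq 1 (hProp 0) (mkProp (X := X) ⟨h⟩) (mkProp (X := Y) ⟨h'⟩))
      (fun X => fn fun h => fn fun h' =>
        (libPropIsSet.next isPropIsPropTy ⬝ X ⬝ h ⬝ h').ap 1 fun h => mkProp (X := X) ⟨h⟩) p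

def libPairProp : Lib := libPropExt.add pairPropPf (by decide +kernel)

def hPropExtTy : Exp :=
  pi (hProp 0) fun P => pi (hProp 0) fun Q =>
    arr (arr (holds 0 P) (holds 0 Q)) (arr (arr (holds 0 Q) (holds 0 P)) (eq 1 (hProp 0) P Q))

/-- Pairs have no judgmental `η`, so both propositions are first taken apart by dependent
elimination. -/
def hPropExtPf : T hPropExtTy :=
  fn fun P => sigElim 1 (fun P => pi (hProp 0) fun Q =>
      arr (arr (holds 0 P) (holds 0 Q)) (arr (arr (holds 0 Q) (holds 0 P)) (eq 1 (hProp 0) P Q)))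
    (fun X h => fn fun Q => sigElim 1 (fun Q =>
      arr (arr (holds 0 (mkProp h)) (holds 0 Q)) (arr (arr (holds 0 Q) (holds 0 (mkProp h)))
        (eq 1 (hProp 0) (mkProp h) Q)))
      (fun Y h' => fn fun f => fn fun g =>
        libPropExt.next pairPropTy ⬝ X ⬝ Y ⬝
          (libIsPropArr.next propExtTy ⬝ X ⬝ Y ⬝ h ⬝ h' ⬝ f.cast ⬝ g.cast) ⬝ h ⬝ h') Q) P

def libHPropExt : Lib := libPairProp.add hPropExtPf (by decide +kernel)

def hPropExt {P Q : Exp} (f : T (arr (holds 0 P) (holds 0 Q))) (g : T (arr (holds 0 Q) (holds 0 P))) :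
    T (eq 1 (hProp 0) P Q) :=
  libPairProp.next hPropExtTy ⬝ ⟨P⟩ ⬝ ⟨Q⟩ ⬝ f ⬝ g

/-- The type that underlies a proposition is a proposition. -/
def holdsProp (P : T (hProp 0)) : T (isProp 0 (holds 0 P)) := P.snd.cast

/-- The implication between equal propositions -/
def impOfEq {P Q : Exp} (p : T (eq 1 (hProp 0) P Q)) : T (arr (holds 0 P) (holds 0 Q)) :=
  fn fun h => p.subst 0 (fun P => holds 0 P) h

def impOfEq' {P Q : Exp} (p : T (eq 1 (hProp 0) P Q)) : T (arr (holds 0 Q) (holds 0 P)) :=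
  fn fun h => p.symm.subst 0 (fun P => holds 0 P) h

/-- Equality of propositions, expressed through a proof `e` of propositional extensionality -/
def hPropEqVia (e : T hPropExtTy) {P Q : Exp} (f : T (arr (holds 0 P) (holds 0 Q)))
    (g : T (arr (holds 0 Q) (holds 0 P))) : T (eq 1 (hProp 0) P Q) :=
  let r : T (eq 1 (hProp 0) P P) := e ⬝ ⟨P⟩ ⬝ ⟨P⟩ ⬝ (fn fun h => h) ⬝ (fn fun h => h)
  r.symm.trans (e ⬝ ⟨P⟩ ⬝ ⟨Q⟩ ⬝ f ⬝ g)

/-- Every equality of propositions is recovered from its two implications. On reflexivity these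
compute to identities, and the factor `r⁻¹` in `hPropEqVia` was inserted to make the result trivial
there. The proof `e` of extensionality stays a variable, as nothing about it matters. -/
def hPropEqTy : Exp :=
  pi hPropExtTy fun e => pi (hProp 0) fun P => pi (hProp 0) fun Q => pi (eq 1 (hProp 0) P Q) fun p =>
    eq 1 (eq 1 (hProp 0) P Q)
      (hPropEqVia ⟨e⟩ (impOfEq (P := P) (Q := Q) ⟨p⟩) (impOfEq' (P := P) (Q := Q) ⟨p⟩)) p

def hPropEqPf : T hPropEqTy :=
  fn fun e => fn fun _ => fn fun _ => fn fun p =>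
    idElim 1 (fun P Q p => eq 1 (eq 1 (hProp 0) P Q)
      (hPropEqVia e (impOfEq (P := P) (Q := Q) ⟨p⟩) (impOfEq' (P := P) (Q := Q) ⟨p⟩)) p)
      (fun P => (libSymmTrans.next (symmTransTy 1) ⬝ ⟨hProp 0⟩ ⬝ P ⬝ P ⬝
        (e ⬝ P ⬝ P ⬝ (fn fun h => h) ⬝ (fn fun h => h))).cast) p

def libHPropEq : Lib := libHPropExt.add hPropEqPf (by decide +kernel)

/-- Both `p` and `q` are recovered from their implications, and implications between propositions
are unique. The two implications are exchanged one at a time. -/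
def hPropSetPf : T (isSet 1 (hProp 0)) :=
  fn fun P => fn fun Q => fn fun p => fn fun q =>
    let ext := libPairProp.next hPropExtTy
    let key := libHPropExt.next hPropEqTy ⬝ ext ⬝ P ⬝ Q
    let e := isPropArr (X := holds 0 P) (holdsProp Q) ⬝ impOfEq p ⬝ impOfEq q
    let e' := isPropArr (X := holds 0 Q) (holdsProp P) ⬝ impOfEq' p ⬝ impOfEq' q
    let a := e.ap (A' := eq 1 (hProp 0) P Q) 1 fun f => hPropEqVia ext ⟨f⟩ (impOfEq' p)
    let b := e'.ap (A' := eq 1 (hProp 0) P Q) 1 fun g => hPropEqVia ext (impOfEq q) ⟨g⟩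
    (key ⬝ p).symm₁.trans₁ ((a.trans₁ b).trans₁ (key ⬝ q))

def libHPropSet : Lib := libHPropEq.add hPropSetPf (by decide +kernel)

def hPropSet : T (isSet 1 (hProp 0)) := libHPropEq.next _


/-! ### The order of Brouwer trees -/

def unitPropPf : T (isProp 0 unit) :=
  let ind (D : Exp → Exp) (d : T (D star)) : T (pi unit D) := ⟨con (.unitInd 0) (lam unit D) d⟩
  ind (fun x => pi unit fun y => eq 0 unit x y) (ind (fun y => eq 0 unit star y) rfl')

def libUnitProp : Lib := libHPropSet.add unitPropPf (by decide +kernel)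

def unitProp : T (isProp 0 unit) := libHPropSet.next _

/-- Induction on Brouwer trees, for families of propositions -/
def brwPropIndTy : Exp :=
  pi (arr brw (univ 0)) fun C =>
    arr (pi brw fun x => isProp 0 (C x)) <|
    arr (C bzero) <|
    arr (pi brw fun x => arr (C x) (C (bsuc x))) <|
    arr (pi (arr nat brw) fun f => pi (increasing f) fun p => arr (pi nat fun n => C (f n)) (C (blim f p))) <|
      pi brw fun x => C x

/-- The family over `≤` is trivial, constantly the unit type. The methods for the path constructor
and for being a set come for free in a family of propositions. -/
def brwPropIndPf : T brwPropIndTy :=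
  fn fun C => fn fun hC => fn fun hz => fn fun hs => fn fun hl =>
    let ind : T (brwTelescope 0 0 fun C _ _ _ _ _ _ _ _ _ _ _ _ => pi brw fun x => C x) :=
      ⟨con (.brwInd 0 0)⟩
    ind ⬝ C ⬝ (fn fun _ => fn fun _ => fn fun _ => fn fun _ => fn fun _ => ⟨unit⟩) ⬝ hz ⬝ hs ⬝
      (fn fun f => fn fun p => fn fun cf => fn fun _ => hl ⬝ f ⬝ p ⬝ cf) ⬝
      (fn fun _ => fn fun _ => fn fun _ => fn fun _ => fn fun _ => fn fun _ => fn fun _ =>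
        fn fun _ => fn fun _ => fn fun _ => fn fun _ => fn fun _ => hC ⬝ _ ⬝ ⟨_⟩ ⬝ ⟨_⟩) ⬝
      (fn fun x => propIsSet (X := C.tm x) (hC ⬝ x)) ⬝
      (fn fun _ => fn fun _ => star.cast) ⬝
      (fn fun _ => fn fun _ => fn fun _ => fn fun _ => fn fun _ => fn fun _ => fn fun _ =>
        fn fun _ => fn fun _ => fn fun _ => star.cast) ⬝
      (fn fun _ => fn fun _ => fn fun _ => fn fun _ => fn fun _ => fn fun _ => star.cast) ⬝
      (fn fun _ => fn fun _ => fn fun _ => fn fun _ => fn fun _ => fn fun _ => fn fun _ =>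
        fn fun _ => fn fun _ => star.cast) ⬝
      (fn fun _ => fn fun _ => fn fun _ => fn fun _ => fn fun _ => fn fun _ => fn fun _ =>
        fn fun _ => star.cast) ⬝
      (fn fun _ => fn fun _ => fn fun _ => fn fun _ => fn fun _ => unitProp.cast)

def libBrwPropInd : Lib := libUnitProp.add brwPropIndPf (by decide +kernel)

def brwPropInd (C : Exp → Exp) (hC : (x : T brw) → T (isProp 0 (C x))) (hz : T (C bzero))
    (hs : (x : T brw) → T (C x) → T (C (bsuc x)))
    (hl : (f : T (arr nat brw)) → (p : T (increasing f)) → T (pi nat fun n => C (f.tm n)) → T (C (blim f p)))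
    (x : T brw) : T (C x) :=
  (libUnitProp.next brwPropIndTy ⬝ ⟨lam brw C⟩ ⬝ (fn fun x => (hC x).cast) ⬝ hz.cast ⬝
    (fn fun x => fn fun h => (hs x h.cast).cast) ⬝
    (fn fun f => fn fun p => fn fun h => (hl f p h.cast).cast) ⬝ x).cast

def leReflPf : T (pi brw fun x => le x x) :=
  fn <| brwPropInd (fun x => le x x) (fun _ => leProp) leZero (fun _ h => h.leSuc)
    (fun _ _ h => leLimiting (fn fun k => T.leCocone k (h ⬝ k)))

def libLeRefl : Lib := libBrwPropInd.add leReflPf (by decide +kernel)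

def leRefl {x : Exp} : T (le x x) := libBrwPropInd.next (pi brw fun x => le x x) ⬝ ⟨x⟩

def leSucSelfPf : T (pi brw fun x => le x (bsuc x)) :=
  fn <| brwPropInd (fun x => le x (bsuc x)) (fun _ => leProp) leZero (fun _ h => h.leSuc)
    (fun _ _ h => leLimiting (fn fun k => (h ⬝ k).leTrans (T.leCocone k leRefl).leSuc))

def libLeSucSelf : Lib := libLeRefl.add leSucSelfPf (by decide +kernel)

def leSucSelf {x : Exp} : T (le x (bsuc x)) := libLeRefl.next (pi brw fun x => le x (bsuc x)) ⬝ ⟨x⟩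

/-- `x < y` implies `x ≤ y`. -/
def T.leOfLt {x y : Exp} (h : T (lt x y)) : T (le x y) := leSucSelf.leTrans h

/-- Transport in a constant family of propositions -/
def transportConstTy : Exp :=
  pi brw fun x => pi brw fun y => pi (eq 0 brw x y) fun p => pi (hProp 0) fun u =>
    eq 1 (hProp 0) (transport 0 1 brw (lam brw fun _ => hProp 0) x y p u) u

def transportConstPf : T transportConstTy :=
  fn fun _ => fn fun _ => fn fun p => fn fun u =>
    idElim 1 (fun x y p => eq 1 (hProp 0) (transport 0 1 brw (lam brw fun _ => hProp 0) x y p u) u)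
      (fun _ => rfl') p

def libTransportConst : Lib := libLeSucSelf.add transportConstPf (by decide +kernel)

/-- The sequence `f` with the values `cf` is simulated by `g` with the values `cg`. -/
def simulatedOver (D f cf g cg : Exp) : Exp :=
  pi nat fun k => exist 0 nat fun n => prod 0 (le (f k) (g n)) (D (f k) (g n) (cf k) (cg n))

/-- What is to be shown about a family `V` of propositions over `Brw` with the values `mz`, `ms`,
`ml` at the constructors, and about the relation `D` -/
def propFamilySpec (D mz ms ml V : Exp) : Exp :=
  prod 0 (arr (holds 0 (V bzero)) (holds 0 mz)) <|
  prod 0 (pi brw fun y => iff 0 (holds 0 (V (bsuc y))) (holds 0 (ms y (V y)))) <|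
  prod 0 (pi (arr nat brw) fun f => pi (increasing f) fun p =>
    arr (holds 0 (V (blim f p))) (holds 0 (ml f (lam nat fun n => V (f n))))) <|
    pi brw fun x => pi brw fun y => arr (le x y) (D x y (V x) (V y))

/-- Families of propositions over `Brw` whose values `mz`, `ms`, `ml` at the constructors are given,
together with a relation `D` between the values at `x` and `y` whenever `x ≤ y` -/
def propFamilyTy : Exp :=
  pi (arr brw (arr brw (arr (hProp 0) (arr (hProp 0) (univ 0))))) fun D =>
    arr (pi brw fun x => pi brw fun y => pi (hProp 0) fun cx => pi (hProp 0) fun cy =>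
      isProp 0 (D x y cx cy)) <|
    pi (hProp 0) fun mz => pi (arr brw (arr (hProp 0) (hProp 0))) fun ms =>
    pi (arr (arr nat brw) (arr (arr nat (hProp 0)) (hProp 0))) fun ml =>
    arr (pi (arr nat brw) fun f => pi (arr nat (hProp 0)) fun cf => pi (arr nat brw) fun g =>
      pi (arr nat (hProp 0)) fun cg => arr (simulatedOver D f cf g cg)
        (arr (holds 0 (ml f cf)) (holds 0 (ml g cg)))) <|
    arr (pi brw fun x => pi (hProp 0) fun cx => D bzero x mz cx) <|
    arr (pi brw fun x => pi brw fun y => pi brw fun z =>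
      pi (hProp 0) fun cx => pi (hProp 0) fun cy => pi (hProp 0) fun cz =>
      arr (le x y) (arr (D x y cx cy) (arr (D y z cy cz) (D x z cx cz)))) <|
    arr (pi brw fun x => pi brw fun y => pi (hProp 0) fun cx => pi (hProp 0) fun cy =>
      arr (le x y) (D (bsuc x) (bsuc y) (ms x cx) (ms y cy))) <|
    arr (pi brw fun x => pi (hProp 0) fun cx => pi (arr nat brw) fun f => pi (increasing f) fun p =>
      pi (arr nat (hProp 0)) fun cf => pi nat fun k => arr (le x (f k))
        (arr (D x (f k) cx (cf k)) (D x (blim f p) cx (ml f cf)))) <|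
    arr (pi (arr nat brw) fun f => pi (increasing f) fun p => pi (arr nat (hProp 0)) fun cf =>
      pi brw fun x => pi (hProp 0) fun cx =>
      arr (pi nat fun k => D (f k) x (cf k) cx) (D (blim f p) x (ml f cf) cx)) <|
    sig 1 (arr brw (hProp 0)) (propFamilySpec D mz ms ml)

/-- The eliminator with the constant family of values in `hProp`. The method for bisimilar sequences
is propositional extensionality, after the transport in the constant family is removed; the set
condition is `hPropSet`. The relation `D` ignores the proof of `x ≤ y`. -/
def propFamilyPf : T propFamilyTy :=
  fn fun D => fn fun hD => fn fun mz => fn fun ms => fn fun ml => fn fun hb => fn fun nz =>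
  fn fun nt => fn fun ns => fn fun nc => fn fun nl =>
    let C : Exp := lam brw fun _ => hProp 0
    let D' : Exp := lam brw fun x => lam brw fun y => lam (hProp 0) fun cx => lam (hProp 0) fun cy =>
      lam (le x y) fun _ => D.tm x y cx cy
    let incrOver (f p cf : Exp) : Exp :=
      pi nat fun n => D' (bsuc (f n)) (f (succ n)) (ms.tm (f n) (cf n)) (cf (succ n)) (p n)
    let ml' : T (pi (arr nat brw) fun f => pi (increasing f) fun p => pi (arr nat (hProp 0)) fun cf =>
        arr (incrOver f p cf) (hProp 0)) :=
      fn fun f => fn fun _ => fn fun cf => fn fun _ => ml ⬝ f ⬝ cf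
    let mb : T (pi (arr nat brw) fun f => pi (increasing f) fun p => pi (arr nat (hProp 0)) fun cf =>
        pi (incrOver f p cf) fun _ =>
        pi (arr nat brw) fun g => pi (increasing g) fun q => pi (arr nat (hProp 0)) fun cg =>
        pi (incrOver g q cg) fun _ => pi (simulated f g) fun u => pi (simulated g f) fun v =>
        arr (simulatedOver D f cf g cg) (arr (simulatedOver D g cg f cf)
          (eq 1 (hProp 0) (transport 0 1 brw C (blim f p) (blim g q) (con .bisim f p g q u v)
            (ml.tm f cf)) (ml.tm g cg)))) :=
      fn fun f => fn fun p => fn fun cf => fn fun _ => fn fun g => fn fun q => fn fun cg =>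
        fn fun _ => fn fun u => fn fun v => fn fun s => fn fun s' =>
          let c := libLeSucSelf.next transportConstTy ⬝ ⟨blim f p⟩ ⬝ ⟨blim g q⟩ ⬝
            ⟨con .bisim f p g q u v⟩ ⬝ (ml ⬝ f ⬝ cf)
          c.trans₁ (hPropExt (hb ⬝ f ⬝ cf ⬝ g ⬝ cg ⬝ s) (hb ⬝ g ⬝ cg ⬝ f ⬝ cf ⬝ s'))
    let nt' : T (pi brw fun x => pi brw fun y => pi brw fun z =>
        pi (hProp 0) fun cx => pi (hProp 0) fun cy => pi (hProp 0) fun cz =>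
        pi (le x y) fun _ => pi (le y z) fun _ =>
          arr (D.tm x y cx cy) (arr (D.tm y z cy cz) (D.tm x z cx cz))) :=
      fn fun x => fn fun y => fn fun z => fn fun cx => fn fun cy => fn fun cz =>
        fn fun e => fn fun _ => nt ⬝ x ⬝ y ⬝ z ⬝ cx ⬝ cy ⬝ cz ⬝ e
    let ns' : T (pi brw fun x => pi brw fun y => pi (hProp 0) fun cx => pi (hProp 0) fun cy =>
        pi (le x y) fun _ => arr (D.tm x y cx cy)
          (D.tm (bsuc x) (bsuc y) (ms.tm x cx) (ms.tm y cy))) :=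
      fn fun x => fn fun y => fn fun cx => fn fun cy => fn fun e => fn fun _ =>
        ns ⬝ x ⬝ y ⬝ cx ⬝ cy ⬝ e
    let nc' : T (pi brw fun x => pi (hProp 0) fun cx =>
        pi (arr nat brw) fun f => pi (increasing f) fun p => pi (arr nat (hProp 0)) fun cf =>
        pi (incrOver f p cf) fun _ => pi nat fun k => arr (le x (f k))
          (arr (D.tm x (f k) cx (cf k)) (D.tm x (blim f p) cx (ml.tm f cf)))) :=
      fn fun x => fn fun cx => fn fun f => fn fun p => fn fun cf => fn fun _ =>
        nc ⬝ x ⬝ cx ⬝ f ⬝ p ⬝ cf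
    let nl' : T (pi (arr nat brw) fun f => pi (increasing f) fun p => pi (arr nat (hProp 0)) fun cf =>
        pi (incrOver f p cf) fun _ => pi brw fun x => pi (hProp 0) fun cx =>
        pi (pi nat fun k => le (f k) x) fun _ =>
        arr (pi nat fun k => D.tm (f k) x (cf k) cx) (D.tm (blim f p) x (ml.tm f cf) cx)) :=
      fn fun f => fn fun p => fn fun cf => fn fun _ => fn fun x => fn fun cx => fn fun _ =>
        nl ⬝ f ⬝ p ⬝ cf ⬝ x ⬝ cx
    let mset : T (arr brw (isSet 1 (hProp 0))) := fn fun _ => hPropSet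
    let nprop : T (pi brw fun x => pi brw fun y => pi (hProp 0) fun cx => pi (hProp 0) fun cy =>
        pi (le x y) fun _ => isProp 0 (D.tm x y cx cy)) :=
      fn fun x => fn fun y => fn fun cx => fn fun cy => fn fun _ => hD ⬝ x ⬝ y ⬝ cx ⬝ cy
    let all (c : Const) : Exp := con c C D' mz ms ml' mb mset nz nt' ns' nc' nl' nprop
    -- The family is abstracted as `V`, and the eliminator is substituted only at the end. Its
    -- values at the constructors are judgmental, so identity functions then prove the clauses about
    -- them; the last clause is `leInd`.
    let finish : T (pi (arr brw (hProp 0)) fun V => arr (arr (holds 0 (V bzero)) (holds 0 mz)) <|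
        arr (pi brw fun y => arr (holds 0 (V (bsuc y))) (holds 0 (ms.tm y (V y)))) <|
        arr (pi brw fun y => arr (holds 0 (ms.tm y (V y))) (holds 0 (V (bsuc y)))) <|
        arr (pi (arr nat brw) fun f => pi (increasing f) fun p =>
          arr (holds 0 (V (blim f p))) (holds 0 (ml.tm f (lam nat fun n => V (f n))))) <|
        arr (pi brw fun x => pi brw fun y => arr (le x y) (D.tm x y (V x) (V y))) <|
        sig 1 (arr brw (hProp 0)) (propFamilySpec D mz ms ml)) :=
      fn fun V => fn fun h₁ => fn fun h₂ => fn fun h₃ => fn fun h₄ => fn fun h₅ =>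
        mk V (T.cast (A := propFamilySpec D mz ms ml V)
          (mk h₁ (mk (fn fun y => mk (h₂ ⬝ y) (h₃ ⬝ y)) (mk h₄ h₅))))
    finish ⬝ ⟨all (.brwInd 1 0)⟩ ⬝ ⟨lam (holds 0 mz) fun h => h⟩ ⬝
      ⟨lam brw fun y => lam (holds 0 (ms.tm y (all (.brwInd 1 0) y))) fun h => h⟩ ⬝
      ⟨lam brw fun y => lam (holds 0 (ms.tm y (all (.brwInd 1 0) y))) fun h => h⟩ ⬝
      ⟨lam (arr nat brw) fun f => lam (increasing f) fun _ =>
        lam (holds 0 (ml.tm f (lam nat fun n => all (.brwInd 1 0) (f n)))) fun h => h⟩ ⬝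
      ⟨all (.leInd 1 0)⟩

def libPropFamily : Lib := libTransportConst.add propFamilyPf (by decide +kernel)


/-- For `α : Brw` there is a family `G` that is weaker than `α < x`, with the expected values on
the constructors. -/
def ltFamilyTy : Exp :=
  pi brw fun a => sig 1 (arr brw (univ 0)) fun G =>
    prod 0 (pi brw fun x => arr (lt a x) (G x)) <|
    prod 0 (arr (G bzero) empty) <|
    prod 0 (pi brw fun y => arr (G (bsuc y)) (le a y)) <|
      pi (arr nat brw) fun f => pi (increasing f) fun p =>
        arr (G (blim f p)) (exist 0 nat fun k => lt a (f k))

def emptyProp : T (isProp 0 empty) := fn fun x => fn fun _ => x.absurd 0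

/-- The values are `⊥` at zero, `a ≤ x` at `suc x`, and `∃ k, a < f k` together with the value at `f
k` at a limit. The relation `D` says that `a < x` carries the value at `x` to the value at `y`. Its
premise `a < x` is needed for `leCocone`, where membership in the value at the limit requires `a < f
k`, obtained from `a < x ≤ f k`. -/
def ltFamilyPf : T ltFamilyTy :=
  fn fun a =>
    let D : T (arr brw (arr brw (arr (hProp 0) (arr (hProp 0) (univ 0))))) :=
      fn fun x => fn fun _ => fn fun cx => fn fun cy =>
        ⟨arr (lt a x) (arr (holds 0 cx) (holds 0 cy))⟩
    let body (f cf : Exp) (k : Exp) : Exp := prod 0 (lt a (f k)) (holds 0 (cf k))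
    let lim (f cf : Exp) : T (hProp 0) := mkProp (X := exist 0 nat (body f cf)) truncProp
    (libTransportConst.next propFamilyTy ⬝ D ⬝
      (fn fun x => fn fun _ => fn fun cx => fn fun cy =>
        (isPropArr (X := lt a x) (isPropArr (X := holds 0 cx) (holdsProp cy))).cast) ⬝
      mkProp emptyProp ⬝
      (fn fun x => fn fun _ => mkProp (X := le a x) leProp) ⬝
      (fn fun f => fn fun cf => lim f cf) ⬝
      (fn fun f => fn fun cf => fn fun g => fn fun cg => fn fun s => T.cast (A :=
          arr (exist 0 nat (body f cf)) (exist 0 nat (body g cg))) <|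
        fn fun t => t.exElim truncProp fun k b =>
          b.split 0 fun l c => (s ⬝ k).exElim truncProp fun n d =>
            exMk n (mk (l.leTrans d.fst)
              (d.snd.cast (A' := arr (lt a (f.tm k)) (arr (holds 0 (cf.tm k)) (holds 0 (cg.tm n)))) ⬝ l ⬝ c))) ⬝
      (fn fun _ => fn fun cx => T.cast (A := arr (lt a bzero) (arr empty (holds 0 cx))) <|
        fn fun _ => fn fun b => b.absurd 0) ⬝
      (fn fun x => fn fun y => fn fun _ => fn fun cx => fn fun cy => fn fun cz => fn fun e => T.cast
          (A := arr (arr (lt a x) (arr (holds 0 cx) (holds 0 cy)))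
            (arr (arr (lt a y) (arr (holds 0 cy) (holds 0 cz)))
              (arr (lt a x) (arr (holds 0 cx) (holds 0 cz))))) <|
        fn fun d => fn fun d' => fn fun l => fn fun c => d' ⬝ (l.leTrans e) ⬝ (d ⬝ l ⬝ c)) ⬝
      (fn fun x => fn fun y => fn fun cx => fn fun cy => fn fun e => T.cast (A :=
          arr (lt a (bsuc x)) (arr (le a x) (le a y))) <|
        fn fun _ => fn fun l => l.leTrans e) ⬝
      (fn fun x => fn fun cx => fn fun f => fn fun p => fn fun cf => fn fun k => fn fun e => T.cast
          (A := arr (arr (lt a x) (arr (holds 0 cx) (holds 0 (cf.tm k))))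
            (arr (lt a x) (arr (holds 0 cx) (exist 0 nat (body f cf))))) <|
        fn fun d => fn fun l => fn fun c => exMk k (mk (l.leTrans e) (d ⬝ l ⬝ c))) ⬝
      (fn fun f => fn fun p => fn fun cf => fn fun x => fn fun cx => T.cast
          (A := arr (pi nat fun k => arr (lt a (f.tm k)) (arr (holds 0 (cf.tm k)) (holds 0 cx)))
            (arr (lt a (blim f p)) (arr (exist 0 nat (body f cf)) (holds 0 cx)))) <|
        fn fun d => fn fun _ => fn fun t =>
          t.exElim (holdsProp cx) fun k b => b.split 0 fun l c => d ⬝ k ⬝ l ⬝ c)).split 1 fun V s =>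
    let G (x : Exp) : Exp := holds 0 (V.tm x)
    let s : T (prod 0 (arr (G bzero) empty) <|
        prod 0 (pi brw fun y => iff 0 (G (bsuc y)) (le a y)) <|
        prod 0 (pi (arr nat brw) fun f => pi (increasing f) fun p =>
          arr (G (blim f p)) (exist 0 nat (body f (lam nat fun n => V.tm (f n))))) <|
        pi brw fun x => pi brw fun y => arr (le x y) (arr (lt a x) (arr (G x) (G y)))) := s.cast
    s.split 1 fun hz s => s.split 1 fun hs s => s.split 1 fun hl hD =>
      mk (A := arr brw (univ 0)) ⟨lam brw G⟩ <| T.cast (A :=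
          prod 0 (pi brw fun x => arr (lt a x) (G x)) <|
          prod 0 (arr (G bzero) empty) <|
          prod 0 (pi brw fun y => arr (G (bsuc y)) (le a y)) <|
            pi (arr nat brw) fun f => pi (increasing f) fun p =>
              arr (G (blim f p)) (exist 0 nat fun k => lt a (f k))) <|
        -- The value at `suc a` is `a ≤ a`, hence true; it is carried along `suc a ≤ x`.
        mk (fn fun x => fn fun e => hD ⬝ ⟨bsuc a⟩ ⬝ x ⬝ e ⬝ leRefl ⬝ ((hs ⬝ a).snd ⬝ leRefl)) <|
        mk hz <| mk (fn fun y => (hs ⬝ y).fst) <| fn fun f => fn fun p => fn fun h =>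
          (hl ⬝ f ⬝ p ⬝ h).exElim truncProp fun k b => exMk k (T.cast (A := lt a (f.tm k)) b.fst)

def libLtFamily : Lib := libPropFamily.add ltFamilyPf (by decide +kernel)

def ltInvTy : Exp :=
  pi brw fun a =>
    prod 0 (arr (lt a bzero) empty) <|
    prod 0 (pi brw fun y => arr (lt a (bsuc y)) (le a y)) <|
      pi (arr nat brw) fun f => pi (increasing f) fun p =>
        arr (lt a (blim f p)) (exist 0 nat fun k => lt a (f k))

def ltInvPf : T ltInvTy :=
  fn fun a => (libPropFamily.next ltFamilyTy ⬝ a).split 0 fun G s =>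
    s.split 0 fun h s => s.split 0 fun hz s => s.split 0 fun hs hl =>
      mk (fn fun e => hz ⬝ (h ⬝ (⟨bzero⟩ : T brw) ⬝ e)) <|
      mk (fn fun y => fn fun e => hs ⬝ y ⬝ (h ⬝ ⟨bsuc y⟩ ⬝ e)) <|
        fn fun f => fn fun p => fn fun e => hl ⬝ f ⬝ p ⬝ (h ⬝ ⟨blim f p⟩ ⬝ e)

def libLtInv : Lib := libLtFamily.add ltInvPf (by decide +kernel)

/-! ### Inversion of the strict order, and antisymmetry for limits -/

def zeroInvTy : Exp := pi brw fun x => arr (lt x bzero) empty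

def libZeroInv : Lib := libLtInv.add (A := zeroInvTy)
  (fn fun x => (libLtFamily.next ltInvTy ⬝ x).fst) (by decide +kernel)

/-- Nothing is below `0`. -/
def T.zeroInv {x : Exp} (e : T (lt x bzero)) : T empty := libLtInv.next zeroInvTy ⬝ ⟨x⟩ ⬝ e

def sucInvTy : Exp := pi brw fun x => pi brw fun y => arr (lt x (bsuc y)) (le x y)

def libSucInv : Lib := libZeroInv.add (A := sucInvTy)
  (fn fun x => (libLtFamily.next ltInvTy ⬝ x).snd.fst) (by decide +kernel)

/-- `x < suc y` implies `x ≤ y`. -/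
def T.sucInv {x y : Exp} (e : T (lt x (bsuc y))) : T (le x y) :=
  libZeroInv.next sucInvTy ⬝ ⟨x⟩ ⬝ ⟨y⟩ ⬝ e

def limInvTy : Exp :=
  pi brw fun x => pi (arr nat brw) fun f => pi (increasing f) fun p =>
    arr (lt x (blim f p)) (exist 0 nat fun k => lt x (f k))

def libLimInv : Lib := libSucInv.add (A := limInvTy)
  (fn fun x => (libLtFamily.next ltInvTy ⬝ x).snd.snd) (by decide +kernel)

/-- `x < lim f` implies `x < f k` for some `k`. -/
def T.limInv {x f p : Exp} (e : T (lt x (blim f p))) : T (exist 0 nat fun k => lt x (f k)) :=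
  libSucInv.next limInvTy ⬝ ⟨x⟩ ⬝ ⟨f⟩ ⬝ ⟨p⟩ ⬝ e

/-- `f k ≤ lim f` -/
def leLim {f p : Exp} (k : T nat) : T (le (f k) (blim f p)) := T.leCocone k leRefl

/-- `f k < lim f` -/
def ltLim {f : Exp} (p : T (increasing f)) (k : T nat) : T (lt (f k) (blim f p)) :=
  T.leCocone k.succ (p ⬝ k)

/-- Each `f k` is strictly below `lim f`, hence below `suc y`, and inversion gives `f k ≤ y`. -/
def limCancelTy : Exp :=
  pi (arr nat brw) fun f => pi (increasing f) fun p => pi brw fun y =>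
    arr (le (blim f p) (bsuc y)) (le (blim f p) y)

def libLimCancel : Lib := libLimInv.add (A := limCancelTy)
  (fn fun _ => fn fun p => fn fun _ => fn fun e =>
    leLimiting (fn fun k => ((ltLim p k).leTrans e).sucInv)) (by decide +kernel)

/-- `lim f ≤ suc y` implies `lim f ≤ y`. -/
def T.limCancel {f p y : Exp} (e : T (le (blim f p) (bsuc y))) : T (le (blim f p) y) :=
  libLimInv.next limCancelTy ⬝ ⟨f⟩ ⬝ ⟨p⟩ ⬝ ⟨y⟩ ⬝ e

/-- From `f k < lim f ≤ lim g`, inversion at the limit gives `f k < g n` for some `n`. -/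
def simulatedTy : Exp :=
  pi (arr nat brw) fun f => pi (increasing f) fun p => pi (arr nat brw) fun g =>
    pi (increasing g) fun q => arr (le (blim f p) (blim g q)) (simulated f g)

def libSimulated : Lib := libLimCancel.add (A := simulatedTy)
  (fn fun _ => fn fun p => fn fun _ => fn fun _ => fn fun e => fn fun k =>
    ((ltLim p k).leTrans e).limInv.exElim truncProp fun n e => exMk n e.leOfLt) (by decide +kernel)

/-- Inequalities in both directions give the two simulations that the path constructor asks for.
Antisymmetry is only needed between limits. -/
def limAntisymTy : Exp :=
  pi (arr nat brw) fun f => pi (increasing f) fun p => pi (arr nat brw) fun g =>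
    pi (increasing g) fun q => arr (le (blim f p) (blim g q)) (arr (le (blim g q) (blim f p))
      (eq 0 brw (blim f p) (blim g q)))

def libLimAntisym : Lib := libSimulated.add (A := limAntisymTy)
  (fn fun f => fn fun p => fn fun g => fn fun q => fn fun e => fn fun e' =>
    let s := libLimCancel.next simulatedTy
    ⟨con .bisim f p g q (s ⬝ f ⬝ p ⬝ g ⬝ q ⬝ e).tm (s ⬝ g ⬝ q ⬝ f ⬝ p ⬝ e').tm⟩)
  (by decide +kernel)

def limAntisym {f p g q : Exp} (e : T (le (blim f p) (blim g q))) (e' : T (le (blim g q) (blim f p))) :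
    T (eq 0 brw (blim f p) (blim g q)) :=
  libSimulated.next limAntisymTy ⬝ ⟨f⟩ ⬝ ⟨p⟩ ⬝ ⟨g⟩ ⬝ ⟨q⟩ ⬝ e ⬝ e'

/-- Equal trees are comparable. -/
def T.leOfEq {x y : Exp} (p : T (eq 0 brw x y)) : T (le x y) := p.subst 0 (fun y => le x y) leRefl


/-! ### Finite successors and limits -/

def addNatMonoTy : Exp :=
  pi brw fun x => pi brw fun y => pi nat fun k => arr (le x y) (le (addNat x k) (addNat y k))

def libAddNatMono : Lib := libLimAntisym.add (A := addNatMonoTy)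
  (fn fun x => fn fun y => fn fun k => fn fun e =>
    natElim 0 (fun k => le (addNat x k) (addNat y k)) e.cast (fun _ h => h.leSuc.cast) k)
  (by decide +kernel)

def addNatMono {x y : Exp} (k : T nat) (e : T (le x y)) : T (le (addNat x k) (addNat y k)) :=
  libLimAntisym.next addNatMonoTy ⬝ ⟨x⟩ ⬝ ⟨y⟩ ⬝ k ⬝ e

def leAddNatTy : Exp := pi brw fun x => pi nat fun k => le x (addNat x k)

def libLeAddNat : Lib := libAddNatMono.add (A := leAddNatTy)
  (fn fun x => fn <| natElim 0 (fun k => le x (addNat x k)) (leRefl (x := x)).cast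
    (fun _ h => (h.leTrans leSucSelf).cast)) (by decide +kernel)

def leAddNat {x : Exp} (k : T nat) : T (le x (addNat x k)) :=
  libAddNatMono.next leAddNatTy ⬝ ⟨x⟩ ⬝ k

def addNatLeTy : Exp :=
  pi brw fun x => pi nat fun m => pi nat fun k => le (addNat x k) (addNat x (natAdd m k))

def libAddNatLe : Lib := libLeAddNat.add (A := addNatLeTy)
  (fn fun x => fn fun m => fn <| natElim 0 (fun k => le (addNat x k) (addNat x (natAdd m k)))
    (leAddNat (x := x) m).cast (fun _ h => h.leSuc.cast)) (by decide +kernel)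

/-- `x + k ≤ x + (m + k)` -/
def addNatLe {x : Exp} (m k : T nat) : T (le (addNat x k) (addNat x (natAdd m k))) :=
  libLeAddNat.next addNatLeTy ⬝ ⟨x⟩ ⬝ m ⬝ k

/-- `z` is the limit of the sequence `f`. -/
def isLimOf (f z : Exp) : Exp := sig 0 (increasing f) fun p => eq 0 brw z (blim f p)

/-- `z` is a limit. -/
def isLim (z : Exp) : Exp := sig 0 (arr nat brw) fun f => isLimOf f z

def seqLeTy : Exp :=
  pi (arr nat brw) fun f => pi brw fun z => pi (isLimOf f z) fun _ => pi nat fun k => le (f k) z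

def libSeqLe : Lib := libAddNatLe.add (A := seqLeTy)
  (fn fun f => fn fun z => fn fun h => fn fun k => T.split (A := increasing f)
    (B := fun p => eq 0 brw z (blim f p)) 0 h fun p e =>
      (leLim (f := f) (p := p) k).leTrans e.symm.leOfEq) (by decide +kernel)

/-- The members of a sequence are below its limit. -/
def T.seqLe {f z : Exp} (h : T (isLimOf f z)) (k : T nat) : T (le (f k) z) :=
  libAddNatLe.next seqLeTy ⬝ ⟨f⟩ ⬝ ⟨z⟩ ⬝ h ⬝ k

def seqLeastTy : Exp :=
  pi (arr nat brw) fun f => pi brw fun z => pi (isLimOf f z) fun _ => pi brw fun x =>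
    arr (pi nat fun k => le (f k) x) (le z x)

def libSeqLeast : Lib := libSeqLe.add (A := seqLeastTy)
  (fn fun f => fn fun z => fn fun h => fn fun _ => fn fun l => T.split (A := increasing f)
    (B := fun p => eq 0 brw z (blim f p)) 0 h fun _ e => e.leOfEq.leTrans (leLimiting l))
  (by decide +kernel)

def T.seqLeast {f z x : Exp} (h : T (isLimOf f z)) (l : T (pi nat fun k => le (f k) x)) :
    T (le z x) :=
  libSeqLe.next seqLeastTy ⬝ ⟨f⟩ ⬝ ⟨z⟩ ⬝ h ⬝ ⟨x⟩ ⬝ l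

def seqInvTy : Exp :=
  pi (arr nat brw) fun f => pi brw fun z => pi (isLimOf f z) fun _ => pi brw fun x =>
    arr (lt x z) (exist 0 nat fun k => lt x (f k))

def libSeqInv : Lib := libSeqLeast.add (A := seqInvTy)
  (fn fun f => fn fun z => fn fun h => fn fun _ => fn fun l => T.split (A := increasing f)
    (B := fun p => eq 0 brw z (blim f p)) 0 h fun _ e => (l.leTrans e.leOfEq).limInv)
  (by decide +kernel)

def T.seqInv {f z x : Exp} (h : T (isLimOf f z)) (l : T (lt x z)) :
    T (exist 0 nat fun k => lt x (f k)) :=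
  libSeqLeast.next seqInvTy ⬝ ⟨f⟩ ⬝ ⟨z⟩ ⬝ h ⬝ ⟨x⟩ ⬝ l

/-- Iterates `T.limCancel`. It undoes the finite summands that `diag` introduces to make sequences
strictly increasing. -/
def stripTy : Exp :=
  pi brw fun z => pi (isLim z) fun _ => pi brw fun y => pi nat fun k =>
    arr (le z (addNat y k)) (le z y)

def libStrip : Lib := libSeqInv.add (A := stripTy)
  (fn fun z => fn fun h => fn fun y => fn <| natElim 0 (fun k => arr (le z (addNat y k)) (le z y))
    (T.cast (A := arr (le z y) (le z y)) (fn fun e => e))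
    (fun k ih => T.cast (A := arr (le z (bsuc (addNat y k))) (le z y)) <| fn fun l =>
      T.split (A := arr nat brw) (B := fun f => isLimOf f z) 0 h fun f h => T.split
        (A := increasing f) (B := fun p => eq 0 brw z (blim f p)) 0 h fun _ e =>
          ih ⬝ e.leOfEq.leTrans (e.symm.leOfEq.leTrans l).limCancel)) (by decide +kernel)

/-- A limit that is below `y + k` is below `y`. -/
def T.strip {z y : Exp} (h : T (isLim z)) (k : T nat) (l : T (le z (addNat y k))) : T (le z y) :=
  libSeqInv.next stripTy ⬝ ⟨z⟩ ⬝ h ⬝ ⟨y⟩ ⬝ k ⬝ l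

def limEqTy : Exp :=
  pi brw fun z => pi brw fun w => arr (isLim z) (arr (isLim w) (arr (le z w) (arr (le w z)
    (eq 0 brw z w))))

def libLimEq : Lib := libStrip.add (A := limEqTy)
  (fn fun z => fn fun w => fn fun hz => fn fun hw => fn fun e => fn fun e' =>
    T.split (A := arr nat brw) (B := fun f => isLimOf f z) 0 hz fun f hz => T.split
      (A := increasing f) (B := fun p => eq 0 brw z (blim f p)) 0 hz fun _ p =>
    T.split (A := arr nat brw) (B := fun f => isLimOf f w) 0 hw fun g hw => T.split
      (A := increasing g) (B := fun p => eq 0 brw w (blim g p)) 0 hw fun _ q =>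
        (p.trans₀ (limAntisym (p.symm₀.leOfEq.leTrans (e.leTrans q.leOfEq))
          (q.symm₀.leOfEq.leTrans (e'.leTrans p.leOfEq)))).trans₀ q.symm₀)
  (by decide +kernel)

/-- Limits that are below each other are equal. -/
def limEq {z w : Exp} (hz : T (isLim z)) (hw : T (isLim w)) (e : T (le z w)) (e' : T (le w z)) :
    T (eq 0 brw z w) :=
  libStrip.next limEqTy ⬝ ⟨z⟩ ⬝ ⟨w⟩ ⬝ hz ⬝ hw ⬝ e ⬝ e'

/-- The sequence `k ↦ f k + k` -/
def diag (f : Exp) : Exp := lam nat fun k => addNat (f k) k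

/-- The summand `k` turns a weakly increasing sequence into a strictly increasing one, as the limit
constructor demands. -/
def diagIncreasingTy : Exp :=
  pi (arr nat brw) fun f => arr (pi nat fun k => le (f k) (f (succ k))) (increasing (diag f))

def libDiagIncreasing : Lib := libLimEq.add (A := diagIncreasingTy)
  (fn fun f => fn fun h => T.cast
    (A := pi nat fun k => le (bsuc (addNat (f.tm k) k)) (bsuc (addNat (f.tm (succ k)) k)))
    (fn fun k => (addNatMono k (h ⬝ k)).leSuc)) (by decide +kernel)

def diagIncreasing {f : Exp} (h : T (pi nat fun k => le (f k) (f (succ k)))) :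
    T (increasing (diag f)) :=
  libLimEq.next diagIncreasingTy ⬝ ⟨f⟩ ⬝ h

/-! ### Monotone sequences of booleans -/

def isTt (b : Exp) : Exp := eq 0 bool b tt

def libFfNeTt : Lib := libDiagIncreasing.add (A := arr (isTt ff) empty)
  (fn fun p =>
    let D (b : Exp) : Exp := con (.boolInd 1) (lam bool fun _ => univ 0) unit empty b
    (T.subst 0 D (p.cast (A' := eq 0 bool ff tt)) star.cast).cast) (by decide +kernel)

def T.ffNeTt (p : T (isTt ff)) : T empty := libDiagIncreasing.next (arr (isTt ff) empty) ⬝ p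

/-- `b ∨ b'`, by recursion on `b` -/
def bor (b b' : Exp) : Exp := con (.boolInd 0) (lam bool fun _ => bool) b' tt b

/-- `b ∧ b'`, by recursion on `b` -/
def band (b b' : Exp) : Exp := con (.boolInd 0) (lam bool fun _ => bool) ff b' b

def borInlTy : Exp := pi bool fun b => pi bool fun b' => arr (isTt b) (isTt (bor b b'))

def libBorInl : Lib := libFfNeTt.add (A := borInlTy)
  (fn fun b => fn fun b' => boolElim 0 (fun b => arr (isTt b) (isTt (bor b b')))
    (fn fun p => p.ffNeTt.absurd 0) (fn fun p => p.cast) b) (by decide +kernel)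

def borInl {b b' : Exp} (p : T (isTt b)) : T (isTt (bor b b')) :=
  libFfNeTt.next borInlTy ⬝ ⟨b⟩ ⬝ ⟨b'⟩ ⬝ p

def borInrTy : Exp := pi bool fun b => pi bool fun b' => arr (isTt b') (isTt (bor b b'))

def libBorInr : Lib := libBorInl.add (A := borInrTy)
  (fn fun b => fn fun b' => boolElim 0 (fun b => arr (isTt b') (isTt (bor b b')))
    (T.cast (A := arr (isTt b') (isTt b')) (fn fun p => p)) (fn fun _ => T.cast (A := isTt tt) rfl') b)
  (by decide +kernel)

def borInr {b b' : Exp} (p : T (isTt b')) : T (isTt (bor b b')) :=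
  libBorInl.next borInrTy ⬝ ⟨b⟩ ⬝ ⟨b'⟩ ⬝ p

def borCasesTy : Exp :=
  pi (univ 1000) fun G => pi bool fun b => pi bool fun b' =>
    arr (arr (isTt b) G) (arr (arr (isTt b') G) (arr (isTt (bor b b')) G))

def libBorCases : Lib := libBorInr.add (A := borCasesTy)
  (fn fun G => fn fun b => fn fun b' => boolElim 1000
    (fun b => arr (arr (isTt b) G) (arr (arr (isTt b') G) (arr (isTt (bor b b')) G)))
    (fn fun _ => fn fun g => T.cast (A := arr (isTt b') G) g)
    (fn fun f => fn fun _ => fn fun _ => f ⬝ rfl') b) (by decide +kernel)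

def T.borCases {b b' G : Exp} (p : T (isTt (bor b b'))) (f : T (arr (isTt b) G))
    (g : T (arr (isTt b') G)) : T G :=
  libBorInr.next borCasesTy ⬝ ⟨G⟩ ⬝ ⟨b⟩ ⬝ ⟨b'⟩ ⬝ f ⬝ g ⬝ p

def bandMkTy : Exp :=
  pi bool fun b => pi bool fun b' => arr (isTt b) (arr (isTt b') (isTt (band b b')))

def libBandMk : Lib := libBorCases.add (A := bandMkTy)
  (fn fun b => fn fun b' => boolElim 0 (fun b => arr (isTt b) (arr (isTt b') (isTt (band b b'))))
    (fn fun p => p.ffNeTt.absurd 0)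
    (fn fun _ => T.cast (A := arr (isTt b') (isTt b')) (fn fun p => p)) b) (by decide +kernel)

def bandMk {b b' : Exp} (p : T (isTt b)) (q : T (isTt b')) : T (isTt (band b b')) :=
  libBorCases.next bandMkTy ⬝ ⟨b⟩ ⬝ ⟨b'⟩ ⬝ p ⬝ q

def bandSplitTy : Exp :=
  pi bool fun b => pi bool fun b' => arr (isTt (band b b')) (prod 0 (isTt b) (isTt b'))

def libBandSplit : Lib := libBandMk.add (A := bandSplitTy)
  (fn fun b => fn fun b' => boolElim 0
    (fun b => arr (isTt (band b b')) (prod 0 (isTt b) (isTt b')))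
    (fn fun p => (T.ffNeTt p.cast).absurd 0)
    (fn fun p => mk rfl' (T.cast (A := isTt b') p.cast)) b) (by decide +kernel)

def T.bandSplit {b b' : Exp} (p : T (isTt (band b b'))) : T (prod 0 (isTt b) (isTt b')) :=
  libBandMk.next bandSplitTy ⬝ ⟨b⟩ ⬝ ⟨b'⟩ ⬝ p

/-- The sequence `c` of booleans is weakly increasing. -/
def boolMono (c : Exp) : Exp := pi nat fun k => arr (isTt (c k)) (isTt (c (succ k)))

def monoAddTy : Exp :=
  pi nat fun a => pi nat fun b => pi (arr nat bool) fun c => arr (boolMono c)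
    (arr (isTt (c a)) (isTt (c (natAdd a b))))

def libMonoAdd : Lib := libBandSplit.add (A := monoAddTy)
  (fn fun a => fn fun b => fn fun c => fn fun h => fn fun p =>
    natElim 0 (fun b => isTt (c.tm (natAdd a b))) p.cast (fun b ih => (h ⬝ ⟨natAdd a b⟩ ⬝ ih).cast) b)
  (by decide +kernel)

/-- `c a = 1` implies `c (a + b) = 1`. -/
def T.monoAdd {c : Exp} (h : T (boolMono c)) (a b : T nat) (p : T (isTt (c a))) :
    T (isTt (c (natAdd a b))) :=
  libBandSplit.next monoAddTy ⬝ a ⬝ b ⬝ ⟨c⟩ ⬝ h ⬝ p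

/-- Induction on `b` with `c` replaced by its shift, which fits the recursion of addition on the
second summand and avoids commutativity. -/
def monoAddLeftTy : Exp :=
  pi nat fun a => pi nat fun b => pi (arr nat bool) fun c => arr (boolMono c)
    (arr (isTt (c b)) (isTt (c (natAdd a b))))

def libMonoAddLeft : Lib := libMonoAdd.add (A := monoAddLeftTy)
  (fn fun a => fn <| natElim 0 (fun b => pi (arr nat bool) fun c => arr (boolMono c)
      (arr (isTt (c b)) (isTt (c (natAdd a b)))))
    (fn fun c => fn fun h => fn fun p =>
      T.cast (A := isTt (c.tm a)) (natElim 0 (fun a => isTt (c.tm a)) p (fun a ih => h ⬝ a ⬝ ih) a))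
    (fun _ ih => fn fun c => fn fun h => fn fun p =>
      (ih ⬝ ⟨lam nat fun k => c.tm (succ k)⟩ ⬝
        T.cast (A := pi nat fun k => arr (isTt (c.tm (succ k))) (isTt (c.tm (succ (succ k))))) (fn fun k => T.cast
          (A := arr (isTt (c.tm (succ k))) (isTt (c.tm (succ (succ k))))) (h ⬝ k.succ)) ⬝ p.cast).cast))
  (by decide +kernel)

/-- `c b = 1` implies `c (a + b) = 1`. -/
def T.monoAddLeft {c : Exp} (h : T (boolMono c)) (a b : T nat) (p : T (isTt (c b))) :
    T (isTt (c (natAdd a b))) :=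
  libMonoAdd.next monoAddLeftTy ⬝ a ⬝ b ⬝ ⟨c⟩ ⬝ h ⬝ p

/-- The weakly increasing sequence `c` of booleans is not constantly `0` precisely if `A` is
inhabited. -/
def decides (A c : Exp) : Exp :=
  prod 1000 (boolMono c) <| prod 1000 (arr A (exist 0 nat fun k => isTt (c k))) <|
    pi nat fun k => arr (isTt (c k)) A

/-- `A` is semidecided by a weakly increasing sequence of booleans. -/
def monoSemiDec (A : Exp) : Exp := exist 1000 (arr nat bool) fun c => decides A c

/-- The sequence `k ↦ s 0 ∨ ⋯ ∨ s (k - 1)` -/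
def running (s : Exp) : Exp :=
  lam nat fun k => con (.natInd 0) (lam nat fun _ => bool) ff
    (lam nat fun k => lam bool fun b => bor b (s k)) k

/-- The running disjunction is weakly increasing and takes the value `1` at `k + 1` if `s k = 1`.
Monotonicity is what later makes `selSeq` strictly increasing. -/
def ofSemiDecTy : Exp := pi (univ 1000) fun A => arr (isSemiDec 1000 A) (monoSemiDec A)

def libOfSemiDec : Lib := libMonoAddLeft.add (A := ofSemiDecTy)
  (fn fun A => fn fun t => T.exElim (A := arr nat bool)
    (B := fun s => iff 1000 A (exist 0 nat fun k => isTt (s k))) t truncProp fun s e =>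
    let e : T (prod 1000 (arr A (exist 0 nat fun k => isTt (s.tm k)))
      (arr (exist 0 nat fun k => isTt (s.tm k)) A)) := e
    exMk (A := arr nat bool) (B := fun c => decides A c) ⟨running s⟩ <| T.cast
      (A := decides A (running s)) <|
      mk (T.cast (A := pi nat fun k => arr (isTt (running s k))
          (isTt (bor (running s k) (s.tm k)))) (fn fun _ => fn fun p => borInl p)) <|
      mk (fn fun a => (e.fst ⬝ a).exElim truncProp fun k p =>
        exMk k.succ (T.cast (A := isTt (bor (running s k) (s.tm k))) (borInr p))) <|
      fn <| natElim 1000 (fun k => arr (isTt (running s k)) A)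
        (fn fun p => (T.ffNeTt p.cast).absurd 1000)
        (fun k ih => fn fun p => T.borCases (b := running s k) (b' := s.tm k) p.cast ih
          (fn fun q => e.snd ⬝ exMk k q)))
  (by decide +kernel)

def monoSemiDecUnit : T (monoSemiDec unit) :=
  exMk (A := arr nat bool) (B := fun c => decides unit c) ⟨lam nat fun _ => tt⟩ <| T.cast
    (A := decides unit (lam nat fun _ => tt)) <|
    mk (fn fun _ => fn fun _ => T.cast (A := isTt tt) rfl') <|
    mk (fn fun _ => exMk ⟨zero⟩ (T.cast (A := isTt tt) rfl')) <| fn fun _ => fn fun _ => star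

def monoSemiDecProdTy : Exp :=
  pi (univ 1000) fun A => pi (univ 1000) fun B =>
    arr (monoSemiDec A) (arr (monoSemiDec B) (monoSemiDec (prod 1000 A B)))

def libMonoSemiDecProd : Lib := libOfSemiDec.add (A := monoSemiDecProdTy)
  (fn fun A => fn fun B => fn fun s => fn fun t =>
    T.exElim (A := arr nat bool) (B := fun c => decides A c) s truncProp fun c h =>
    T.exElim (A := arr nat bool) (B := fun c => decides B c) t truncProp fun d h' =>
    let e : Exp := lam nat fun k => band (c.tm k) (d.tm k)
    exMk (A := arr nat bool) (B := fun c => decides (prod 1000 A B) c) ⟨e⟩ <| T.cast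
      (A := decides (prod 1000 A B) e) <|
      h.split 1000 fun hm h => h.split 1000 fun ha hk =>
      h'.split 1000 fun hm' h' => h'.split 1000 fun hb hk' =>
      mk (T.cast (A := pi nat fun k => arr (isTt (band (c.tm k) (d.tm k)))
            (isTt (band (c.tm (succ k)) (d.tm (succ k))))) <|
          fn fun k => fn fun p => p.bandSplit.split 0 fun p q =>
            bandMk (T.app (hm ⬝ k) p) (T.app (hm' ⬝ k) q)) <|
      -- If `c` is `1` at `k` and `d` is `1` at `l`, both are `1` at `k + l`.
      mk (fn fun p => p.split 1000 fun a b => (ha ⬝ a).exElim truncProp fun k p =>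
          (hb ⬝ b).exElim truncProp fun l q => exMk ⟨natAdd k l⟩ <|
            T.cast (A := isTt (band (c.tm (natAdd k l)) (d.tm (natAdd k l))))
              (bandMk (hm.monoAdd k l p) (hm'.monoAddLeft k l q))) <|
      fn fun k => fn fun p => (T.bandSplit (b := c.tm k) (b' := d.tm k) p.cast).split 1000 fun p q =>
        mk (hk ⬝ k ⬝ p) (hk' ⬝ k ⬝ q))
  (by decide +kernel)


/-! ### Limits that are given by their predecessors -/

/-- `z` is a limit, and its predecessors are described by `C`. -/
def isCut (C z : Exp) : Exp :=
  prod 1000 (isLim z) <| prod 1000 (pi brw fun y => arr (lt y z) (trunc 1000 (C y))) <|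
    pi brw fun y => arr (C y) (lt y z)

/-- It suffices to bound the members of a fundamental sequence of `z`. They are predecessors of `z`,
so `C` holds of them up to truncation, which is harmless because `≤` is a proposition. -/
def cutUpperTy : Exp :=
  pi (arr brw (univ 1000)) fun C => pi brw fun z => pi (isCut C z) fun _ => pi brw fun x =>
    arr (pi brw fun y => arr (C y) (le y x)) (le z x)

def libCutUpper : Lib := libMonoSemiDecProd.add (A := cutUpperTy)
  (fn fun C => fn fun z => fn fun h => fn fun x => fn fun g =>
    T.split (A := isLim z) (B := fun _ => prod 1000
        (pi brw fun y => arr (lt y z) (trunc 1000 (C.tm y))) (pi brw fun y => arr (C.tm y) (lt y z)))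
      0 h fun hz h => h.split 0 fun h _ =>
    T.split (A := arr nat brw) (B := fun f => isLimOf f z) 0 hz fun f hz =>
    T.split (A := increasing f) (B := fun p => eq 0 brw z (blim f p)) 0 hz fun p e =>
      e.leOfEq.leTrans <| leLimiting <| fn fun k =>
        (h ⬝ (f ⬝ k) ⬝ (ltLim p k).leTrans e.symm₀.leOfEq).untrunc leProp fun c => g ⬝ (f ⬝ k) ⬝ c)
  (by decide +kernel)

def T.cutUpper {C z x : Exp} (h : T (isCut C z)) (g : T (pi brw fun y => arr (C y) (le y x))) :
    T (le z x) :=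
  libMonoSemiDecProd.next cutUpperTy ⬝ ⟨C⟩ ⬝ ⟨z⟩ ⬝ h ⬝ ⟨x⟩ ⬝ g

def cutLeTy : Exp :=
  pi (arr brw (univ 1000)) fun C => pi (arr brw (univ 1000)) fun C' => pi brw fun z => pi brw fun w =>
    pi (isCut C z) fun _ => pi (isCut C' w) fun _ =>
      arr (pi brw fun y => arr (C y) (C' y)) (le z w)

def libCutLe : Lib := libCutUpper.add (A := cutLeTy)
  (fn fun _ => fn fun _ => fn fun _ => fn fun _ => fn fun h => fn fun h' => fn fun g =>
    h.cutUpper <| fn fun y => fn fun c =>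
      (h'.snd.snd ⬝ y ⬝ (g ⬝ y ⬝ c)).leOfLt) (by decide +kernel)

def T.cutLe {C C' z w : Exp} (h : T (isCut C z)) (h' : T (isCut C' w))
    (g : T (pi brw fun y => arr (C y) (C' y))) : T (le z w) :=
  libCutUpper.next cutLeTy ⬝ ⟨C⟩ ⬝ ⟨C'⟩ ⬝ ⟨z⟩ ⬝ ⟨w⟩ ⬝ h ⬝ h' ⬝ g

def cutEqTy : Exp :=
  pi (arr brw (univ 1000)) fun C => pi brw fun z => pi brw fun w =>
    arr (isCut C z) (arr (isCut C w) (eq 0 brw z w))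

def libCutEq : Lib := libCutLe.add (A := cutEqTy)
  (fn fun _ => fn fun _ => fn fun _ => fn fun h => fn fun h' =>
    limEq h.fst h'.fst (h.cutLe h' (fn fun _ => fn fun c => c)) (h'.cutLe h (fn fun _ => fn fun c => c)))
  (by decide +kernel)

/-- Pairs of a tree `z` and a truncated proof that `z` is given by `C` -/
def cutLim (C : Exp) : Exp := sig 1000 brw fun z => trunc 1000 (isCut C z)

/-- Two limits with the same predecessors are below each other, hence equal. As `Brw` is a set, this
equality may be derived from truncated data. -/
def cutLimPropTy : Exp := pi (arr brw (univ 1000)) fun C => isProp 1000 (cutLim C)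

def libCutLimProp : Lib := libCutEq.add (A := cutLimPropTy)
  (fn fun C =>
    let S : Exp := cutLim C
    let m (z : Exp) (t : Exp) : Exp := pair 1000 brw (fun z => trunc 1000 (isCut C z)) z t
    fn <| sigElim (A := brw) (B := fun z => trunc 1000 (isCut C z)) 1000
      (fun p => pi S fun q => eq 1000 S p q) fun z t =>
    fn <| sigElim (A := brw) (B := fun z => trunc 1000 (isCut C z)) 1000
      (fun q => eq 1000 S (m z t) q) fun w t' =>
    let e : T (eq 0 brw z w) := t.untrunc (j := 0) ⟨con .brwSet z w⟩ fun c =>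
      t'.untrunc (j := 0) ⟨con .brwSet z w⟩ fun c' =>
        libCutLe.next cutEqTy ⬝ C ⬝ z ⬝ w ⬝ c ⬝ c'
    -- Path induction along `z = w` needs the truncated proofs to be generalized; over a single `z`
    -- they are equal.
    idElim 1000 (fun z w _ => pi (trunc 1000 (isCut C z)) fun t =>
        pi (trunc 1000 (isCut C w)) fun t' => eq 1000 S (m z t) (m w t'))
      (fun z => fn fun t => fn fun t' =>
        T.ap 1000 (m z) (truncProp (i := 1000) (A := isCut C z) ⬝ t ⬝ t')) e ⬝ t ⬝ t')
  (by decide +kernel)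

def uniqueCutTy : Exp :=
  pi (arr brw (univ 1000)) fun C => arr (exist 1000 brw fun z => isCut C z) (cutLim C)

/-- Unique choice: the limit that is given by `C` -/
def libUniqueCut : Lib := libCutLimProp.add (A := uniqueCutTy)
  (fn fun C => fn fun t => T.exElim (A := brw) (B := fun z => isCut C z) (j := 1000) t
    (libCutEq.next cutLimPropTy ⬝ C) fun z c => mk z c.inTrunc) (by decide +kernel)

def uniqueCut {C : Exp} (h : T (exist 1000 brw fun z => isCut C z)) : T (cutLim C) :=
  libCutLimProp.next uniqueCutTy ⬝ ⟨C⟩ ⬝ h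

/-! ### Extending a limit if a proposition holds -/

/-- `v` if `b = 1`, and `u` otherwise -/
def sel (b u v : Exp) : Exp := con (.boolInd 0) (lam bool fun _ => brw) u v b

def leSelTy : Exp :=
  pi bool fun b => pi brw fun u => pi brw fun v => pi brw fun w =>
    arr (le w u) (arr (le w v) (le w (sel b u v)))

def libLeSel : Lib := libUniqueCut.add (A := leSelTy)
  (fn fun b => fn fun u => fn fun v => fn fun w => fn fun e => fn fun e' =>
    boolElim 0 (fun b => le w (sel b u v)) e.cast e'.cast b) (by decide +kernel)

def leSel {b u v w : Exp} (e : T (le w u)) (e' : T (le w v)) : T (le w (sel b u v)) :=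
  libUniqueCut.next leSelTy ⬝ ⟨b⟩ ⬝ ⟨u⟩ ⬝ ⟨v⟩ ⬝ ⟨w⟩ ⬝ e ⬝ e'

def leSelTtTy : Exp :=
  pi bool fun b => pi brw fun u => pi brw fun v => arr (isTt b) (le v (sel b u v))

def libLeSelTt : Lib := libLeSel.add (A := leSelTtTy)
  (fn fun b => fn fun u => fn fun v => boolElim 0 (fun b => arr (isTt b) (le v (sel b u v)))
    (fn fun p => p.ffNeTt.absurd 0) (fn fun _ => (leRefl (x := v)).cast) b) (by decide +kernel)

def leSelTt {b u v : Exp} (p : T (isTt b)) : T (le v (sel b u v)) :=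
  libLeSel.next leSelTtTy ⬝ ⟨b⟩ ⬝ ⟨u⟩ ⬝ ⟨v⟩ ⬝ p

def selLtTy : Exp :=
  pi bool fun b => pi bool fun b' => pi brw fun u => pi brw fun v => pi brw fun u' => pi brw fun v' =>
    arr (arr (isTt b) (isTt b')) (arr (lt u u') (arr (lt u v') (arr (lt v v')
      (lt (sel b u v) (sel b' u' v')))))

def libSelLt : Lib := libLeSelTt.add (A := selLtTy)
  (fn fun b => fn fun b' => fn fun u => fn fun v => fn fun u' => fn fun v' => fn fun g =>
    fn fun h₁ => fn fun h₂ => fn fun h₃ =>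
      boolElim 0 (fun b => arr (arr (isTt b) (isTt b')) (lt (sel b u v) (sel b' u' v')))
        (fn fun _ => T.cast (A := lt u (sel b' u' v')) (leSel h₁ h₂))
        (fn fun g => T.cast (A := lt v (sel b' u' v'))
          (h₃.leTrans (leSelTt (T.app (A := isTt tt) g rfl')))) b ⬝ g) (by decide +kernel)

def selLt {b b' u v u' v' : Exp} (g : T (arr (isTt b) (isTt b'))) (h₁ : T (lt u u'))
    (h₂ : T (lt u v')) (h₃ : T (lt v v')) : T (lt (sel b u v) (sel b' u' v')) :=
  libLeSelTt.next selLtTy ⬝ ⟨b⟩ ⬝ ⟨b'⟩ ⬝ ⟨u⟩ ⬝ ⟨v⟩ ⬝ ⟨u'⟩ ⬝ ⟨v'⟩ ⬝ g ⬝ h₁ ⬝ h₂ ⬝ h₃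

def ltSelTy : Exp :=
  pi (univ 1000) fun G => pi bool fun b => pi brw fun u => pi brw fun v => pi brw fun y =>
    arr (arr (lt y u) G) (arr (arr (isTt b) (arr (lt y v) G)) (arr (lt y (sel b u v)) G))

def libLtSel : Lib := libSelLt.add (A := ltSelTy)
  (fn fun G => fn fun b => fn fun u => fn fun v => fn fun y => fn fun g => fn fun g' =>
    boolElim 1000 (fun b => arr (arr (isTt b) (arr (lt y v) G)) (arr (lt y (sel b u v)) G))
      (fn fun _ => T.cast (A := arr (lt y u) G) g)
      (fn fun g' => T.cast (A := arr (lt y v) G) (T.app (A := isTt tt) g' rfl')) b ⬝ g')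
  (by decide +kernel)

def T.ltSel {b u v y G : Exp} (e : T (lt y (sel b u v))) (g : T (arr (lt y u) G))
    (g' : T (arr (isTt b) (arr (lt y v) G))) : T G :=
  libSelLt.next ltSelTy ⬝ ⟨G⟩ ⬝ ⟨b⟩ ⬝ ⟨u⟩ ⬝ ⟨v⟩ ⬝ ⟨y⟩ ⬝ g ⬝ g' ⬝ e

/-- The sequence that follows `f` as long as `c` is `0`, and then `x + k` -/
def selSeq (c f x : Exp) : Exp := lam nat fun k => sel (c k) (f k) (addNat x k)

/-- At the switch one uses `f k ≤ x ≤ x + k < x + (k + 1)`. Switching back is impossible by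
monotonicity of `c`. -/
def selSeqIncreasingTy : Exp :=
  pi (arr nat bool) fun c => pi (arr nat brw) fun f => pi brw fun x =>
    arr (boolMono c) (arr (increasing f) (arr (pi nat fun k => le (f k) x) (increasing (selSeq c f x))))

def libSelSeqIncreasing : Lib := libLtSel.add (A := selSeqIncreasingTy)
  (fn fun c => fn fun f => fn fun x => fn fun hc => fn fun hf => fn fun h => T.cast
    (A := pi nat fun k => lt (sel (c.tm k) (f.tm k) (addNat x k))
      (sel (c.tm (succ k)) (f.tm (succ k)) (bsuc (addNat x k)))) <|
    fn fun k => selLt (hc ⬝ k) (hf ⬝ k) ((h ⬝ k).leTrans (leAddNat k)).leSuc leRefl)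
  (by decide +kernel)

/-- The predecessors of `C`, and those of `b` if `A` holds -/
def stepCut (C b A : Exp) : Exp := lam brw fun y => sum 1000 (C y) (prod 1000 A (lt y b))

/-- The limit of `selSeq c f x` is `z` if `A` fails and `b = x + ω` if `A` holds, and its
description by predecessors needs no decision between the two. The sequences `c` and `f` enter only
through the existence of this limit. -/
def stepTy : Exp :=
  pi (arr brw (univ 1000)) fun C => pi (univ 1000) fun A => pi brw fun z => pi brw fun x => pi brw fun b =>
    arr (isCut C z) (arr (le z x) (arr (isLimOf (lam nat fun k => addNat x k) b)
      (arr (monoSemiDec A) (exist 1000 brw fun w => isCut (stepCut C b A) w))))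

def stepPf : T stepTy :=
  fn fun C => fn fun A => fn fun z => fn fun x => fn fun b => fn fun h => fn fun hx => fn fun hb => fn fun s =>
    T.exElim (A := arr nat bool) (B := fun c => decides A c) s truncProp fun c hc =>
    T.split (A := isLim z) (B := fun _ => prod 1000
        (pi brw fun y => arr (lt y z) (trunc 1000 (C.tm y))) (pi brw fun y => arr (C.tm y) (lt y z)))
      1000 h fun hz h => h.split 1000 fun h₁ h₂ =>
    T.split (A := arr nat brw) (B := fun f => isLimOf f z) 1000 hz fun f hf =>
    hc.split 1000 fun hm hc => hc.split 1000 fun ha hk =>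
    let u := selSeq c f x
    let G (y : Exp) : Exp := sum 1000 (C.tm y) (prod 1000 A (lt y b))
    let hb : T (isLimOf (lam nat fun k => addNat x k) b) := hb
    let finish : T (pi (increasing u) fun p => exist 1000 brw fun w => isCut (stepCut C b A) w) :=
      fn fun p =>
        let w : T brw := ⟨blim u p⟩
        let zw : T (le z w) := hf.seqLeast <| fn fun k => T.leCocone (f := u) k <|
          T.cast (A := le (f.tm k) (sel (c.tm k) (f.tm k) (addNat x k)))
            (leSel leRefl ((hf.seqLe k).leTrans (hx.leTrans (leAddNat k))))
        exMk (A := brw) w <| T.cast (A := isCut (lam brw G) w) <|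
          mk (T.cast (A := isLim w) (mk (A := arr nat brw) ⟨u⟩ (T.cast (A := isLimOf u w) (mk p rfl')))) <|
          mk (T.cast (A := pi brw fun y => arr (lt y w) (trunc 1000 (G y))) <| fn fun y => fn fun e =>
            (T.limInv (f := u) (p := p) e).exElim truncProp fun k e =>
              T.ltSel (b := c.tm k) (u := f.tm k) (v := addNat x k) e.cast
                (fn fun e => (h₁ ⬝ y ⬝ e.leTrans (hf.seqLe k)).untrunc truncProp fun c =>
                  (inl (i := 1000) (B := prod 1000 A (lt y b)) c).inTrunc)
                (fn fun q => fn fun e => (inr (i := 1000) (A := C.tm y) (mk (B := fun _ => lt y b) (hk ⬝ k ⬝ q)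
                  (e.leTrans ((hb.seqLe k).cast (A' := le (addNat x k) b))))).inTrunc)) <|
          T.cast (A := pi brw fun y => arr (G y) (lt y w)) <| fn fun y => fn fun g =>
            T.cases (A := C.tm y) (B := prod 1000 A (lt y b)) 0 g (fun c => (h₂ ⬝ y ⬝ c).leTrans zw)
              fun g => g.split 0 fun a e => (ha ⬝ a).exElim leProp fun k q =>
                (hb.seqInv e).exElim leProp fun j e =>
                  -- With `c k = 1` and `y < x + j`, the member at `k + j` already follows the
                  -- second branch and is at least `x + j`.
                  T.leCocone (f := u) ⟨natAdd k j⟩ <|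
                    T.cast (A := le (bsuc y) (sel (c.tm (natAdd k j)) (f.tm (natAdd k j)) (addNat x (natAdd k j)))) <|
                      ((e.cast (A' := lt y (addNat x j))).leTrans (addNatLe k j)).leTrans
                        (leSelTt (hm.monoAdd k j q))
    finish ⬝ (libLtSel.next selSeqIncreasingTy ⬝ c ⬝ f ⬝ x ⬝ hm ⬝ hf.fst ⬝
      (fn fun k => (hf.seqLe k).leTrans hx))

def libStep : Lib := libSelSeqIncreasing.add stepPf (by decide +kernel)


/-! ### The limits that measure how many members of a sequence of propositions hold -/

/-- `P 0 × ⋯ × P (k - 1)` -/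
def conj (P k : Exp) : Exp :=
  con (.natInd 1001) (lam nat fun _ => univ 1000) unit
    (lam nat fun k => lam (univ 1000) fun R => prod 1000 R (P k)) k

/-- The type `A`, as a member of the universe of level 1000 -/
def lift (A : Exp) : Exp := lam (univ 1000) (fun X => X) A

/-- The predecessors of the largest `ω · (j + 1)`, where `j ≤ k` and the first `j` members of `P`
hold -/
def rankCut (O P k : Exp) : Exp :=
  con (.natInd 1001) (lam nat fun _ => arr brw (univ 1000)) (lam brw fun y => lift (lt y (O (succ zero))))
    (lam nat fun k => lam (arr brw (univ 1000)) fun C =>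
      stepCut C (O (succ (succ k))) (conj P (succ k))) k

/-- `O (k + 1) = O k + ω` -/
def omegaSteps (O : Exp) : Exp :=
  pi nat fun k => isLimOf (lam nat fun j => addNat (O k) j) (O (succ k))

def conjMonoSemiDecTy : Exp :=
  pi (arr nat (univ 1000)) fun P => arr (pi nat fun n => monoSemiDec (P n))
    (pi nat fun k => monoSemiDec (conj P k))

def libConjMonoSemiDec : Lib := libStep.add (A := conjMonoSemiDecTy)
  (fn fun P => fn fun h => fn <| natElim 1000 (fun k => monoSemiDec (conj P k))
    monoSemiDecUnit.cast
    (fun k ih => (libOfSemiDec.next monoSemiDecProdTy ⬝ ⟨conj P k⟩ ⬝ ⟨P.tm k⟩ ⬝ ih ⬝ (h ⬝ k)).cast))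
  (by decide +kernel)

def omegaLeTy : Exp :=
  pi (arr nat brw) fun O => arr (omegaSteps O) (pi nat fun k => le (O k) (O (succ k)))

def libOmegaLe : Lib := libConjMonoSemiDec.add (A := omegaLeTy)
  (fn fun _ => fn fun h => fn fun k => (T.seqLe (h ⬝ k) ⟨zero⟩).cast) (by decide +kernel)

def omegaLe {O : Exp} (h : T (omegaSteps O)) (k : T nat) : T (le (O k) (O (succ k))) :=
  libConjMonoSemiDec.next omegaLeTy ⬝ ⟨O⟩ ⬝ h ⬝ k

/-- Gives `Z k ≤ ω · (k + 1)`, the hypothesis `z ≤ x` of the extension step. -/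
def rankBoundTy : Exp :=
  pi (arr nat brw) fun O => pi (arr nat (univ 1000)) fun P => arr (omegaSteps O)
    (pi nat fun k => pi brw fun y => arr (rankCut O P k y) (lt y (O (succ k))))

def libRankBound : Lib := libOmegaLe.add (A := rankBoundTy)
  (fn fun O => fn fun P => fn fun h => fn <| natElim 1000
    (fun k => pi brw fun y => arr (rankCut O P k y) (lt y (O.tm (succ k))))
    (T.cast (A := pi brw fun y => arr (lt y (O.tm (succ zero))) (lt y (O.tm (succ zero))))
      (fn fun _ => fn fun e => e))
    (fun k ih => fn fun y => fn fun c => T.cases (i := 1000) (A := rankCut O P k y)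
      (B := prod 1000 (conj P (succ k)) (lt y (O.tm (succ (succ k))))) 0 c.cast
      (fun c => (ih ⬝ y ⬝ c).leTrans (omegaLe h k.succ)) fun p => p.snd)) (by decide +kernel)

def rankBound {O P k y : Exp} (h : T (omegaSteps O)) (c : T (rankCut O P k y)) : T (lt y (O (succ k))) :=
  libOmegaLe.next rankBoundTy ⬝ ⟨O⟩ ⬝ ⟨P⟩ ⬝ h ⬝ ⟨k⟩ ⬝ ⟨y⟩ ⬝ c

/-- Induction on `k`: start with `ω`, then extend with `x = ω · (k + 1)` and `b = ω · (k + 2)`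
subject to the first `k + 1` propositions. -/
def existsRankTy : Exp :=
  pi (arr nat brw) fun O => pi (arr nat (univ 1000)) fun P => arr (omegaSteps O)
    (arr (pi nat fun n => monoSemiDec (P n))
      (pi nat fun k => exist 1000 brw fun z => isCut (rankCut O P k) z))

def libExistsRank : Lib := libRankBound.add (A := existsRankTy)
  (fn fun O => fn fun P => fn fun hO => fn fun hP => fn <| natElim 1000
    (fun k => exist 1000 brw fun z => isCut (rankCut O P k) z)
    (exMk (A := brw) ⟨O.tm (succ zero)⟩ <| T.cast
      (A := isCut (lam brw fun y => lt y (O.tm (succ zero))) (O.tm (succ zero))) <|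
      mk (mk (A := arr nat brw) ⟨lam nat fun j => addNat (O.tm zero) j⟩ (hO ⬝ ⟨zero⟩)) <|
      mk (T.cast (A := pi brw fun y => arr (lt y (O.tm (succ zero)))
          (trunc 1000 (lt y (O.tm (succ zero))))) <| fn fun y => fn fun e => e.inTrunc) <|
      T.cast (A := pi brw fun y => arr (lt y (O.tm (succ zero))) (lt y (O.tm (succ zero)))) <|
        fn fun y => fn fun e => e)
    (fun k ih => T.exElim (A := brw) (B := fun z => isCut (rankCut O P k) z) ih truncProp fun z c =>
      T.cast (A := exist 1000 brw fun z =>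
          isCut (stepCut (rankCut O P k) (O.tm (succ (succ k))) (conj P (succ k))) z) <|
        libSelSeqIncreasing.next stepTy ⬝ ⟨rankCut O P k⟩ ⬝ ⟨conj P (succ k)⟩ ⬝ z ⬝ ⟨O.tm (succ k)⟩ ⬝
          ⟨O.tm (succ (succ k))⟩ ⬝ c ⬝
          (c.cutUpper <| fn fun y => fn fun c => (rankBound hO c).leOfLt) ⬝ (hO ⬝ k.succ) ⬝
          (libStep.next conjMonoSemiDecTy ⬝ P ⬝ hP ⬝ k.succ)))
  (by decide +kernel)

/-- `Z k` is the limit that is given by `rankCut O P k`. -/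
def isRank (O P Z : Exp) : Exp := pi nat fun k => trunc 1000 (isCut (rankCut O P k) (Z k))

/-- The sequence of ranks -/
def rankTy : Exp :=
  pi (arr nat brw) fun O => pi (arr nat (univ 1000)) fun P => arr (omegaSteps O)
    (arr (pi nat fun n => monoSemiDec (P n)) (sig 1000 (arr nat brw) fun Z => isRank O P Z))

/-- For each `k` the limit exists merely, but it is unique, so unique choice gives a function of
`k`. -/
def rankPf : T rankTy :=
  fn fun O => fn fun P => fn fun hO => fn fun hP =>
    let t : T (pi nat fun k => cutLim (rankCut O P k)) := fn fun k =>
      uniqueCut (libRankBound.next existsRankTy ⬝ O ⬝ P ⬝ hO ⬝ hP ⬝ k)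
    let finish : T (arr (pi nat fun k => cutLim (rankCut O P k))
        (sig 1000 (arr nat brw) fun Z => isRank O P Z)) := fn fun t =>
      let p (k : T nat) : T (sig 1000 brw fun z => trunc 1000 (isCut (rankCut O P k) z)) := t ⬝ k
      mk (A := arr nat brw) (fn fun k => (p k).fst) <| T.cast
        (A := pi nat fun k => trunc 1000 (isCut (rankCut O P k) (p ⟨k⟩).fst)) <|
        fn fun k => (p k).snd
    finish ⬝ t

def libRank : Lib := libExistsRank.add rankPf (by decide +kernel)

def rankMonoTy : Exp :=
  pi (arr nat brw) fun O => pi (arr nat (univ 1000)) fun P => pi (arr nat brw) fun Z =>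
    arr (isRank O P Z) (pi nat fun k => le (Z k) (Z (succ k)))

def libRankMono : Lib := libRank.add (A := rankMonoTy)
  (fn fun O => fn fun P => fn fun _ => fn fun h => fn fun k =>
    (h ⬝ k).untrunc leProp fun c => (h ⬝ k.succ).untrunc leProp fun c' =>
      c.cutLe c' <| fn fun y => T.cast (A := arr (rankCut O P k y) (sum 1000 (rankCut O P k y)
        (prod 1000 (conj P (succ k)) (lt y (O.tm (succ (succ k))))))) <| fn fun c => inl c)
  (by decide +kernel)

def rankMono {O P Z : Exp} (h : T (isRank O P Z)) : T (pi nat fun k => le (Z k) (Z (succ k))) :=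
  libRank.next rankMonoTy ⬝ ⟨O⟩ ⬝ ⟨P⟩ ⬝ ⟨Z⟩ ⬝ h

/-! ### Dependence of the ranks on the propositions -/

def conjMapTy : Exp :=
  pi (arr nat (univ 1000)) fun P => pi (arr nat (univ 1000)) fun P' =>
    arr (pi nat fun n => arr (P n) (P' n)) (pi nat fun k => arr (conj P k) (conj P' k))

def libConjMap : Lib := libRankMono.add (A := conjMapTy)
  (fn fun P => fn fun P' => fn fun h => fn <| natElim 1000 (fun k => arr (conj P k) (conj P' k))
    (T.cast (A := arr unit unit) (fn fun u => u))
    (fun k ih => T.cast (A := arr (prod 1000 (conj P k) (P.tm k)) (prod 1000 (conj P' k) (P'.tm k))) <|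
      fn fun p => mk (ih ⬝ p.fst) (h ⬝ k ⬝ p.snd))) (by decide +kernel)

def rankCutMapTy : Exp :=
  pi (arr nat brw) fun O => pi (arr nat (univ 1000)) fun P => pi (arr nat (univ 1000)) fun P' =>
    arr (pi nat fun n => arr (P n) (P' n))
      (pi nat fun k => pi brw fun y => arr (rankCut O P k y) (rankCut O P' k y))

def libRankCutMap : Lib := libConjMap.add (A := rankCutMapTy)
  (fn fun O => fn fun P => fn fun P' => fn fun h => fn <| natElim 1000
    (fun k => pi brw fun y => arr (rankCut O P k y) (rankCut O P' k y))
    (T.cast (A := pi brw fun y => arr (lt y (O.tm (succ zero))) (lt y (O.tm (succ zero))))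
      (fn fun y => fn fun e => e))
    (fun k ih =>
      let G (P : Exp) (y : Exp) : Exp := sum 1000 (rankCut O P k y)
        (prod 1000 (conj P (succ k)) (lt y (O.tm (succ (succ k)))))
      T.cast (A := pi brw fun y => arr (G P y) (G P' y)) <| fn fun y => fn fun c =>
        T.cases (i := 1000) (A := rankCut O P k y)
          (B := prod 1000 (conj P (succ k)) (lt y (O.tm (succ (succ k))))) 1000 c
          (fun c => inl (ih ⬝ y ⬝ c))
          (fun p => inr <| mk (B := fun _ => lt y (O.tm (succ (succ k))))
            (libRankMono.next conjMapTy ⬝ P ⬝ P' ⬝ h ⬝ k.succ ⬝ p.fst) p.snd)))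
  (by decide +kernel)

def rankMapTy : Exp :=
  pi (arr nat brw) fun O => pi (arr nat (univ 1000)) fun P => pi (arr nat (univ 1000)) fun P' =>
    pi (arr nat brw) fun Z => pi (arr nat brw) fun Z' =>
      arr (pi nat fun n => arr (P n) (P' n)) (arr (isRank O P Z) (arr (isRank O P' Z')
        (pi nat fun k => le (Z k) (Z' k))))

def libRankMap : Lib := libRankCutMap.add (A := rankMapTy)
  (fn fun O => fn fun P => fn fun P' => fn fun _ => fn fun _ => fn fun g => fn fun h => fn fun h' =>
    fn fun k => (h ⬝ k).untrunc leProp fun c => (h' ⬝ k).untrunc leProp fun c' =>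
      c.cutLe c' (libConjMap.next rankCutMapTy ⬝ O ⬝ P ⬝ P' ⬝ g ⬝ k)) (by decide +kernel)

/-- If `P` implies `P'`, then the ranks for `P` are below those for `P'`. -/
def rankMap {O P P' Z Z' : Exp} (g : T (pi nat fun n => arr (P n) (P' n))) (h : T (isRank O P Z))
    (h' : T (isRank O P' Z')) (k : T nat) : T (le (Z k) (Z' k)) :=
  libRankCutMap.next rankMapTy ⬝ ⟨O⟩ ⬝ ⟨P⟩ ⬝ ⟨P'⟩ ⬝ ⟨Z⟩ ⬝ ⟨Z'⟩ ⬝ g ⬝ h ⬝ h' ⬝ k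

def conjAllTy : Exp :=
  pi (arr nat (univ 1000)) fun P => arr (pi nat fun n => P n) (pi nat fun k => conj P k)

def libConjAll : Lib := libRankMap.add (A := conjAllTy)
  (fn fun P => fn fun h => fn <| natElim 1000 (fun k => conj P k) star.cast
    (fun k ih => T.cast (A := prod 1000 (conj P k) (P.tm k)) (mk ih (h ⬝ k)))) (by decide +kernel)

/-- If all members of `P` hold, then `ω · k ≤ Z k`. -/
def rankFullTy : Exp :=
  pi (arr nat brw) fun O => pi (arr nat (univ 1000)) fun P => pi (arr nat brw) fun Z =>
    arr (omegaSteps O) (arr (isRank O P Z) (arr (pi nat fun n => P n) (pi nat fun k => le (O k) (Z k))))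

/-- The argument in fact passes through `ω · (k + 1) ≤ Z k`: every `ω · k + j` is a predecessor of
`Z k`. The eliminator serves only to distinguish `0` from successors. -/
def libRankFull : Lib := libConjAll.add (A := rankFullTy)
  (fn fun O => fn fun P => fn fun Z => fn fun hO => fn fun h => fn fun a => fn <| natElim 0
    (fun k => le (O.tm k) (Z.tm k))
    ((h ⬝ ⟨zero⟩).untrunc leProp fun c => T.leTrans (omegaLe hO ⟨zero⟩) <|
      T.seqLeast (hO ⬝ ⟨zero⟩) <| fn fun j => T.cast (A := le (addNat (O.tm zero) j) (Z.tm zero)) <|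
        T.leOfLt <| c.snd.snd ⬝ ⟨addNat (O.tm zero) j⟩ ⬝ T.cast
          (A := lt (addNat (O.tm zero) j) (O.tm (succ zero)))
          ((T.seqLe (hO ⬝ ⟨zero⟩) j.succ).cast))
    (fun k _ => (h ⬝ k.succ).untrunc leProp fun c => T.leTrans (omegaLe hO k.succ) <|
      T.seqLeast (hO ⬝ k.succ) <| fn fun j => T.cast (A := le (addNat (O.tm (succ k)) j) (Z.tm (succ k))) <|
        T.leOfLt <| c.snd.snd ⬝ ⟨addNat (O.tm (succ k)) j⟩ ⬝ T.cast
          (A := sum 1000 (rankCut O P k (addNat (O.tm (succ k)) j))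
            (prod 1000 (conj P (succ k)) (lt (addNat (O.tm (succ k)) j) (O.tm (succ (succ k))))))
          (inr <| mk (libRankMap.next conjAllTy ⬝ P ⬝ a ⬝ k.succ)
            ((T.seqLe (hO ⬝ k.succ) j.succ).cast))))
  (by decide +kernel)

/-! ### Recovering the propositions from the ranks -/

def antitoneZeroTy : Exp :=
  pi (arr nat (univ 1000)) fun S => arr (pi nat fun k => arr (S (succ k)) (S k))
    (pi nat fun k => arr (S k) (S zero))

def libAntitoneZero : Lib := libRankFull.add (A := antitoneZeroTy)
  (fn fun S => fn fun h => fn <| natElim 1000 (fun k => arr (S.tm k) (S.tm zero)) (fn fun s => s)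
    (fun k ih => fn fun s => ih ⬝ (h ⬝ k ⬝ s))) (by decide +kernel)

/-- `ω · n < ω · k` and `S k` imply `S n`, for antitone `S`. -/
def antitoneTy : Exp :=
  pi (arr nat brw) fun O => arr (omegaSteps O) <| arr (pi brw fun y => arr (lt y (O zero)) empty) <|
    pi nat fun k => pi (arr nat (univ 1000)) fun S => pi nat fun n =>
      arr (pi nat fun k => arr (S (succ k)) (S k)) (arr (lt (O n) (O k)) (arr (S k) (trunc 1000 (S n))))

/-- Induction on `k` with `S` generalized to its shifts, so `n < k` never has to be extracted. From
`ω · (n + 1) < ω · (k + 1)` one gets `ω · (n + 1) < ω · k + j` for some `j`, then `ω · (n + 1) ≤ ω ·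
k` by stripping, and so `ω · n < ω · k`. -/
def antitonePf : T antitoneTy :=
  fn fun O => fn fun hO => fn fun hz => fn <| natElim 1001
    (fun k => pi (arr nat (univ 1000)) fun S => pi nat fun n =>
      arr (pi nat fun k => arr (S (succ k)) (S k)) (arr (lt (O.tm n) (O.tm k))
        (arr (S k) (trunc 1000 (S n)))))
    (fn fun _ => fn fun _ => fn fun _ => fn fun e => fn fun _ => (hz ⬝ _ ⬝ e).absurd 1000)
    (fun k ih => fn fun S => fn fun n => fn fun hS => natElim 1000
      (fun n => arr (lt (O.tm n) (O.tm (succ k))) (arr (S.tm (succ k)) (trunc 1000 (S.tm n))))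
      (fn fun _ => fn fun s => (libRankFull.next antitoneZeroTy ⬝ S ⬝ hS ⬝ k.succ ⬝ s).inTrunc)
      (fun n _ => fn fun e => fn fun s => (T.seqInv (hO ⬝ k) e).exElim truncProp fun j e =>
        let l : T (le (O.tm (succ n)) (O.tm k)) := T.strip
          (mk (A := arr nat brw) ⟨lam nat fun j => addNat (O.tm n) j⟩ (hO ⬝ n)) j
          (T.leOfLt (y := addNat (O.tm k) j) e.cast)
        (ih ⬝ ⟨lam nat fun n => S.tm (succ n)⟩ ⬝ n ⬝ T.cast
            (A := pi nat fun k => arr (S.tm (succ (succ k))) (S.tm (succ k))) (fn fun k => hS ⬝ k.succ) ⬝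
          T.leTrans (T.cast (A := lt (O.tm n) (O.tm (succ n))) (T.seqLe (hO ⬝ n) ⟨succ zero⟩).cast) l ⬝
          s.cast).cast) n)

def libAntitone : Lib := libAntitoneZero.add antitonePf (by decide +kernel)


/-- The sequence `1, conj P 0, conj P 1, …` -/
def conjShift (P k : Exp) : Exp :=
  con (.natInd 1001) (lam nat fun _ => univ 1000) unit
    (lam nat fun k => lam (univ 1000) fun _ => conj P k) k

def conjShiftAntitoneTy : Exp :=
  pi (arr nat (univ 1000)) fun P => pi nat fun k => arr (conjShift P (succ k)) (conjShift P k)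

def libConjShiftAntitone : Lib := libAntitone.add (A := conjShiftAntitoneTy)
  (fn fun P => fn <| natElim 1000 (fun k => arr (conjShift P (succ k)) (conjShift P k))
    (T.cast (A := arr unit unit) (fn fun u => u))
    (fun k _ => T.cast (A := arr (prod 1000 (conj P k) (P.tm k)) (conj P k)) (fn fun p => p.fst)))
  (by decide +kernel)

/-- The predecessors of `ω · (j + 1)` are admitted if the first `j` propositions hold. The shift
aligns these indices: the condition attached to `ω · k` is `conjShift P k`, and antitonicity passes
it down to each `ω · n < ω · k`. -/
def rankCutConjTy : Exp :=
  pi (arr nat brw) fun O => arr (omegaSteps O) <| arr (pi brw fun y => arr (lt y (O zero)) empty) <|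
    pi (arr nat (univ 1000)) fun P => pi nat fun n => pi nat fun k =>
      arr (rankCut O P k (O n)) (trunc 1000 (conjShift P n))

def libRankCutConj : Lib := libConjShiftAntitone.add (A := rankCutConjTy)
  (fn fun O => fn fun hO => fn fun hz => fn fun P => fn fun n =>
    let S : T (arr nat (univ 1000)) := ⟨lam nat fun k => conjShift P k⟩
    let main (k : T nat) (e : T (lt (O.tm n) (O.tm k))) (s : T (conjShift P k)) :
        T (trunc 1000 (conjShift P n)) :=
      (libAntitoneZero.next antitoneTy ⬝ O ⬝ hO ⬝ hz ⬝ k ⬝ S ⬝ n ⬝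
        (libAntitone.next conjShiftAntitoneTy ⬝ P).cast ⬝ e ⬝ s.cast).cast
    fn <| natElim 1000 (fun k => arr (rankCut O P k (O.tm n)) (trunc 1000 (conjShift P n)))
      (T.cast (A := arr (lt (O.tm n) (O.tm (succ zero))) (trunc 1000 (conjShift P n)))
        (fn fun e => main ⟨succ zero⟩ e star.cast))
      (fun k ih => fn fun c => T.cases (i := 1000) (A := rankCut O P k (O.tm n))
        (B := prod 1000 (conj P (succ k)) (lt (O.tm n) (O.tm (succ (succ k))))) 1000 c.cast
        (fun c => ih ⬝ c) (fun p => main k.succ.succ p.snd p.fst.cast)))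
  (by decide +kernel)

/-! ### The limit of the ranks, compared with `ω²` -/

def omegaLtTy : Exp :=
  pi (arr nat brw) fun O => arr (omegaSteps O) (pi nat fun k => lt (O k) (O (succ k)))

def libOmegaLt : Lib := libRankCutConj.add (A := omegaLtTy)
  (fn fun _ => fn fun h => fn fun k => (T.seqLe (h ⬝ k) ⟨succ zero⟩).cast) (by decide +kernel)

def omegaLt {O : Exp} (h : T (omegaSteps O)) (k : T nat) : T (lt (O k) (O (succ k))) :=
  libRankCutConj.next omegaLtTy ⬝ ⟨O⟩ ⬝ h ⬝ k

/-- `W` is the limit of `Z k + k`, for the sequence `Z` of ranks. -/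
def isRankLim (O P W : Exp) : Exp :=
  sig 1000 (arr nat brw) fun Z => prod 1000 (isRank O P Z) (isLimOf (diag Z) W)

def rankLimTy : Exp :=
  pi (arr nat brw) fun O => pi (arr nat (univ 1000)) fun P => arr (omegaSteps O)
    (arr (pi nat fun n => monoSemiDec (P n)) (sig 1000 brw fun W => isRankLim O P W))

def libRankLim : Lib := libOmegaLt.add (A := rankLimTy)
  (fn fun O => fn fun P => fn fun hO => fn fun hP =>
    T.split (A := arr nat brw) (B := fun Z => isRank O P Z) 1000
      (libExistsRank.next rankTy ⬝ O ⬝ P ⬝ hO ⬝ hP) fun Z h =>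
    let finish : T (pi (increasing (diag Z)) fun q => sig 1000 brw fun W => isRankLim O P W) :=
      fn fun q => mk (A := brw) ⟨blim (diag Z) q⟩ <| T.cast (A := isRankLim O P (blim (diag Z) q)) <|
        mk (A := arr nat brw) Z <| T.cast (A := prod 1000 (isRank O P Z)
          (isLimOf (diag Z) (blim (diag Z) q))) <| mk h (mk q rfl')
    finish ⬝ diagIncreasing (rankMono h)) (by decide +kernel)

def rankLimMapTy : Exp :=
  pi (arr nat brw) fun O => pi (arr nat (univ 1000)) fun P => pi (arr nat (univ 1000)) fun P' =>
    arr (pi nat fun n => arr (P n) (P' n)) <| pi brw fun W => pi brw fun W' =>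
      arr (isRankLim O P W) (arr (isRankLim O P' W') (le W W'))

def libRankLimMap : Lib := libRankLim.add (A := rankLimMapTy)
  (fn fun O => fn fun P => fn fun P' => fn fun g => fn fun W => fn fun W' => fn fun h => fn fun h' =>
    T.split (A := arr nat brw) (B := fun Z => prod 1000 (isRank O P Z) (isLimOf (diag Z) W)) 0 h
      fun Z h =>
    T.split (A := arr nat brw) (B := fun Z => prod 1000 (isRank O P' Z) (isLimOf (diag Z) W')) 0 h'
      fun Z' h' =>
    h.split 0 fun h l => h'.split 0 fun h' l' => l.seqLeast <| fn fun k =>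
      T.cast (A := le (addNat (Z.tm k) k) W')
        ((addNatMono k (rankMap g h h' k)).leTrans (l'.seqLe k).cast)) (by decide +kernel)

def rankLimFullTy : Exp :=
  pi (arr nat brw) fun O => pi brw fun w => arr (omegaSteps O) <| arr (isLimOf O w) <|
    pi (arr nat (univ 1000)) fun P => pi brw fun W => arr (isRankLim O P W)
      (arr (pi nat fun n => P n) (le w W))

def libRankLimFull : Lib := libRankLimMap.add (A := rankLimFullTy)
  (fn fun O => fn fun _ => fn fun hO => fn fun hw => fn fun P => fn fun W => fn fun h => fn fun a =>
    T.split (A := arr nat brw) (B := fun Z => prod 1000 (isRank O P Z) (isLimOf (diag Z) W)) 0 h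
      fun Z h => h.split 0 fun h l => hw.seqLeast <| fn fun k =>
        T.leTrans (libConjAll.next rankFullTy ⬝ O ⬝ P ⬝ Z ⬝ hO ⬝ h ⬝ a ⬝ k)
          ((leAddNat k).leTrans (l.seqLe k).cast)) (by decide +kernel)

def rankLimOutTy : Exp :=
  pi (arr nat brw) fun O => pi brw fun w => arr (omegaSteps O) <|
    arr (pi brw fun y => arr (lt y (O zero)) empty) <| arr (isLimOf O w) <|
    pi (arr nat (univ 1000)) fun P => pi brw fun W => arr (isRankLim O P W)
      (arr (le w W) (pi nat fun n => trunc 1000 (P n)))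

def libRankLimOut : Lib := libRankLimFull.add (A := rankLimOutTy)
  (fn fun O => fn fun _ => fn fun hO => fn fun hz => fn fun hw => fn fun P => fn fun W => fn fun h =>
    fn fun e => fn fun n =>
    T.split (A := arr nat brw) (B := fun Z => prod 1000 (isRank O P Z) (isLimOf (diag Z) W)) 1000 h
      fun Z h => h.split 1000 fun h l =>
    -- `conjShift P (n + 2)` computes to `conj P (n + 1)`, whose last factor is `P n`. One further
    -- multiple of `ω` makes a limit to strip, and another gives strictness.
    let m : T nat := n.succ.succ
    (l.seqInv ((omegaLt hO m.succ).leTrans ((hw.seqLe m.succ.succ).leTrans e))).exElim truncProp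
      fun k e =>
    let e' : T (le (O.tm (succ m)) (Z.tm k)) := T.strip
      (mk (A := arr nat brw) ⟨lam nat fun j => addNat (O.tm m) j⟩ (hO ⬝ m)) k
        (T.leOfLt (y := addNat (Z.tm k) k) e.cast)
    (h ⬝ k).untrunc truncProp fun c =>
    (c.snd.fst ⬝ (O ⬝ m) ⬝ ((omegaLt hO m).leTrans e')).untrunc truncProp fun c =>
    (libConjShiftAntitone.next rankCutConjTy ⬝ O ⬝ hO ⬝ hz ⬝ P ⬝ m ⬝ k ⬝ c).untrunc truncProp fun s =>
      (T.snd (s.cast (A' := prod 1000 (conj P n) (P.tm n)))).inTrunc) (by decide +kernel)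

def monoIterTy : Exp :=
  pi (arr nat brw) fun W => arr (pi nat fun m => le (W m) (W (succ m)))
    (pi nat fun m => pi nat fun k => le (W m) (W (natAdd m k)))

def libMonoIter : Lib := libRankLimOut.add (A := monoIterTy)
  (fn fun W => fn fun h => fn fun m => fn <| natElim 0 (fun k => le (W.tm m) (W.tm (natAdd m k)))
    (leRefl (x := W.tm m)).cast (fun k ih => (ih.leTrans (h ⬝ ⟨natAdd m k⟩)).cast)) (by decide +kernel)

/-- For a weakly increasing sequence `W`, there is `y` with `w + ω ≤ y` precisely if `w ≤ W m` for
some `m`. -/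
def diagBoundTy : Exp :=
  pi brw fun w => pi brw fun t => arr (isLim w) <| arr (isLimOf (lam nat fun k => addNat w k) t) <|
    pi (arr nat brw) fun W => arr (pi nat fun m => le (W m) (W (succ m))) <|
      sig 0 brw fun y => prod 0 (pi nat fun m => arr (le w (W m)) (le t y))
        (arr (le t y) (exist 0 nat fun m => le w (W m)))

def libDiagBound : Lib := libMonoIter.add (A := diagBoundTy)
  (fn fun w => fn fun t => fn fun hw => fn fun ht => fn fun W => fn fun hW =>
    let G (y : Exp) : Exp := prod 0 (pi nat fun m => arr (le w (W.tm m)) (le t y))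
      (arr (le t y) (exist 0 nat fun m => le w (W.tm m)))
    let finish : T (pi (increasing (diag W)) fun q => sig 0 brw G) := fn fun q =>
      let y : Exp := blim (diag W) q
      mk (A := brw) ⟨y⟩ <| T.cast (A := G y) <| mk
        (fn fun m => fn fun e => ht.seqLeast <| fn fun k => T.cast (A := le (addNat w k) y) <|
          -- At the index `m + k` the tree is still at least `w`, and at least `k` successors have
          -- been added.
          let i : T nat := ⟨natAdd m k⟩
          T.leCocone (f := diag W) i <| T.cast (A := le (addNat w k) (addNat (W.tm i) i)) <|
            (addNatMono k (e.leTrans (libRankLimOut.next monoIterTy ⬝ W ⬝ hW ⬝ m ⬝ k))).leTrans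
              (addNatLe (x := W.tm i) m k))
        (fn fun e =>
          -- Since `w < w + ω ≤ y`, some `W m + m` is above `w`; stripping the `m` successors uses
          -- that `w` is a limit.
          let l : T (lt w y) := T.leTrans (ht.seqLe ⟨succ zero⟩).cast e
          T.exElim (i := 0) (A := nat) (B := fun m => lt w (diag W m)) (T.limInv (f := diag W) (p := q) l)
            truncProp fun m e => exMk m (hw.strip m (T.leOfLt (y := addNat (W.tm m) m) e.cast)))
    finish ⬝ diagIncreasing hW) (by decide +kernel)

/-- The main result, for a sequence `O` with the properties of `k ↦ ω · k` -/
def existsForallTy : Exp :=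
  pi (arr nat brw) fun O => pi brw fun w => pi brw fun t => arr (omegaSteps O) <|
    arr (pi brw fun y => arr (lt y (O zero)) empty) <| arr (isLimOf O w) <|
    arr (isLimOf (lam nat fun k => addNat w k) t) <|
    pi (arr nat (arr nat (univ 1000))) fun P =>
      arr (pi nat fun m => pi nat fun n => isProp 1000 (P m n)) <|
      arr (pi nat fun m => pi nat fun n => monoSemiDec (P m n)) <|
      arr (pi nat fun m => pi nat fun n => arr (P m n) (P (succ m) n)) <|
      exist 1000 brw fun y => iff 1000 (exist 1000 nat fun m => pi nat fun n => P m n) (le t y)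

/-- The limits of the ranks are obtained for every `m` without truncation, so they form a sequence,
to which the diagonal bound applies. That the `P m n` are propositions removes the truncation left
by `rankLimOutTy`. -/
def existsForallPf : T existsForallTy :=
  fn fun O => fn fun w => fn fun t => fn fun hO => fn fun hz => fn fun hw => fn fun ht => fn fun P =>
  fn fun hP => fn fun hs => fn fun hm =>
    let G (y : Exp) : Exp := iff 1000 (exist 1000 nat fun m => pi nat fun n => P.tm m n) (le t y)
    let finish : T (arr (pi nat fun m => sig 1000 brw fun W => isRankLim O (P.tm m) W)
        (exist 1000 brw G)) := fn fun r =>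
      let r' (m : T nat) : T (sig 1000 brw fun W => isRankLim O (P.tm m) W) := r ⬝ m
      let W : Exp := lam nat fun m => (r' ⟨m⟩).fst
      let h (m : T nat) : T (isRankLim O (P ⬝ m) (r' m).fst) := (r' m).snd
      let d : T (sig 0 brw fun y => prod 0 (pi nat fun m => arr (le w (W m)) (le t y))
          (arr (le t y) (exist 0 nat fun m => le w (W m)))) :=
        libMonoIter.next diagBoundTy ⬝ w ⬝ t ⬝ mk (A := arr nat brw) (B := fun f => isLimOf f w) O hw ⬝
          ht ⬝ ⟨W⟩ ⬝ T.cast (A := pi nat fun m => le (r' ⟨m⟩).fst (r' ⟨succ m⟩).fst) (fn fun m =>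
            libRankLim.next rankLimMapTy ⬝ O ⬝ (P ⬝ m) ⬝ (P ⬝ m.succ) ⬝ (hm ⬝ m) ⬝ (r' m).fst ⬝
              (r' m.succ).fst ⬝ h m ⬝ h m.succ)
      T.split (A := brw) (B := fun y => prod 0 (pi nat fun m => arr (le w (W m)) (le t y))
          (arr (le t y) (exist 0 nat fun m => le w (W m)))) 1000 d fun y d =>
        exMk (A := brw) (B := G) y <| T.cast (A := G y) <| mk
          (fn fun e => T.exElim (A := nat) (B := fun m => pi nat fun n => P.tm m n) e leProp fun m a =>
            d.fst ⬝ m ⬝ T.cast (A := le w (r' m).fst)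
              (libRankLimMap.next rankLimFullTy ⬝ O ⬝ w ⬝ hO ⬝ hw ⬝ (P ⬝ m) ⬝ (r' m).fst ⬝ h m ⬝ a))
          (fn fun e => (d.snd ⬝ e).exElim truncProp fun m e => exMk m <| fn fun n =>
            (libRankLimFull.next rankLimOutTy ⬝ O ⬝ w ⬝ hO ⬝ hz ⬝ hw ⬝ (P ⬝ m) ⬝ (r' m).fst ⬝ h m ⬝
              e.cast ⬝ n).untrunc (hP ⬝ m ⬝ n) fun a => a)
    finish ⬝ fn fun m => libOmegaLt.next rankLimTy ⬝ O ⬝ (P ⬝ m) ⬝ hO ⬝ (hs ⬝ m)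

def libExistsForall : Lib := libDiagBound.add existsForallPf (by decide +kernel)

/-! ### The ordinal `ω² + ω` -/

/-- Up to here `ω · n` was an abstract sequence `O`, which spares the checker its unfolding. For the
concrete sequence the hypotheses on limits hold by reflexivity. -/
def omegaSeq : Exp := lam nat fun n => ordVal (omegaMul n)

def libOmegaSteps : Lib := libExistsForall.add (A := omegaSteps omegaSeq)
  (fn fun k => mk ⟨lam nat fun j => addNatRefl (omegaMul k) (succ j)⟩ rfl') (by decide +kernel)

def libOmegaSeqZero : Lib := libOmegaSteps.add (A := pi brw fun y => arr (lt y (omegaSeq zero)) empty)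
  (fn fun y => fn fun e => T.zeroInv (x := y) e.cast) (by decide +kernel)

def libOmegaSq : Lib := libOmegaSeqZero.add (A := isLimOf omegaSeq (ordVal omegaSq))
  (mk ⟨lam nat fun n => ltAddOmega (omegaMul n)⟩ rfl') (by decide +kernel)

def libOmegaSqAddOmega : Lib :=
  libOmegaSq.add (A := isLimOf (lam nat fun k => addNat (ordVal omegaSq) k) omegaSqAddOmega)
    (mk ⟨lam nat fun k => addNatRefl omegaSq (succ k)⟩ rfl') (by decide +kernel)

def existsForallOrdDecPf : T (existsForallOrdDec 1000) :=
  fn fun P => fn fun h => fn fun hm =>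
    -- The arguments are exchanged: the abstract result indexes its sequences of propositions by `m`
    -- first.
    let Q (m n : Exp) : Exp := holds 1000 (P.tm (pair 0 nat (fun _ => nat) n m))
    T.cast <| libDiagBound.next existsForallTy ⬝ ⟨omegaSeq⟩ ⬝ ⟨ordVal omegaSq⟩ ⬝ ⟨omegaSqAddOmega⟩ ⬝
      libExistsForall.next (omegaSteps omegaSeq) ⬝
      libOmegaSteps.next (pi brw fun y => arr (lt y (omegaSeq zero)) empty) ⬝
      libOmegaSeqZero.next (isLimOf omegaSeq (ordVal omegaSq)) ⬝
      libOmegaSq.next (isLimOf (lam nat fun k => addNat (ordVal omegaSq) k) omegaSqAddOmega) ⬝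
      ⟨lam nat fun m => lam nat fun n => Q m n⟩ ⬝
      T.cast (A := pi nat fun m => pi nat fun n => isProp 1000 (Q m n)) (fn fun m => fn fun n =>
        T.cast (T.snd (i := 1001) (A := univ 1000) (B := fun X => isProp 1000 X)
          ⟨P.tm (pair 0 nat (fun _ => nat) n m)⟩)) ⬝
      T.cast (A := pi nat fun m => pi nat fun n => monoSemiDec (Q m n)) (fn fun m => fn fun n =>
        libMonoAddLeft.next ofSemiDecTy ⬝ ⟨Q m n⟩ ⬝ (h ⬝ n ⬝ m)) ⬝
      T.cast (A := pi nat fun m => pi nat fun n => arr (Q m n) (Q (succ m) n)) (fn fun m => fn fun n =>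
        hm ⬝ n ⬝ m)

theorem provable_existsForallOrdDec (i : ℕ) : Provable (existsForallOrdDec i) :=
  libOmegaSqAddOmega.provable existsForallOrdDecPf i _ (by decide +kernel) (by decide +kernel) rfl


/-! ### Decidable types -/

def dec (A : Exp) : Exp := sum 0 A (arr A empty)

def semiDecOfDecTy : Exp := pi (univ 0) fun A => arr (dec A) (isSemiDec 0 A)

/-- A constant Boolean sequence, with value according to the decision. The library branches off at
`libFfNeTt`; the arithmetic does not depend on the theory of ranks. -/
def libSemiDecOfDec : Lib := libFfNeTt.add (A := semiDecOfDecTy)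
  (fn fun A => fn fun d =>
    let B (s : Exp) : Exp := iff 0 A (exist 0 nat fun k => isTt (s k))
    T.cases (A := A) (B := arr A empty) 0 d
      (fun a => exMk (A := arr nat bool) (B := B) ⟨lam nat fun _ => tt⟩ <|
        T.cast (A := iff 0 A (exist 0 nat fun _ => isTt tt)) <|
          mk (fn fun _ => exMk ⟨zero⟩ rfl') (fn fun _ => a))
      (fun f => exMk (A := arr nat bool) (B := B) ⟨lam nat fun _ => ff⟩ <|
        T.cast (A := prod 0 (arr A (exist 0 nat fun _ => isTt ff)) (arr (exist 0 nat fun _ => isTt ff) A)) <|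
          mk (fn fun a => (f ⬝ a).absurd 0)
            (fn fun t => (t.exElim emptyProp fun _ p => p.ffNeTt).absurd 0))) (by decide +kernel)

def decMapTy : Exp :=
  pi (univ 0) fun A => pi (univ 0) fun B => arr (arr A B) (arr (arr B A) (arr (dec A) (dec B)))

def libDecMap : Lib := libSemiDecOfDec.add (A := decMapTy)
  (fn fun A => fn fun B => fn fun f => fn fun g => fn fun d =>
    T.cases (A := A) (B := arr A empty) 0 d (fun a => inl (f ⬝ a))
      (fun h => inr (fn fun b => h ⬝ (g ⬝ b)))) (by decide +kernel)

def decMap {A B : Exp} (f : T (arr A B)) (g : T (arr B A)) (d : T (dec A)) : T (dec B) :=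
  libSemiDecOfDec.next decMapTy ⬝ ⟨A⟩ ⬝ ⟨B⟩ ⬝ f ⬝ g ⬝ d

def decArrTy : Exp :=
  pi (univ 0) fun A => pi (univ 0) fun B => arr (dec A) (arr (dec B) (dec (arr A B)))

def libDecArr : Lib := libDecMap.add (A := decArrTy)
  (fn fun A => fn fun B => fn fun d => fn fun d' =>
    T.cases (A := B) (B := arr B empty) 0 d' (fun b => inl (fn fun _ => b)) fun h' =>
    T.cases (A := A) (B := arr A empty) 0 d (fun a => inr (fn fun f => h' ⬝ (f ⬝ a)))
      (fun h => inl (fn fun a => (h ⬝ a).absurd 0))) (by decide +kernel)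

def decArr {A B : Exp} (d : T (dec A)) (d' : T (dec B)) : T (dec (arr A B)) :=
  libDecMap.next decArrTy ⬝ ⟨A⟩ ⬝ ⟨B⟩ ⬝ d ⬝ d'

def decProdTy : Exp :=
  pi (univ 0) fun A => pi (univ 0) fun B => arr (dec A) (arr (dec B) (dec (prod 0 A B)))

def libDecProd : Lib := libDecArr.add (A := decProdTy)
  (fn fun A => fn fun B => fn fun d => fn fun d' =>
    T.cases (A := A) (B := arr A empty) 0 d
      (fun a => T.cases (A := B) (B := arr B empty) 0 d' (fun b => inl (mk a b))
        (fun h => inr (fn fun p => h ⬝ p.snd)))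
      (fun h => inr (fn fun p => h ⬝ p.fst))) (by decide +kernel)

def decProd {A B : Exp} (d : T (dec A)) (d' : T (dec B)) : T (dec (prod 0 A B)) :=
  libDecArr.next decProdTy ⬝ ⟨A⟩ ⬝ ⟨B⟩ ⬝ d ⬝ d'

def decEmpty : T (dec empty) := inr (fn fun e => e)

/-- A universal statement about numbers is decidable if its instances are decidable and hold from
some number on. -/
def decForallTy : Exp :=
  pi nat fun N => pi (arr nat (univ 0)) fun D => arr (pi nat fun a => dec (D a))
    (arr (pi nat fun j => D (natAdd j N)) (dec (pi nat fun a => D a)))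

/-- Induction on `N` with the predicate generalized: the statement splits into the instance at `0`
and the statement for the shifted predicate, whose bound is smaller by one. -/
def libDecForall : Lib := libDecProd.add (A := decForallTy)
  (fn <| natElim 1 (fun N => pi (arr nat (univ 0)) fun D => arr (pi nat fun a => dec (D a))
      (arr (pi nat fun j => D (natAdd j N)) (dec (pi nat fun a => D a))))
    (fn fun D => fn fun _ => fn fun h => inl (T.cast (A := pi nat fun j => D.tm (natAdd j zero)) h))
    (fun N ih => fn fun D => fn fun d => fn fun h => decMap
      (A := prod 0 (D.tm zero) (pi nat fun a => D.tm (succ a)))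
      (fn fun p => fn fun a => natElim 0 (fun a => D.tm a) p.fst (fun a _ => p.snd ⬝ a) a)
      (fn fun f => mk (f ⬝ ⟨zero⟩) (fn fun a => f ⬝ a.succ))
      (decProd (d ⬝ ⟨zero⟩) <| T.cast <| ih ⬝ ⟨lam nat fun a => D.tm (succ a)⟩ ⬝
        T.cast (A := pi nat fun a => dec (D.tm (succ a))) (fn fun a => d ⬝ a.succ) ⬝ h.cast)))
  (by decide +kernel)

def decForall {D : Exp → Exp} (N : T nat) (d : T (pi nat fun a => dec (D a)))
    (h : T (pi nat fun j => D (natAdd j N))) : T (dec (pi nat D)) :=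
  (libDecProd.next decForallTy ⬝ N ⬝ ⟨lam nat D⟩ ⬝ d.cast ⬝ h.cast).cast

/-! ### Natural numbers -/

def succNeZeroTy : Exp := pi nat fun n => arr (eq 0 nat (succ n) zero) empty

def libSuccNeZero : Lib := libDecForall.add (A := succNeZeroTy)
  (fn fun n => fn fun p =>
    let D (k : Exp) : Exp :=
      con (.natInd 1) (lam nat fun _ => univ 0) empty (lam nat fun _ => lam (univ 0) fun _ => unit) k
    (T.subst 0 D p (star.cast (A' := D (succ n)))).cast) (by decide +kernel)

def T.succNeZero {n : Exp} (p : T (eq 0 nat (HoTT.succ n) zero)) : T empty :=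
  libDecForall.next succNeZeroTy ⬝ ⟨n⟩ ⬝ p

def decNatEqTy : Exp := pi nat fun m => pi nat fun n => dec (eq 0 nat m n)

def libDecNatEq : Lib := libSuccNeZero.add (A := decNatEqTy)
  (fn <| natElim 0 (fun m => pi nat fun n => dec (eq 0 nat m n))
    (fn <| natElim 0 (fun n => dec (eq 0 nat zero n)) (inl rfl')
      (fun n _ => inr (fn fun p => p.symm₀.succNeZero)))
    (fun m ih => fn <| natElim 0 (fun n => dec (eq 0 nat (succ m) n)) (inr (fn fun p => p.succNeZero))
      (fun n _ => decMap (A := eq 0 nat m n) (fn fun p => p.ap 0 succ)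
        (fn fun p =>
          let pred (k : Exp) : Exp := con (.natInd 0) (lam nat fun _ => nat) zero
            (lam nat fun k => lam nat fun _ => k) k
          (T.ap (A' := nat) 0 pred p).cast) (ih ⬝ n)))) (by decide +kernel)

/-- The order of the natural numbers, defined by recursion -/
def natLeRec (x y : Exp) : Exp :=
  con (.natInd 1) (lam nat fun _ => arr nat (univ 0)) (lam nat fun _ => unit)
    (lam nat fun _ => lam (arr nat (univ 0)) fun r => lam nat fun y =>
      con (.natInd 1) (lam nat fun _ => univ 0) empty (lam nat fun y => lam (univ 0) fun _ => r y) y) x y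

def natLeRecSuccTy : Exp :=
  pi nat fun x => pi nat fun y => arr (natLeRec x y) (natLeRec x (succ y))

def libNatLeRecSucc : Lib := libDecNatEq.add (A := natLeRecSuccTy)
  (fn <| natElim 0 (fun x => pi nat fun y => arr (natLeRec x y) (natLeRec x (succ y)))
    (fn fun _ => fn fun _ => star.cast)
    (fun x ih => fn <| natElim 0 (fun y => arr (natLeRec (succ x) y) (natLeRec (succ x) (succ y)))
      (fn fun e => (T.cast (A := natLeRec (succ x) zero) e).absurd 0)
      (fun y _ => T.cast (ih ⬝ y)))) (by decide +kernel)

def natLeRecAddTy : Exp :=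
  pi nat fun x => pi nat fun y => pi nat fun k => arr (natLeRec x y) (natLeRec x (natAdd y k))

def libNatLeRecAdd : Lib := libNatLeRecSucc.add (A := natLeRecAddTy)
  (fn fun x => fn fun y => fn fun k => fn fun e => natElim 0 (fun k => natLeRec x (natAdd y k))
    e.cast (fun k ih => (libDecNatEq.next natLeRecSuccTy ⬝ x ⬝ ⟨natAdd y k⟩ ⬝ ih).cast) k)
  (by decide +kernel)

def natLeRecAdd {x y : Exp} (k : T nat) (e : T (natLeRec x y)) : T (natLeRec x (natAdd y k)) :=
  libNatLeRecSucc.next natLeRecAddTy ⬝ ⟨x⟩ ⬝ ⟨y⟩ ⬝ k ⬝ e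

def natLeRecReflTy : Exp := pi nat fun m => pi nat fun a => natLeRec a (natAdd m a)

def libNatLeRecRefl : Lib := libNatLeRecAdd.add (A := natLeRecReflTy)
  (fn fun m => fn <| natElim 0 (fun a => natLeRec a (natAdd m a)) star.cast (fun _ ih => ih.cast))
  (by decide +kernel)

def natLeRecIrreflTy : Exp := pi nat fun j => pi nat fun p => arr (natLeRec (natAdd j (succ p)) p) empty

def libNatLeRecIrrefl : Lib := libNatLeRecRefl.add (A := natLeRecIrreflTy)
  (fn fun j => fn <| natElim 0 (fun p => arr (natLeRec (natAdd j (succ p)) p) empty)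
    (fn fun e => e.cast) (fun _ ih => ih.cast)) (by decide +kernel)

def zeroAddTy : Exp := pi nat fun n => eq 0 nat (natAdd zero n) n

def libZeroAdd : Lib := libNatLeRecIrrefl.add (A := zeroAddTy)
  (fn <| natElim 0 (fun n => eq 0 nat (natAdd zero n) n) rfl' (fun _ ih => T.cast (T.ap (A' := nat) 0 succ ih)))
  (by decide +kernel)

def succAddTy : Exp := pi nat fun m => pi nat fun n => eq 0 nat (natAdd (succ m) n) (succ (natAdd m n))

def libSuccAdd : Lib := libZeroAdd.add (A := succAddTy)
  (fn fun m => fn <| natElim 0 (fun n => eq 0 nat (natAdd (succ m) n) (succ (natAdd m n))) rfl'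
    (fun _ ih => T.cast (T.ap (A' := nat) 0 succ ih))) (by decide +kernel)

def natLeOfRecTy : Exp := pi nat fun x => pi nat fun y => arr (natLeRec x y) (natLe x y)

def libNatLeOfRec : Lib := libSuccAdd.add (A := natLeOfRecTy)
  (fn <| natElim 0 (fun x => pi nat fun y => arr (natLeRec x y) (natLe x y))
    (fn fun y => fn fun _ => mk y (libNatLeRecIrrefl.next zeroAddTy ⬝ y))
    (fun x ih => fn <| natElim 0 (fun y => arr (natLeRec (succ x) y) (natLe (succ x) y))
      (fn fun e => (T.cast (A := natLeRec (succ x) zero) e).absurd 0)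
      (fun y _ => fn fun e => T.split (A := nat) (B := fun k => eq 0 nat (natAdd x k) y) 0
        (ih ⬝ y ⬝ e.cast) fun k p => mk k <|
          T.trans₀ (libZeroAdd.next succAddTy ⬝ x ⬝ k) (p.ap 0 succ)))) (by decide +kernel)

def recOfNatLeTy : Exp := pi nat fun x => pi nat fun y => arr (natLe x y) (natLeRec x y)

def libRecOfNatLe : Lib := libNatLeOfRec.add (A := recOfNatLeTy)
  (fn fun x => fn fun y => fn fun h => T.split (A := nat) (B := fun k => eq 0 nat (natAdd x k) y) 0 h
    fun k p => p.subst 0 (fun y => natLeRec x y) <| natLeRecAdd k <| T.subst 0 (fun y => natLeRec x y)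
      (libNatLeRecIrrefl.next zeroAddTy ⬝ x) (libNatLeRecAdd.next natLeRecReflTy ⬝ ⟨zero⟩ ⬝ x))
  (by decide +kernel)

def decNatLeTy : Exp := pi nat fun x => pi nat fun y => dec (natLe x y)

def libDecNatLe : Lib := libRecOfNatLe.add (A := decNatLeTy)
  (fn fun x => fn fun y => decMap (A := natLeRec x y) (libSuccAdd.next natLeOfRecTy ⬝ x ⬝ y)
    (libNatLeOfRec.next recOfNatLeTy ⬝ x ⬝ y) <|
    natElim 0 (fun x => pi nat fun y => dec (natLeRec x y)) (fn fun _ => T.cast (A := dec unit) (inl star))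
      (fun x ih => fn <| natElim 0 (fun y => dec (natLeRec (succ x) y)) (decEmpty.cast)
        (fun y _ => T.cast (ih ⬝ y))) x ⬝ y) (by decide +kernel)

def decNatLe (x y : T nat) : T (dec (natLe x y)) := libRecOfNatLe.next decNatLeTy ⬝ x ⬝ y

/-! ### Twin primes -/

def libTwoLeZero : Lib := libDecNatLe.add (A := arr (natLe two zero) empty)
  (fn fun h => T.split (A := nat) (B := fun k => eq 0 nat (natAdd two k) zero) 0 h fun k p =>
    natElim 0 (fun k => arr (eq 0 nat (natAdd two k) zero) empty)
      (fn fun p => T.succNeZero (n := succ zero) p.cast)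
      (fun k _ => fn fun p => T.succNeZero (n := natAdd two k) p.cast) k ⬝ p) (by decide +kernel)

def T.twoLeZero (h : T (natLe two zero)) : T empty :=
  libDecNatLe.next (arr (natLe two zero) empty) ⬝ h

/-- The factors of `p` are at most `p`. -/
def leftFactorTy : Exp :=
  pi nat fun p => pi nat fun j => pi nat fun b => arr (natLe two b)
    (arr (eq 0 nat (natMul (natAdd j (succ p)) b) p) empty)

/-- For `b = b' + 1` the product computes to `a * b' + a`, which is at least `a = j + (p + 1)` and
so cannot be `p`. -/
def libLeftFactor : Lib := libTwoLeZero.add (A := leftFactorTy)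
  (fn fun p => fn fun j =>
    let a : Exp := natAdd j (succ p)
    fn <| natElim 0 (fun b => arr (natLe two b) (arr (eq 0 nat (natMul a b) p) empty))
      (fn fun h => h.twoLeZero.absurd 0)
      (fun b _ => fn fun _ => fn fun e => libNatLeRecRefl.next natLeRecIrreflTy ⬝ j ⬝ p ⬝
        e.subst 0 (fun m => natLeRec a m)
          (T.cast (libNatLeRecAdd.next natLeRecReflTy ⬝ ⟨natMul a b⟩ ⬝ ⟨a⟩)))) (by decide +kernel)

def leMulTy : Exp := pi nat fun a => pi nat fun b => natLeRec b (natMul (succ a) b)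

def libLeMul : Lib := libLeftFactor.add (A := leMulTy)
  (fn fun a => fn <| natElim 0 (fun b => natLeRec b (natMul (succ a) b)) star.cast
    (fun _ ih => T.cast (natLeRecAdd a ih))) (by decide +kernel)

def rightFactorTy : Exp :=
  pi nat fun p => pi nat fun j => pi nat fun a => arr (natLe two a)
    (arr (eq 0 nat (natMul a (natAdd j (succ p))) p) empty)

def libRightFactor : Lib := libLeMul.add (A := rightFactorTy)
  (fn fun p => fn fun j =>
    let b : Exp := natAdd j (succ p)
    fn <| natElim 0 (fun a => arr (natLe two a) (arr (eq 0 nat (natMul a b) p) empty))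
      (fn fun h => h.twoLeZero.absurd 0)
      (fun a _ => fn fun _ => fn fun e => libNatLeRecRefl.next natLeRecIrreflTy ⬝ j ⬝ p ⬝
        e.subst 0 (fun m => natLeRec b m) (libLeftFactor.next leMulTy ⬝ a ⬝ ⟨b⟩))) (by decide +kernel)

def decPrimeTy : Exp := pi nat fun p => dec (isPrime p)

/-- The condition on factors holds trivially as soon as one of them exceeds `p`, so both universal
quantifiers are decided with the bound `p + 1`. -/
def libDecPrime : Lib := libRightFactor.add (A := decPrimeTy)
  (fn fun p =>
    let D (a b : Exp) : Exp :=
      arr (natLe two a) (arr (natLe two b) (arr (eq 0 nat (natMul a b) p) empty))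
    T.cast (A := dec (prod 0 (natLe two p) (pi nat fun a => pi nat fun b => D a b))) <|
    decProd (decNatLe ⟨two⟩ p) <| decForall (D := fun a => pi nat fun b => D a b) p.succ
      (fn fun a => decForall (D := D a) p.succ
        (fn fun b => decArr (decNatLe ⟨two⟩ a) <| decArr (decNatLe ⟨two⟩ b) <|
          decArr (libSuccNeZero.next decNatEqTy ⬝ ⟨natMul a b⟩ ⬝ p) decEmpty)
        (fn fun j => fn fun h => fn fun _ => libLeMul.next rightFactorTy ⬝ p ⬝ j ⬝ a ⬝ h))
      (fn fun j => fn fun b => fn fun _ => fn fun h =>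
        libTwoLeZero.next leftFactorTy ⬝ p ⬝ j ⬝ b ⬝ h)) (by decide +kernel)

/-- The statement that `n` is not a counterexample to the finiteness of twin primes from `m` on -/
def noTwinPrime (m n : Exp) : Exp :=
  arr (natLe m n) (arr (prod 0 (isPrime n) (isPrime (natAdd n two))) empty)

def decNoTwinPrimeTy : Exp := pi nat fun n => pi nat fun m => dec (noTwinPrime m n)

def libDecNoTwinPrime : Lib := libDecPrime.add (A := decNoTwinPrimeTy)
  (fn fun n => fn fun m =>
    let d := libRightFactor.next decPrimeTy
    decArr (decNatLe m n) (decArr (decProd (d ⬝ n) (d ⬝ ⟨natAdd n two⟩)) decEmpty)) (by decide +kernel)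

def noTwinPrimeSuccTy : Exp :=
  pi nat fun n => pi nat fun m => arr (noTwinPrime m n) (noTwinPrime (succ m) n)

def libNoTwinPrimeSucc : Lib := libDecNoTwinPrime.add (A := noTwinPrimeSuccTy)
  (fn fun n => fn fun m => fn fun f =>
    let R : Exp := arr (prod 0 (isPrime n) (isPrime (natAdd n two))) empty
    let f : T (arr (natLe m n) R) := f
    T.cast (A := arr (natLe (succ m) n) R) <| fn fun h => T.app f <| T.split (A := nat) (B := fun k => eq 0 nat (natAdd (succ m) k) n) 0 h fun k p =>
      T.cast (A := sig 0 nat fun k => eq 0 nat (natAdd m k) n) <|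
      mk k.succ (T.cast <| (T.symm₀ (libZeroAdd.next succAddTy ⬝ m ⬝ k)).trans₀ p)) (by decide +kernel)

/-- The general theorem at level `0` is a hypothesis here, because it belongs to the other branch of
the library; `Provable.mp` joins the two. -/
def twinPrimePf : T (arr (existsForallOrdDec 0)
    (isOrdDec 0 omegaSqAddOmega twinPrimeCounterexample)) :=
  fn fun main =>
    let P : T (arr (prod 0 nat nat) (hProp 0)) := fn fun p =>
      let n := T.fst p
      let m := T.snd p
      mkProp (X := noTwinPrime m n) (isPropArr (X := natLe m n)
        (isPropArr (X := prod 0 (isPrime n) (isPrime (natAdd n two))) emptyProp))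
    T.cast <| T.app (A := arr (prod 0 nat nat) (hProp 0)) main P ⬝
      T.cast (A := pi nat fun n => pi nat fun m => isSemiDec 0 (noTwinPrime m n))
        (fn fun n => fn fun m => libFfNeTt.next semiDecOfDecTy ⬝ ⟨noTwinPrime m n⟩ ⬝
          (libDecPrime.next decNoTwinPrimeTy ⬝ n ⬝ m)) ⬝
      T.cast (libDecNoTwinPrime.next noTwinPrimeSuccTy)

/-- In `arr A B` the type `B` stands under one binder. The hypothesis `hB` says that its raw term
does not depend on that depth. -/
theorem Provable.mp {A B : Exp} (h : Provable (arr A B)) (hA : Provable A)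
    (hB : B.atDepth 1 = B.close) (hc : B.close.closedAt 0 = true) : Provable B := by
  obtain ⟨f, hf⟩ := h
  obtain ⟨a, ha⟩ := hA
  have := HasType.app hf ha
  change HasType [] _ ((B.atDepth 1).inst a) at this
  rw [hB, Tm.inst, Tm.subst_closed _ 0 _ (by simp) hc] at this
  exact ⟨_, this⟩

end HoTT

theorem theorem7p12 :
    (∀ i : ℕ, HoTT.Provable (HoTT.existsForallOrdDec i)) ∧
      HoTT.Provable
        (HoTT.isOrdDec 0 HoTT.omegaSqAddOmega HoTT.twinPrimeCounterexample) := by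
  refine ⟨HoTT.provable_existsForallOrdDec, ?_⟩
  refine HoTT.Provable.mp ?_ (HoTT.provable_existsForallOrdDec 0) rfl (by decide +kernel)
  exact HoTT.libNoTwinPrimeSucc.provable HoTT.twinPrimePf 0 _ (by decide +kernel) (by decide +kernel) rfl
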